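/- Let $p$ be an odd prime, $u$ a topological generator of $1+p\mathbb Z_p$, $\omega$ the Teichmüller character, $m\ge 0$ an integer, and $R=\mathbb Q_p\langle w\rangle$ the Tate algebra. Let $\mathcal A^\dagger$ be the space of power series over $\mathbb Q_p$ in $z$ that converge on some disc of radius $>1$ (with the inductive limit topology), and $\mathcal D^\dagger(R)=\mathrm{Hom}_{\mathrm{cont}}(\mathcal A^\dagger,R)$. For $a\in\mathbb Z_p^\times$, $c\in p\mathbb Z_p$ put $$K_{a,c,m}(z,w)=\omega(a)^m\sum_{n\ge0}\binom{\log\left(\frac{a+cz}{\omega(a)}\right)/\log u}{n}(pw)^n ,$$ and let $\gamma=\begin{pmatrix}a&b\\c&d\end{pmatrix}\in M_2(\mathbb Z_p)$ with $a\in\mathbb Z_p^\times$, $c\in p\mathbb Z_p$, $\det\gamma\ne0$ act on $\mathcal D^\dagger(R)$ by $$(\mu|\gamma)(f)=\mu\Bigl(K_{a,c,m}(z,w)\,f\Bigl(\frac{b+dz}{a+cz}\Bigr)\Bigr),$$ where $\mu$ is extended $R$-linearly and continuously. Let $\mu_j\in\mathcal D^\dagger(R)$ be the distribution whose $j$-th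 moment $\mu_j(z^j)$ is $1$ and whose other moments vanish. The total measure of $\mu$ is $\mu(\mathbf 1)$. Let $\Gamma$ be a congruence subgroup of $\mathrm{SL}_2(\mathbb Z)$ such that $\Gamma_0=\Gamma\cap\Gamma_0(p)$ is torsion-free and contains $T=\begin{pmatrix}1&1\\0&1\end{pmatrix}$, and let $\Delta_0=\mathrm{Div}^0(\mathbb P^1(\mathbb Q))$. Say that $\gamma_1,\dots,\gamma_t\in\Gamma_0$ and $D_1,\dots,D_t\in\Delta_0$ solve the Manin relations if $\{0\}-\{\infty\},D_1,\dots,D_t$ generate the $\mathbb Z[\Gamma_0]$-module $\Delta_0$ and all relations between them are multiples of the single relation $$(T^{-1}-1)(\{0\}-\{\infty\})=\sum_{j=1}^t(\gamma_j^{-1}-1)D_j .$$ (A) There are $t$, $\gamma_j=\begin{pmatrix}a_j&b_j\\c_j&d_j\end{pmatrix}$ and $D_j$ that solve the Manin relations, with $c_j\neq0$ for all $j$. (B) Let $\gamma_1,\dots,\gamma_t\in\Gamma_0$, with entries $a_j,b_j,c_j,d_j$ as in (A), let $v_1',\dots,v_t'\in\mathcal D^\dagger(R)$ be arbitrary, and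 set $$g=-\Bigl(\sum_{j=1}^t v_j'|(\gamma_j-1)\Bigr)(\mathbf 1).$$ If $m\equiv0\pmod{p-1}$, fix any $i$ with $c_i\ne0$ and put $h=\frac{\partial}{\partial z}K_{a_i,c_i,m}(z,w)\big|_{z=0}$ and $k=1$. If $m\not\equiv0\pmod{p-1}$, fix any $i$ with $a_i^m\not\equiv1\pmod p$ and put $h=K_{a_i,c_i,m}(0,w)-1$ and $k=0$. Set $v_j=v_j'$ for $j\ne i$ and $v_i=v_i'+\frac{g}{h}\,\mu_k$. Then, in either case, $h\ne0$ and $g/h\in R$, so that $v_j\in\mathcal D^\dagger(R)$ for all $j$; the sum $\sum_{j=1}^t v_j|(\gamma_j-1)$ has total measure zero; and whenever $D_1,\dots,D_t$ together with $\gamma_1,\dots,\gamma_t$ solve the Manin relations, there is a $\mathcal D^\dagger(R)$-valued modular symbol $\widetilde\Phi$ of level $\Gamma_0$, that is, a homomorphism $\widetilde\Phi:\Delta_0\to\mathcal D^\dagger(R)$ with $\widetilde\Phi(\gamma D)=\widetilde\Phi(D)|\gamma^{-1}$ for all $\gamma\in\Gamma_0$, $D\in\Delta_0$, such that $\widetilde\Phi(D_j)=v_j$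 for all $j$. -/

import Mathlib

open scoped MatrixGroups PowerSeries

noncomputable section

namespace HidaFamilies

/-! ### Power series, the Tate algebra `R`, overconvergent functions and distributions -/

section Distributions

variable (p : ℕ) [Fact p.Prime]

/-- The norm `‖f‖ = sup_n |a_n| r ^ n` of `f = ∑ a_n z ^ n`. It is finite for those `f` that
converge on the closed disc of radius `r`, the only ones for which it is used. -/
def discNorm (r : ℝ) (f : ℚ_[p]⟦X⟧) : ℝ :=
  PowerSeries.gaussNorm (fun a : ℚ_[p] => ‖a‖) r f

variable {p}

theorem coeff_le_discNorm {r : ℝ} {f : ℚ_[p]⟦X⟧} (hf : PowerSeries.IsRestricted r f) (n : ℕ) :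
    ‖PowerSeries.coeff n f‖ * r ^ n ≤ discNorm p r f := by
  apply PowerSeries.le_gaussNorm
  exact ((PowerSeries.isRestricted_iff' r f).1 hf).bddAbove_range

theorem discNorm_nonneg (r : ℝ) (f : ℚ_[p]⟦X⟧) : 0 ≤ discNorm p r f :=
  PowerSeries.gaussNorm_nonneg _ _ _ fun _ => norm_nonneg _

theorem discNorm_one_le {f : ℚ_[p]⟦X⟧} {B : ℝ} (h : ∀ n, ‖PowerSeries.coeff n f‖ ≤ B) :
    discNorm p 1 f ≤ B := by
  rw [discNorm, PowerSeries.gaussNorm_eq]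
  exact ciSup_le fun n => by simpa using h n

theorem isRestricted_anti {r s : ℝ} (hs : 0 ≤ s) (hsr : s ≤ r) {f : ℚ_[p]⟦X⟧}
    (hf : PowerSeries.IsRestricted r f) : PowerSeries.IsRestricted s f := by
  rw [PowerSeries.isRestricted_iff'] at hf ⊢
  exact squeeze_zero (fun n => by positivity) (fun n => by gcongr) hf

variable (p)

/-- The Tate algebra `R = ℚ_p⟨w⟩`, the functions on the closed disc of weights
(with `w = W / p`): power series in `w` whose coefficients tend to `0`. -/
def Tate : Subalgebra ℚ_[p] ℚ_[p]⟦X⟧ where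
  __ := PowerSeries.IsRestricted.subring (R := ℚ_[p]) 1
  algebraMap_mem' a := PowerSeries.isRestricted_C 1 a

/-- The space `𝒜†` of power series in `z` over `ℚ_p` that converge on some closed disc of
radius `r > 1`. -/
def Adag : Submodule ℚ_[p] ℚ_[p]⟦X⟧ where
  carrier := {f | ∃ r : ℝ, 1 < r ∧ PowerSeries.IsRestricted r f}
  zero_mem' := ⟨2, one_lt_two, PowerSeries.isRestricted_zero 2⟩
  add_mem' := by
    rintro f g ⟨r, hr, hf⟩ ⟨s, hs, hg⟩
    refine ⟨min r s, lt_min hr hs, ?_⟩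
    have h0 : (0 : ℝ) ≤ min r s := (zero_lt_one.trans (lt_min hr hs)).le
    exact PowerSeries.isRestricted.add _ (isRestricted_anti h0 (min_le_left _ _) hf)
      (isRestricted_anti h0 (min_le_right _ _) hg)
  smul_mem' := by
    rintro a f ⟨r, hr, hf⟩
    refine ⟨r, hr, ?_⟩
    have h := PowerSeries.isRestricted.mul r (PowerSeries.isRestricted_C r a) hf
    rwa [← PowerSeries.smul_eq_C_mul] at h

/-- The monomial `z ^ j` as an element of `𝒜†`. -/
def monom (j : ℕ) : Adag p :=
  ⟨PowerSeries.X ^ j, 2, one_lt_two, by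
    rw [PowerSeries.X_pow_eq]; exact PowerSeries.isRestricted_monomial 2 j 1⟩

/-- `𝒟†(R) = Hom_cont(𝒜†, R)`: the `ℚ_p`-linear maps `μ : 𝒜† → R` that are continuous for the
inductive limit topology, that is, whose restriction to the Banach space of power series
converging on the closed disc of radius `r` is bounded, for every `r > 1`. -/
def Ddag : Submodule (Tate p) (Adag p →ₗ[ℚ_[p]] Tate p) where
  carrier := {μ | ∀ r : ℝ, 1 < r → ∃ C : ℝ, ∀ f : Adag p,
    PowerSeries.IsRestricted r (f : ℚ_[p]⟦X⟧) →
      discNorm p 1 (μ f : ℚ_[p]⟦X⟧) ≤ C * discNorm p r (f : ℚ_[p]⟦X⟧)}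
  zero_mem' := by
    intro r _
    refine ⟨0, fun f _ => ?_⟩
    rw [zero_mul]
    exact discNorm_one_le fun n => by simp
  add_mem' := by
    intro μ ν hμ hν r hr
    obtain ⟨C, hC⟩ := hμ r hr
    obtain ⟨C', hC'⟩ := hν r hr
    refine ⟨C + C', fun f hf => discNorm_one_le fun n => ?_⟩
    have h1 := coeff_le_discNorm (μ f).2 n
    have h2 := coeff_le_discNorm (ν f).2 n
    rw [one_pow, mul_one] at h1 h2
    have h3 := norm_add_le (PowerSeries.coeff n (μ f : ℚ_[p]⟦X⟧))
      (PowerSeries.coeff n (ν f : ℚ_[p]⟦X⟧))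
    have h4 : PowerSeries.coeff n (((μ + ν) f : Tate p) : ℚ_[p]⟦X⟧) =
        PowerSeries.coeff n (μ f : ℚ_[p]⟦X⟧) + PowerSeries.coeff n (ν f : ℚ_[p]⟦X⟧) := by
      simp
    rw [h4, add_mul]
    linarith [hC f hf, hC' f hf]
  smul_mem' := by
    intro q μ hμ r hr
    obtain ⟨C, hC⟩ := hμ r hr
    refine ⟨discNorm p 1 (q : ℚ_[p]⟦X⟧) * C, fun f hf => ?_⟩
    rw [mul_assoc]
    refine le_trans (discNorm_one_le fun n => ?_)
      (mul_le_mul_of_nonneg_left (hC f hf) (discNorm_nonneg _ _))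
    have h : (((q • μ) f : Tate p) : ℚ_[p]⟦X⟧) = (q : ℚ_[p]⟦X⟧) * (μ f : ℚ_[p]⟦X⟧) := by
      simp
    rw [h, PowerSeries.coeff_mul]
    refine IsUltrametricDist.norm_sum_le_of_forall_le_of_nonneg
      (mul_nonneg (discNorm_nonneg _ _) (discNorm_nonneg _ _)) fun x _ => ?_
    rw [norm_mul]
    have h1 := coeff_le_discNorm q.2 x.1
    have h2 := coeff_le_discNorm (μ f).2 x.2
    rw [one_pow, mul_one] at h1 h2
    exact mul_le_mul h1 h2 (norm_nonneg _) (discNorm_nonneg _ _)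

/-- The distribution `μ_j`, whose `j`-th moment is `1` and whose other moments vanish. -/
def momentDist (j : ℕ) : Ddag p :=
  ⟨{ toFun := fun f => algebraMap ℚ_[p] (Tate p) (PowerSeries.coeff j (f : ℚ_[p]⟦X⟧))
     map_add' := fun f g => by simp
     map_smul' := fun a f => by simp [Algebra.smul_def] }, by
    intro r hr
    refine ⟨1, fun f hf => ?_⟩
    rw [one_mul]
    refine discNorm_one_le fun n => ?_
    have h1 := coeff_le_discNorm hf j
    have h2 : ‖PowerSeries.coeff j (f : ℚ_[p]⟦X⟧)‖ ≤ discNorm p r (f : ℚ_[p]⟦X⟧) :=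
      le_trans (le_mul_of_one_le_right (norm_nonneg _) (one_le_pow₀ hr.le)) h1
    have h3 : ((algebraMap ℚ_[p] (Tate p) (PowerSeries.coeff j (f : ℚ_[p]⟦X⟧)) : Tate p) :
        ℚ_[p]⟦X⟧) = PowerSeries.C (PowerSeries.coeff j (f : ℚ_[p]⟦X⟧)) := rfl
    change ‖PowerSeries.coeff n ((algebraMap ℚ_[p] (Tate p)
      (PowerSeries.coeff j (f : ℚ_[p]⟦X⟧)) : Tate p) : ℚ_[p]⟦X⟧)‖ ≤ _
    rw [h3, PowerSeries.coeff_C]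
    split_ifs
    · exact h2
    · simpa using discNorm_nonneg r (f : ℚ_[p]⟦X⟧)⟩

end Distributions

/-! ### The automorphy factor and the action of `Σ₀(p)` on families of distributions -/

section Action

variable {p : ℕ} [Fact p.Prime]

/-- `u` is a topological generator of `1 + p ℤ_p`. -/
def IsTopGenerator (u : ℤ_[p]ˣ) : Prop :=
  ((Subgroup.zpowers u).topologicalClosure : Set ℤ_[p]ˣ) =
    {x : ℤ_[p]ˣ | (p : ℤ_[p]) ∣ (x : ℤ_[p]) - 1}

/-- The Teichmüller representative `ω(a) = lim a ^ (p ^ n)`; the limit exists for every `a`, and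
for a unit `a` it is the `(p - 1)`-st root of unity congruent to `a` modulo `p`. -/
def teich (a : ℤ_[p]) : ℤ_[p] :=
  Filter.limUnder Filter.atTop fun n : ℕ => a ^ p ^ n

/-- The `p`-adic logarithm `log x = ∑_{k ≥ 1} (-1) ^ (k + 1) (x - 1) ^ k / k`, `x ∈ 1 + p ℤ_p`. -/
def padicLog (x : ℚ_[p]) : ℚ_[p] :=
  ∑' k : ℕ, (-1) ^ (k + 1) / (k : ℚ_[p]) * (x - 1) ^ k

/-- The logarithm of a power series `F` in `z` that is congruent to `1` modulo `p`, by the same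
series; the coefficients converge one by one. -/
def logSeries (F : ℚ_[p]⟦X⟧) : ℚ_[p]⟦X⟧ :=
  PowerSeries.mk fun i =>
    ∑' k : ℕ, (-1) ^ (k + 1) / (k : ℚ_[p]) * PowerSeries.coeff i ((F - 1) ^ k)

/-- The power series `a + c z`. -/
def linear (a c : ℤ_[p]) : ℚ_[p]⟦X⟧ :=
  PowerSeries.C (a : ℚ_[p]) + PowerSeries.C (c : ℚ_[p]) * PowerSeries.X

/-- `log_u ((a + c z) / ω(a))`, with `log_u = log / log u`. -/
def logFactor (u : ℤ_[p]ˣ) (a c : ℤ_[p]) : ℚ_[p]⟦X⟧ :=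
  PowerSeries.C (padicLog ((u : ℤ_[p]) : ℚ_[p]))⁻¹ *
    logSeries (PowerSeries.C ((teich a : ℚ_[p])⁻¹) * linear a c)

/-- The binomial coefficient `L (L - 1) ⋯ (L - n + 1) / n!` of a power series `L`. -/
def binom (L : ℚ_[p]⟦X⟧) (n : ℕ) : ℚ_[p]⟦X⟧ :=
  PowerSeries.C ((n.factorial : ℚ_[p])⁻¹) * ∏ k ∈ Finset.range n, (L - (k : ℚ_[p]⟦X⟧))

/-- The automorphy factor
`K_{a,c,m}(z, w) = ω(a) ^ m ∑_n binom (log_u ((a + c z) / ω(a))) n (p w) ^ n`,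
as a power series in `z` (outer variable) with coefficients power series in `w` (inner
variable). -/
def autFactor (u : ℤ_[p]ˣ) (m : ℕ) (a c : ℤ_[p]) : ℚ_[p]⟦X⟧⟦X⟧ :=
  PowerSeries.mk fun i => PowerSeries.mk fun n =>
    (teich a : ℚ_[p]) ^ m * (p : ℚ_[p]) ^ n *
      PowerSeries.coeff i (binom (logFactor u a c) n)

/-- `f ((b + d z) / (a + c z))` for `f ∈ 𝒜†`: the substitution is made in the expansion of `f` and
the coefficients converge one by one. -/
def mobius (g : Matrix (Fin 2) (Fin 2) ℤ_[p]) (f : ℚ_[p]⟦X⟧) : ℚ_[p]⟦X⟧ :=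
  PowerSeries.mk fun i => ∑' n : ℕ, PowerSeries.coeff n f *
    PowerSeries.coeff i ((linear (g 0 1) (g 1 1) * (linear (g 0 0) (g 1 0))⁻¹) ^ n)

/-- The `R`-linear extension of `μ ∈ 𝒟†(R)` to power series in `z` with coefficients in `R` that
converge for `|z| ≤ r` for some `r > 1`: `μ (∑ F_i z ^ i) = ∑ F_i μ(z ^ i)`. The sum converges in
the norm of `R`, so it may be computed coefficient by coefficient in `w`. -/
def pairing (μ : Ddag p) (F : ℚ_[p]⟦X⟧⟦X⟧) : ℚ_[p]⟦X⟧ :=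
  PowerSeries.mk fun n => ∑' i : ℕ, PowerSeries.coeff n
    (PowerSeries.coeff i F * ((μ : Adag p →ₗ[ℚ_[p]] Tate p) (monom p i) : ℚ_[p]⟦X⟧))

/-- The action of `Σ₀(p)` on `𝒟†(R)`: `slash u m μ g` is the function `f ↦ (μ | g)(f)` on `𝒜†`,
where `μ | g = (K_{a,c,m} · μ) |₀ g`, that is,
`(μ | g)(f) = μ (K_{a,c,m}(z, w) f ((b + d z) / (a + c z)))`. -/
def slash (u : ℤ_[p]ˣ) (m : ℕ) (μ : Ddag p) (g : Matrix (Fin 2) (Fin 2) ℤ_[p]) (f : Adag p) :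
    ℚ_[p]⟦X⟧ :=
  pairing μ (autFactor u m (g 0 0) (g 1 0) *
    PowerSeries.map PowerSeries.C (mobius g (f : ℚ_[p]⟦X⟧)))

/-- An integral matrix of determinant one, seen over `ℤ_p`. -/
def toPadic (g : SL(2, ℤ)) : Matrix (Fin 2) (Fin 2) ℤ_[p] :=
  (g : Matrix (Fin 2) (Fin 2) ℤ).map (Int.castRingHom ℤ_[p])

/-- The total measure `(∑_j v_j | (γ_j - 1)) (1)`. -/
def totalMeasure (u : ℤ_[p]ˣ) (m : ℕ) {t : ℕ} (γ : Fin t → SL(2, ℤ)) (v : Fin t → Ddag p) :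
    ℚ_[p]⟦X⟧ :=
  ∑ j, (slash u m (v j) (toPadic (γ j)) (monom p 0) -
    ((v j : Adag p →ₗ[ℚ_[p]] Tate p) (monom p 0) : ℚ_[p]⟦X⟧))

end Action

/-! ### Modular symbols -/

section ModularSymbols

/-- `Δ₀`, the divisors of degree zero on `ℙ¹(ℚ)`. -/
def DivZero : AddSubgroup (OnePoint ℚ →₀ ℤ) :=
  (Finsupp.liftAddHom fun _ : OnePoint ℚ => AddMonoidHom.id ℤ).ker

/-- `SL₂(ℤ)` acts on `Δ₀` by linear fractional transformations. -/
def divAct : SL(2, ℤ) →* AddMonoid.End DivZero where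
  toFun g :=
    { toFun := fun D => ⟨Finsupp.mapDomain
        (fun x : OnePoint ℚ => Matrix.SpecialLinearGroup.mapGL ℚ g • x) D.1, by
          have h := D.2
          change Finsupp.liftAddHom (fun _ : OnePoint ℚ => AddMonoidHom.id ℤ) _ = 0 at h
          change Finsupp.liftAddHom (fun _ : OnePoint ℚ => AddMonoidHom.id ℤ) _ = 0
          rw [Finsupp.liftAddHom_apply] at h ⊢
          rw [Finsupp.sum_mapDomain_index (by simp) (by simp)]
          exact h⟩
      map_zero' := Subtype.ext (by simp)
      map_add' := fun D E => Subtype.ext (by simp [Finsupp.mapDomain_add]) }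
  map_one' := by
    ext D : 2
    change Finsupp.mapDomain _ D.1 = D.1
    simp only [map_one, one_smul]
    exact Finsupp.mapDomain_id
  map_mul' g h := by
    ext D : 2
    change Finsupp.mapDomain _ D.1 = Finsupp.mapDomain _ (Finsupp.mapDomain _ D.1)
    rw [← Finsupp.mapDomain_comp]
    congr 1
    funext x
    simp [mul_smul]

/-- `Δ₀` as a module over the group ring `ℤ[Γ]`. -/
def ringAct (Γ : Subgroup SL(2, ℤ)) : MonoidAlgebra ℤ Γ →ₐ[ℤ] AddMonoid.End DivZero :=
  MonoidAlgebra.lift ℤ (AddMonoid.End DivZero) Γ (divAct.comp Γ.subtype)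

/-- The divisor `{0} - {∞}`. -/
def divInfty : DivZero :=
  ⟨Finsupp.single ((0 : ℚ) : OnePoint ℚ) 1 - Finsupp.single OnePoint.infty 1, by
    rw [DivZero, AddMonoidHom.mem_ker, map_sub]; simp⟩

/-- Divisors `D_1, …, D_t` and matrices `γ_1, …, γ_t ∈ Γ` solving the Manin relations for `Γ`:
`{0} - {∞}, D_1, …, D_t` generate the `ℤ[Γ]`-module `Δ₀`, and their relations are the multiples
of the single relation
`(T⁻¹ - 1) ({0} - {∞}) = ∑_j (γ_j⁻¹ - 1) D_j`, where `T = (1 1; 0 1)`. -/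
structure SolvesManinRelations (Γ : Subgroup SL(2, ℤ)) (hT : ModularGroup.T ∈ Γ) {t : ℕ}
    (γ : Fin t → Γ) (D : Fin t → DivZero) : Prop where
  generate : ∀ E : DivZero, ∃ (x : MonoidAlgebra ℤ Γ) (y : Fin t → MonoidAlgebra ℤ Γ),
    E = ringAct Γ x divInfty + ∑ j, ringAct Γ (y j) (D j)
  relation : divAct ModularGroup.T⁻¹ divInfty - divInfty =
    ∑ j, (divAct ((γ j : SL(2, ℤ))⁻¹) (D j) - D j)
  only_relation : ∀ (x : MonoidAlgebra ℤ Γ) (y : Fin t → MonoidAlgebra ℤ Γ),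
    ringAct Γ x divInfty + ∑ j, ringAct Γ (y j) (D j) = 0 →
      ∃ s : MonoidAlgebra ℤ Γ,
        x = s * (MonoidAlgebra.single (⟨ModularGroup.T, hT⟩ : Γ)⁻¹ 1 - 1) ∧
        ∀ j, y j = -(s * (MonoidAlgebra.single (γ j)⁻¹ 1 - 1))

/-- `Φ` is a `𝒟†(R)`-valued modular symbol of level `Γ`:
`Φ(g D) = Φ(D) | g⁻¹` for all `g ∈ Γ` and `D ∈ Δ₀`. -/
def IsModularSymbol {p : ℕ} [Fact p.Prime] (u : ℤ_[p]ˣ) (m : ℕ) (Γ : Subgroup SL(2, ℤ))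
    (Φ : DivZero →+ Ddag p) : Prop :=
  ∀ g ∈ Γ, ∀ (D : DivZero) (f : Adag p),
    ((Φ (divAct g D) : Adag p →ₗ[ℚ_[p]] Tate p) f : ℚ_[p]⟦X⟧) =
      slash u m (Φ D) (toPadic g⁻¹) f

/-- The values `v_j` make `∑_j v_j | (γ_j - 1)` of total measure zero, and extend to a family of
overconvergent modular symbols of level `Γ` whenever the `γ_j` belong to a solution `D_j`, `γ_j`
of the Manin relations. -/
def IsAdjusted {p : ℕ} [Fact p.Prime] (u : ℤ_[p]ˣ) (m : ℕ) (Γ : Subgroup SL(2, ℤ))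
    (hT : ModularGroup.T ∈ Γ) {t : ℕ} (γ : Fin t → Γ) (v : Fin t → Ddag p) : Prop :=
  totalMeasure u m (fun j => (γ j : SL(2, ℤ))) v = 0 ∧
    ∀ D : Fin t → DivZero, SolvesManinRelations Γ hT γ D →
      ∃ Φ : DivZero →+ Ddag p, IsModularSymbol u m Γ Φ ∧ ∀ j, Φ (D j) = v j

end ModularSymbols

end HidaFamilies

end

open scoped MatrixGroups PowerSeries

noncomputable section

namespace HidaFamilies


/-! ### Fundamental polygons

Oriented edges of the Farey tessellation form a torsor under a group `H` (which will be
`PSL₂(ℤ)`); right multiplication by `s` reverses an edge and right multiplication by `r` rotates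
the triangle to its left. A group `Γ` acts through `ι : Γ →* H` on the left. -/

section Polygons

variable {H Γ : Type*} [Group H] [Group Γ] {ι : Γ →* H} {s r : H}

/-! A solution of the Manin relations turns an equivariant homomorphism on `DivZero` into values `w`
at `{0} - {∞}` and `v_j` at `D_j` subject only to `w | T - w = ∑ v_j | (γ_j - 1)`
(`SolvesManinRelations.exists_hom`). Since `T` is the translation `z ↦ z + 1` with trivial
automorphy factor, the transpose of `z ^ n ↦ B_{n+1}(z) / (n + 1)` solves `w | T - w = ν` as soon as
`ν(1) = 0` (`slashD_indefSum_sub`). This operator preserves overconvergence because Bernoulli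
numbers have at most a simple pole at `p`.

It remains to kill the total measure. Adding `q μ_k` to `v_i` changes it by `q h`
(`totalMeasure_update`), so `h` must divide `g` in the Tate algebra. If `a ^ m` is not `1` modulo
`p`, then `h` has a unit constant term and is invertible (`constantCoeff_autFactor_sub_one`). If `p
- 1 ∣ m` and `c ≠ 0`, then `h` is a nonzero constant times `w` times an invertible series
(`coeff_one_autFactor_eq`), while `g` vanishes at `w = 0`, where the weight is trivial
(`constantCoeff_totalMeasure`).

That `slash` is an action on distributions rests on the cocycle relation `autCoeff_mul`: the
logarithm turns the cocycle `a + c z` into an additive one, and the Chu–Vandermonde identity does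
the rest. For odd `p` the norm of `1 / n!` is at most `p ^ ((n - 1) / 2)`, so every series involved
is controlled on discs of radius below `√p`.

For (A), triangles of the Farey tessellation are glued to a fundamental polygon; a torsion-free
group pairs its sides without reversing any edge. The vanishing of the boundary sum is the single
relation, and conversely any function on the sides with sum zero extends over the polygon, so there
are no further relations (`exists_manin_edges`). All sides but two vertical ones are semicircles
oriented from right to left. A pairing reverses an edge, while an element fixing `∞` preserves left
and right, so the remaining pairings have `c_j ≠ 0` (`lower_left_ne_zero`). -/

/-- The group `Γ` acts on oriented edges freely, and no element of it reverses an edge or rotates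
a triangle. -/
structure ActsFreely (ι : Γ →* H) (s r : H) : Prop where
  inj : Function.Injective ι
  s_sq : s * s = 1
  r_cube : r * r * r = 1
  no_flip : ∀ γ g, ι γ * g ≠ g * s
  no_rot : ∀ γ g, ι γ * g ≠ g * r

namespace ActsFreely

theorem r_ne_one (h : ActsFreely ι s r) : r ≠ 1 := fun hr =>
  h.no_rot 1 1 (by simp [hr])

theorem mul_r_ne (h : ActsFreely ι s r) (g : H) : g * r ≠ g := by
  simpa using h.r_ne_one

theorem mul_rr_ne (h : ActsFreely ι s r) (g : H) : g * (r * r) ≠ g := by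
  intro h'
  apply h.mul_r_ne g
  calc g * r = g * (r * r) * r := by rw [h']
    _ = g := by rw [mul_assoc, h.r_cube, mul_one]

theorem mul_r_ne_mul_rr (h : ActsFreely ι s r) (g : H) : g * r ≠ g * (r * r) := by
  rw [← mul_assoc]
  exact (h.mul_r_ne _).symm

theorem mul_rrr (h : ActsFreely ι s r) (g : H) : g * (r * r) * r = g := by
  rw [mul_assoc, h.r_cube, mul_one]

theorem mul_ss (h : ActsFreely ι s r) (g : H) : g * s * s = g := by
  rw [mul_assoc, h.s_sq, mul_one]

theorem eq_one_of_mul_eq (h : ActsFreely ι s r) {γ : Γ} {g : H} (h' : ι γ * g = g) : γ = 1 := by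
  apply h.inj
  rw [map_one]
  simpa using h'

theorem no_rot' (h : ActsFreely ι s r) (γ : Γ) (g : H) : ι γ * g ≠ g * (r * r) := by
  intro h'
  apply h.no_rot γ⁻¹ g
  rw [map_inv, inv_mul_eq_iff_eq_mul, ← mul_assoc, h', h.mul_rrr]

end ActsFreely

variable [DecidableEq H]

/-- Polygons obtained from the triangle of `1` by gluing triangles not equivalent to an earlier
one; `P` is the set of edges of all the triangles, and `B` the set of boundary edges. -/
inductive Polygon (ι : Γ →* H) (s r : H) : Finset H → Finset H → Prop
  | base : Polygon ι s r {1, r, r * r} {1, r, r * r}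
  | glue {P B : Finset H} (g : H) (hP : Polygon ι s r P B) (hg : g ∈ B)
      (hnew : ∀ γ, ι γ * (g * s) ∉ P) :
      Polygon ι s r (P ∪ {g * s, g * s * r, g * s * (r * r)})
        (B.erase g ∪ {g * s * r, g * s * (r * r)})

variable {P B : Finset H}

namespace ActsFreely

/-- Within one triangle the image of `x` is `x` or one of its two rotations; `no_rot` and `no_rot'`
exclude the rotations. -/
theorem triangle_free (h : ActsFreely ι s r) {γ : Γ} {g x : H}
    (hx : x ∈ ({g, g * r, g * (r * r)} : Finset H))
    (hy : ι γ * x ∈ ({g, g * r, g * (r * r)} : Finset H)) : γ = 1 := by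
  have key : ι γ * x = x ∨ ι γ * x = x * r ∨ ι γ * x = x * (r * r) := by
    have e := h.mul_rrr g
    simp only [Finset.mem_insert, Finset.mem_singleton] at hx hy
    rcases hx with rfl | rfl | rfl
    · exact hy
    · have e2 : g * r * (r * r) = g := by rw [mul_assoc, ← mul_assoc r, h.r_cube, mul_one]
      rw [e2, mul_assoc g r r]; tauto
    · have e2 : g * (r * r) * (r * r) = g * r := by rw [← mul_assoc (g * (r * r)), e]
      rw [e, e2]; tauto
  rcases key with k | k | k
  · exact h.eq_one_of_mul_eq k
  · exact absurd k (h.no_rot _ _)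
  · exact absurd k (h.no_rot' _ _)

end ActsFreely

namespace Polygon

theorem mul_r_mem (h : ActsFreely ι s r) (hP : Polygon ι s r P B) :
    ∀ g ∈ P, g * r ∈ P := by
  induction hP with
  | base =>
    intro g hg
    simp only [Finset.mem_insert, Finset.mem_singleton] at hg ⊢
    rcases hg with rfl | rfl | rfl
    · simp
    · simp
    · simp [h.r_cube]
  | glue x hP hx hnew ih =>
    intro g hg
    simp only [Finset.mem_insert, Finset.mem_singleton, Finset.mem_union] at hg ⊢
    rcases hg with hg | rfl | rfl | rfl
    · exact Or.inl (ih g hg)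
    · simp
    · simp [mul_assoc]
    · simp [h.mul_rrr]

theorem mem_of_mul_r_mem (h : ActsFreely ι s r) (hP : Polygon ι s r P B) {g : H}
    (hg : g * r ∈ P) : g ∈ P := by
  have := hP.mul_r_mem h _ (hP.mul_r_mem h _ hg)
  rwa [mul_assoc, mul_assoc, ← mul_assoc r, h.r_cube, mul_one] at this

theorem mem_of_mul_rr_mem (h : ActsFreely ι s r) (hP : Polygon ι s r P B) {g : H}
    (hg : g * (r * r) ∈ P) : g ∈ P := by
  rw [← mul_assoc] at hg
  exact hP.mem_of_mul_r_mem h (hP.mem_of_mul_r_mem h hg)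

theorem subset (hP : Polygon ι s r P B) : B ⊆ P := by
  induction hP with
  | base => rfl
  | glue x hP hx hnew ih =>
    intro g hg
    simp only [Finset.mem_insert, Finset.mem_singleton, Finset.mem_union, Finset.mem_erase]
      at hg ⊢
    rcases hg with hg | hg | hg
    · exact Or.inl (ih hg.2)
    · simp [hg]
    · simp [hg]

/-- The triangle about to be glued is new. -/
theorem notMem_of_mem_triangle (h : ActsFreely ι s r) (hP : Polygon ι s r P B) {g : H}
    (hnew : ∀ γ, ι γ * g ∉ P) {x : H} (hx : x ∈ ({g, g * r, g * (r * r)} : Finset H)) (γ : Γ) :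
    ι γ * x ∉ P := by
  intro hxP
  simp only [Finset.mem_insert, Finset.mem_singleton] at hx
  rcases hx with rfl | rfl | rfl
  · exact hnew γ hxP
  · rw [← mul_assoc] at hxP
    exact hnew γ (hP.mem_of_mul_r_mem h hxP)
  · rw [← mul_assoc] at hxP
    exact hnew γ (hP.mem_of_mul_rr_mem h hxP)

theorem notMem_of_mem_triangle' (h : ActsFreely ι s r) (hP : Polygon ι s r P B) {g : H}
    (hnew : ∀ γ, ι γ * g ∉ P) {x : H} (hx : x ∈ ({g, g * r, g * (r * r)} : Finset H)) :
    x ∉ P := by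
  simpa using hP.notMem_of_mem_triangle h hnew hx 1

/-- At each gluing the orbit of the new triangle avoids the old polygon, and inside the triangle
`triangle_free` applies. Hence a polygon embeds in the quotient by `Γ`, which bounds its size. -/
theorem free (h : ActsFreely ι s r) (hP : Polygon ι s r P B) :
    ∀ (γ : Γ) (g : H), g ∈ P → ι γ * g ∈ P → γ = 1 := by
  induction hP with
  | base =>
    intro γ g hg hγ
    apply h.triangle_free (g := 1) (x := g)
    · simpa using hg
    · simpa using hγ
  | @glue P B x hP hx hnew ih =>
    intro γ g hg hγ
    rw [Finset.mem_union] at hg hγ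
    rcases hg with hg | hg
    · rcases hγ with hγ | hγ
      · exact ih γ g hg hγ
      · have := hP.notMem_of_mem_triangle h hnew hγ γ⁻¹
        rw [map_inv, inv_mul_cancel_left] at this
        exact absurd hg this
    · rcases hγ with hγ | hγ
      · exact absurd hγ (hP.notMem_of_mem_triangle h hnew hg γ)
      · exact h.triangle_free hg hγ

/-- A side leaves `B` only when a triangle is glued along it, and then its reverse enters `P` as the
base of that triangle, not as a side. -/
theorem interior (h : ActsFreely ι s r) (hP : Polygon ι s r P B) :
    ∀ g ∈ P, g ∉ B → g * s ∈ P ∧ g * s ∉ B := by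
  induction hP with
  | base => intro g h1 h2; exact absurd h1 h2
  | @glue P B x hP hx hnew ih =>
    intro g hg hgB
    have n1 := hP.notMem_of_mem_triangle' h hnew (x := x * s) (by simp)
    have n2 := hP.notMem_of_mem_triangle' h hnew (x := x * s * r) (by simp)
    have n3 := hP.notMem_of_mem_triangle' h hnew (x := x * s * (r * r)) (by simp)
    have hxP := hP.subset hx
    simp only [Finset.mem_insert, Finset.mem_singleton, Finset.mem_union, Finset.mem_erase,
      not_or, not_and] at hg hgB ⊢
    rcases hg with hg | rfl | rfl | rfl
    · by_cases hgx : g = x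
      · subst hgx
        refine ⟨Or.inr (Or.inl rfl), fun _ hb => n1 (hP.subset hb), ?_, ?_⟩
        · exact (h.mul_r_ne _).symm
        · exact (h.mul_rr_ne _).symm
      · obtain ⟨h1, h2⟩ := ih g hg (hgB.1 hgx)
        exact ⟨Or.inl h1, fun _ => h2, fun e => n2 (e ▸ h1), fun e => n3 (e ▸ h1)⟩
    · rw [h.mul_ss]
      exact ⟨Or.inl hxP, fun e => absurd rfl e, fun e => n2 (e ▸ hxP), fun e => n3 (e ▸ hxP)⟩
    · exact absurd rfl hgB.2.1
    · exact absurd rfl hgB.2.2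

/-! ### Functions on the edges of a polygon. -/

section Functions

variable {A : Type*} [AddCommGroup A]

/-- The outer edges of the new triangle lie outside `P`, hence outside the old boundary, so nothing
is counted twice. -/
theorem sum_glue (h : ActsFreely ι s r) (hP : Polygon ι s r P B) {g : H} (hg : g ∈ B)
    (hnew : ∀ γ, ι γ * (g * s) ∉ P) (φ : H → A) :
    ∑ x ∈ B.erase g ∪ {g * s * r, g * s * (r * r)}, φ x =
      ∑ x ∈ B, φ x - φ g + (φ (g * s * r) + φ (g * s * (r * r))) := by
  have n2 := hP.notMem_of_mem_triangle' h hnew (x := g * s * r) (by simp)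
  have n3 := hP.notMem_of_mem_triangle' h hnew (x := g * s * (r * r)) (by simp)
  rw [Finset.sum_union, Finset.sum_pair (h.mul_r_ne_mul_rr _), Finset.sum_erase_eq_sub hg]
  rw [Finset.disjoint_right]
  intro x hx hx'
  have := hP.subset (Finset.mem_of_mem_erase hx')
  simp only [Finset.mem_insert, Finset.mem_singleton] at hx
  rcases hx with rfl | rfl
  · exact n2 this
  · exact n3 this

/-- The boundary of a polygon is homologous to zero. -/
theorem sum_boundary (h : ActsFreely ι s r) (hP : Polygon ι s r P B) {ψ : H → A}
    (hs : ∀ g, ψ (g * s) = -ψ g) (hr : ∀ g, ψ g + ψ (g * r) + ψ (g * (r * r)) = 0) :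
    ∑ g ∈ B, ψ g = 0 := by
  induction hP with
  | base =>
    have h1 := h.mul_r_ne 1
    have h2 := h.mul_rr_ne 1
    have h3 := h.mul_r_ne_mul_rr 1
    have := hr 1
    simp only [one_mul] at h1 h2 h3 this
    rw [Finset.sum_insert, Finset.sum_pair h3, ← this, add_assoc]
    simp [h1.symm, h2.symm]
  | glue g hP hg hnew ih =>
    rw [hP.sum_glue h hg hnew, ih]
    have := hr (g * s)
    rw [hs] at this
    rw [zero_sub, ← add_assoc, this]

/-- The boundary edges generate. -/
theorem mem_of_boundary (hP : Polygon ι s r P B) {ψ : H → A}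
    (hs : ∀ g, ψ (g * s) = -ψ g) (hr : ∀ g, ψ g + ψ (g * r) + ψ (g * (r * r)) = 0)
    (N : AddSubgroup A) : (∀ g ∈ B, ψ g ∈ N) → ∀ g ∈ P, ψ g ∈ N := by
  induction hP with
  | base => exact fun hN => hN
  | @glue P B x hP hx hnew ih =>
    intro hN
    have m2 : ψ (x * s * r) ∈ N := hN _ (by simp)
    have m3 : ψ (x * s * (r * r)) ∈ N := hN _ (by simp)
    have m1 : ψ (x * s) ∈ N := by
      have := hr (x * s)
      rw [add_assoc, add_eq_zero_iff_eq_neg] at this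
      rw [this]
      exact N.neg_mem (N.add_mem m2 m3)
    have m0 : ψ x ∈ N := by
      rw [hs] at m1
      simpa using m1
    intro g hg
    simp only [Finset.mem_insert, Finset.mem_singleton, Finset.mem_union] at hg
    rcases hg with hg | rfl | rfl | rfl
    · refine ih (fun y hy => ?_) g hg
      by_cases hyx : y = x
      · rwa [hyx]
      · exact hN y (by simp [hyx, hy])
    · exact m1
    · exact m2
    · exact m3

/-- A function on the boundary with sum zero extends to the polygon. -/
theorem exists_extension (h : ActsFreely ι s r) (hP : Polygon ι s r P B) :
    ∀ φ : H → A, ∑ g ∈ B, φ g = 0 → ∃ ψ : H → A, (∀ g ∈ B, ψ g = φ g) ∧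
      (∀ g ∈ P, ψ g + ψ (g * r) + ψ (g * (r * r)) = 0) ∧
      ∀ g ∈ P, g ∉ B → ψ (g * s) = -ψ g := by
  induction hP with
  | base =>
    intro φ hφ
    have h1 := h.mul_r_ne 1
    have h2 := h.mul_rr_ne 1
    have h3 := h.mul_r_ne_mul_rr 1
    simp only [one_mul] at h1 h2 h3
    rw [Finset.sum_insert (by simp [h1.symm, h2.symm]), Finset.sum_pair h3] at hφ
    refine ⟨φ, fun _ _ => rfl, fun g hg => ?_, fun g h1 h2 => absurd h1 h2⟩
    simp only [Finset.mem_insert, Finset.mem_singleton] at hg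
    rw [← hφ]
    rcases hg with rfl | rfl | rfl
    · simp only [one_mul]; abel
    · rw [← mul_assoc g g g, h.r_cube]; abel
    · rw [h.r_cube, ← mul_assoc (r * r), h.r_cube, one_mul]; abel
  | @glue P B x hP hx hnew ih =>
    intro φ hφ
    have n1 := hP.notMem_of_mem_triangle' h hnew (x := x * s) (by simp)
    have n2 := hP.notMem_of_mem_triangle' h hnew (x := x * s * r) (by simp)
    have n3 := hP.notMem_of_mem_triangle' h hnew (x := x * s * (r * r)) (by simp)
    have hxP := hP.subset hx
    rw [hP.sum_glue h hx hnew] at hφ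
    -- The side `x` becomes interior. Its value is forced by the three-term relation in the new
    -- triangle, and with this value the old boundary sum is again zero.
    obtain ⟨ψ, h1, h2, h3⟩ := ih
      (Function.update φ x (φ (x * s * r) + φ (x * s * (r * r)))) (by
        rw [Finset.sum_update_of_mem hx, Finset.sdiff_singleton_eq_erase,
          Finset.sum_erase_eq_sub hx, ← hφ]
        abel)
    have hψx : ψ x = φ (x * s * r) + φ (x * s * (r * r)) := by rw [h1 x hx]; simp
    set χ : H → A := fun y => if y ∈ P then ψ y else if y = x * s then -ψ x else φ y with hχ
    have χP : ∀ y ∈ P, χ y = ψ y := fun y hy => by simp [hχ, hy]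
    have χ1 : χ (x * s) = -ψ x := by simp [hχ, n1]
    have χ2 : χ (x * s * r) = φ (x * s * r) := by simp [hχ, n2, h.r_ne_one]
    have χ3 : χ (x * s * (r * r)) = φ (x * s * (r * r)) := by
      simp only [hχ, n3, h.mul_rr_ne, if_false]
    refine ⟨χ, ?_, ?_, ?_⟩
    · intro g hg
      simp only [Finset.mem_insert, Finset.mem_singleton, Finset.mem_union, Finset.mem_erase] at hg
      rcases hg with ⟨hg, hgB⟩ | rfl | rfl
      · rw [χP g (hP.subset hgB), h1 g hgB, Function.update_of_ne hg]
      · exact χ2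
      · exact χ3
    · intro g hg
      simp only [Finset.mem_insert, Finset.mem_singleton, Finset.mem_union] at hg
      rcases hg with hg | rfl | rfl | rfl
      · have e := hP.mul_r_mem h g hg
        have e' := hP.mul_r_mem h _ e
        rw [mul_assoc] at e'
        rw [χP _ hg, χP _ e, χP _ e', h2 g hg]
      · rw [χ1, χ2, χ3, hψx]; abel
      · rw [← mul_assoc (x * s * r), mul_assoc (x * s) r r, h.mul_rrr, χ1, χ2, χ3, hψx]; abel
      · rw [← mul_assoc (x * s * (r * r)), h.mul_rrr, χ1, χ2, χ3, hψx]; abel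
    · intro g hg hgB
      simp only [Finset.mem_insert, Finset.mem_singleton, Finset.mem_union, Finset.mem_erase,
        not_or, not_and] at hg hgB
      rcases hg with hg | rfl | rfl | rfl
      · by_cases hgx : g = x
        · rw [hgx, χ1, χP x hxP]
        · rw [χP g hg, χP _ (hP.interior h g hg (hgB.1 hgx)).1, h3 g hg (hgB.1 hgx)]
      · rw [h.mul_ss, χ1, χP x hxP, neg_neg]
      · exact absurd rfl hgB.2.1
      · exact absurd rfl hgB.2.2

end Functions

/-- If the edges `1` and `r²` are paired by `Γ`, they remain on the boundary, and any property of
`r` that is inherited by the two outer edges of a new triangle holds for the rest of it. -/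
theorem boundary_spec (h : ActsFreely ι s r) {τ : Γ} (hτ : ι τ * (r * r) = s) (Q : H → Prop)
    (hQr : Q r) (hQ : ∀ g, Q g → Q (g * s * r) ∧ Q (g * s * (r * r)))
    (hP : Polygon ι s r P B) :
    1 ∈ B ∧ r * r ∈ B ∧ ∀ g ∈ B, g = 1 ∨ g = r * r ∨ Q g := by
  induction hP with
  | base =>
    refine ⟨by simp, by simp, fun g hg => ?_⟩
    simp only [Finset.mem_insert, Finset.mem_singleton] at hg
    rcases hg with rfl | rfl | rfl
    · simp
    · exact Or.inr (Or.inr hQr)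
    · simp
  | @glue P B x hP hx hnew ih =>
    obtain ⟨h1, h2, h3⟩ := ih
    -- The reverse of the edge `1` is `s = τ r²`, which is equivalent to an edge of `P`, so no new
    -- triangle can be glued there; the same pairing protects `r²`.
    have hx1 : x ≠ 1 := by
      rintro rfl
      apply hnew τ⁻¹
      rw [one_mul, ← hτ, map_inv, inv_mul_cancel_left]
      exact hP.subset h2
    have hx2 : x ≠ r * r := by
      rintro rfl
      apply hnew τ
      rw [← mul_assoc, hτ, h.s_sq]
      exact hP.subset h1
    refine ⟨by simp [h1, hx1.symm], by simp [h2, hx2.symm], fun g hg => ?_⟩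
    have hQx : Q x := ((h3 x hx).resolve_left hx1).resolve_left hx2
    simp only [Finset.mem_insert, Finset.mem_singleton, Finset.mem_union, Finset.mem_erase] at hg
    rcases hg with hg | rfl | rfl
    · exact h3 g hg.2
    · exact Or.inr (Or.inr (hQ x hQx).1)
    · exact Or.inr (Or.inr (hQ x hQx).2)

/-- If `Γ` has finitely many orbits on edges, then there is a fundamental polygon. -/
theorem exists_fundamental (h : ActsFreely ι s r) (F : Finset H)
    (hF : ∀ g, ∃ γ, ι γ * g ∈ F)
    (hgen : ∀ N : Set H, 1 ∈ N → (∀ g ∈ N, g * s ∈ N) → (∀ g ∈ N, g * r ∈ N) → ∀ g, g ∈ N) :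
    ∃ P B : Finset H, Polygon ι s r P B ∧ ∀ g, ∃ γ, ι γ * g ∈ P := by
  -- A polygon meets each orbit at most once, so moving its edges into `F` is injective.
  have hcard : ∀ P B : Finset H, Polygon ι s r P B → P.card ≤ F.card := by
    intro P B hP
    choose γ hγ using hF
    refine Finset.card_le_card_of_injOn (fun g => ι (γ g) * g) (fun g _ => hγ g) ?_
    intro g hg g' hg' e
    have e' : ι ((γ g)⁻¹ * γ g') * g' = g := by
      rw [map_mul, mul_assoc, map_inv, inv_mul_eq_iff_eq_mul]
      exact e.symm
    have := hP.free h _ g' hg' (e' ▸ hg)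
    rw [this, map_one, one_mul] at e'
    exact e'.symm
  -- A polygon with the most edges cannot be enlarged: across each side lies a triangle equivalent
  -- to one it already contains.
  set C : Set ℕ := {n | ∃ P B : Finset H, Polygon ι s r P B ∧ P.card = n}
  have hC : BddAbove C := ⟨F.card, by rintro _ ⟨P, B, hP, rfl⟩; exact hcard P B hP⟩
  obtain ⟨P, B, hP, hPC⟩ : sSup C ∈ C := Nat.sSup_mem ⟨_, _, _, Polygon.base, rfl⟩ hC
  have hB : ∀ g ∈ B, ∃ γ, ι γ * (g * s) ∈ P := by
    intro g hg
    by_contra hnew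
    push Not at hnew
    have hP' := Polygon.glue g hP hg hnew
    refine (le_csSup hC ⟨_, _, hP', rfl⟩).not_gt ?_
    rw [← hPC]
    apply Finset.card_lt_card
    refine ⟨Finset.subset_union_left, fun hsub => ?_⟩
    exact hP.notMem_of_mem_triangle' h hnew (x := g * s) (by simp) (hsub (by simp))
  refine ⟨P, B, hP, ?_⟩
  have h1 : (1 : H) ∈ P := by
    clear hB hPC
    induction hP with
    | base => simp
    | glue g _ _ _ ih => simp [ih]
  -- The union of the translates of `P` is stable under reversal and rotation, hence everything.
  apply hgen {g | ∃ γ, ι γ * g ∈ P}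
  · exact ⟨1, by simpa using h1⟩
  · rintro g ⟨γ, hγ⟩
    by_cases hb : ι γ * g ∈ B
    · obtain ⟨γ', hγ'⟩ := hB _ hb
      refine ⟨γ' * γ, ?_⟩
      rwa [map_mul, mul_assoc, ← mul_assoc (ι γ)]
    · refine ⟨γ, ?_⟩
      rw [← mul_assoc]
      exact (hP.interior h _ hγ hb).1
  · rintro g ⟨γ, hγ⟩
    refine ⟨γ, ?_⟩
    rw [← mul_assoc]
    exact hP.mul_r_mem h _ hγ

end Polygon

end Polygons


/-! ### Side pairings and the presentation by edges. -/

section Pairing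

variable {H Γ : Type*} [Group H] [Group Γ] {ι : Γ →* H} {s r : H} [DecidableEq H]

/-- A fundamental polygon of `Γ` in the torsor of oriented edges: the set `P` of edges of its
triangles meets every orbit, and `B` is the set of its sides. -/
structure IsFundamental (ι : Γ →* H) (s r : H) (P B : Finset H) : Prop where
  polygon : Polygon ι s r P B
  cover : ∀ g, ∃ γ, ι γ * g ∈ P

variable {P B : Finset H}

namespace IsFundamental

/-- By `Polygon.free` each orbit meets `P` at most once and stabilizers are trivial; together with
`cover` this gives every edge unique coordinates in `Γ × P`. -/
theorem unique (h : ActsFreely ι s r) (hP : IsFundamental ι s r P B) {γ γ' : Γ} {x y : H}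
    (hx : x ∈ P) (hy : y ∈ P) (e : ι γ * x = ι γ' * y) : γ = γ' ∧ x = y := by
  have e' : ι (γ'⁻¹ * γ) * x = y := by
    rw [map_mul, map_inv, mul_assoc, inv_mul_eq_iff_eq_mul, e]
  have h1 := hP.polygon.free h _ x hx (e' ▸ hy)
  rw [h1, map_one, one_mul] at e'
  exact ⟨(inv_mul_eq_one.mp h1).symm, e'⟩

/-- Every side of a fundamental polygon is paired with a side. -/
theorem exists_partner (h : ActsFreely ι s r) (hP : IsFundamental ι s r P B) {g : H} (hg : g ∈ B) :
    ∃ γ, ∃ x ∈ B, g * s = ι γ * x := by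
  obtain ⟨γ, hγ⟩ := hP.cover (g * s)
  refine ⟨γ⁻¹, ι γ * (g * s), ?_, by simp⟩
  -- If `γ g s` were interior, its reverse `γ g` would lie in `P` along with `g`; freeness gives `γ
  -- = 1`, and then `g` would not be a side.
  by_contra hb
  obtain ⟨h1, h2⟩ := hP.polygon.interior h _ hγ hb
  rw [mul_assoc, h.mul_ss] at h1 h2
  have := hP.polygon.free h γ g (hP.polygon.subset hg) h1
  subst this
  rw [map_one, one_mul] at h2
  exact h2 hg

/-- The sides of a fundamental polygon other than `1` and `r²` are `e_j`, `e_j'` with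
`e_j s = γ_j e_j'`. -/
theorem exists_pairing (h : ActsFreely ι s r) (hP : IsFundamental ι s r P B) {τ : Γ}
    (hτ : ι τ * (r * r) = s) (h1 : 1 ∈ B) (h2 : r * r ∈ B) :
    ∃ (t : ℕ) (γ : Fin t → Γ) (e e' : Fin t → H),
      (∀ j, e j * s = ι (γ j) * e' j) ∧
      (∀ j, e j ∈ B ∧ e j ≠ 1 ∧ e j ≠ r * r) ∧ (∀ j, e' j ∈ B ∧ e' j ≠ 1 ∧ e' j ≠ r * r) ∧
      (∀ g ∈ B, g = 1 ∨ g = r * r ∨ ∃ j, g = e j ∨ g = e' j) ∧ Function.Injective e ∧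
      (∀ i j, e i ≠ e' j) ∧
      ∀ {A : Type*} [AddCommGroup A] (φ : H → A),
        ∑ g ∈ B, φ g = φ 1 + φ (r * r) + ∑ j, (φ (e j) + φ (e' j)) := by
  have hsub := hP.polygon.subset
  have hex : ∀ g, ∃ γ x, g ∈ B → x ∈ B ∧ g * s = ι γ * x := by
    intro g
    by_cases hg : g ∈ B
    · obtain ⟨γ, x, hx, e⟩ := hP.exists_partner h hg
      exact ⟨γ, x, fun _ => ⟨hx, e⟩⟩
    · exact ⟨1, g, fun h' => absurd h' hg⟩
  choose γ σ hσ using hex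
  -- Coordinates are unique, so any pairing that can be exhibited computes `σ`; in particular `σ` is
  -- an involution exchanging `1` and `r²`.
  have key : ∀ g ∈ B, ∀ δ, ∀ x ∈ B, g * s = ι δ * x → σ g = x := by
    intro g hg δ x hx e
    rw [(hσ g hg).2] at e
    exact (hP.unique h (hsub (hσ g hg).1) (hsub hx) e).2
  have hσσ : ∀ g ∈ B, σ (σ g) = g := by
    intro g hg
    apply key _ (hσ g hg).1 (γ g)⁻¹ g hg
    have := (hσ g hg).2
    rw [map_inv, eq_inv_mul_iff_mul_eq, ← mul_assoc, ← this, h.mul_ss]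
  have hσ1 : σ 1 = r * r := key 1 h1 τ _ h2 (by rw [hτ, one_mul])
  have hσ2 : σ (r * r) = 1 := by rw [← hσ1, hσσ 1 h1]
  -- A side paired with itself would be reversed by an element of `Γ`.
  have hσne : ∀ g ∈ B, σ g ≠ g := by
    intro g hg e
    have := (hσ g hg).2
    rw [e] at this
    exact h.no_flip _ _ this.symm
  have h12 : (1 : H) ≠ r * r := by
    have := hσne 1 h1
    rw [hσ1] at this
    exact this.symm
  set B' := (B.erase 1).erase (r * r) with hB'
  have memB' : ∀ g, g ∈ B' ↔ g ∈ B ∧ g ≠ 1 ∧ g ≠ r * r := by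
    intro g; simp only [hB', Finset.mem_erase]; tauto
  have hσB' : ∀ g ∈ B', σ g ∈ B' := by
    intro g hg
    rw [memB'] at hg ⊢
    refine ⟨(hσ g hg.1).1, fun e => hg.2.2 ?_, fun e => hg.2.1 ?_⟩
    · rw [← hσσ g hg.1, e, hσ1]
    · rw [← hσσ g hg.1, e, hσ2]
  -- Any injective numbering of the sides serves to select one side from each pair.
  set o : H → ℕ := fun g => B.toList.idxOf g
  have ho : ∀ x ∈ B, ∀ y ∈ B, o x = o y → x = y := by
    intro x hx y _ e
    exact (List.idxOf_inj (Finset.mem_toList.mpr hx)).mp e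
  set E := B'.filter fun g => o g < o (σ g) with hE
  have memE : ∀ g, g ∈ E ↔ g ∈ B' ∧ o g < o (σ g) := fun g => Finset.mem_filter
  have hEB : ∀ g ∈ E, g ∈ B := fun g hg => ((memB' g).mp ((memE g).mp hg).1).1
  have hsplit : ∀ g ∈ B', g ∉ E → σ g ∈ E := by
    intro g hg hgE
    have hgB := ((memB' g).mp hg).1
    rw [memE] at hgE ⊢
    refine ⟨hσB' g hg, ?_⟩
    rw [hσσ g hgB]
    have : o g ≠ o (σ g) := fun e => hσne g hgB (ho _ hgB _ (hσ g hgB).1 e).symm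
    have := fun hlt => hgE ⟨hg, hlt⟩
    lia
  have hdis : ∀ g ∈ E, σ g ∉ E := by
    intro g hg hgE
    have h3 := ((memE _).mp hg).2
    have h4 := ((memE _).mp hgE).2
    rw [hσσ g (hEB g hg)] at h4
    lia
  set en := E.equivFin.symm
  refine ⟨E.card, fun j => γ (en j), fun j => en j, fun j => σ (en j), ?_, ?_, ?_, ?_, ?_, ?_, ?_⟩
  · intro j
    exact (hσ _ (hEB _ (en j).2)).2
  · intro j
    exact (memB' _).mp ((memE _).mp (en j).2).1
  · intro j
    exact (memB' _).mp (hσB' _ ((memE _).mp (en j).2).1)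
  · intro g hg
    by_cases g1 : g = 1
    · exact Or.inl g1
    by_cases g2 : g = r * r
    · exact Or.inr (Or.inl g2)
    refine Or.inr (Or.inr ?_)
    by_cases hgE : g ∈ E
    · exact ⟨en.symm ⟨g, hgE⟩, Or.inl (by simp)⟩
    · exact ⟨en.symm ⟨σ g, hsplit g ((memB' g).mpr ⟨hg, g1, g2⟩) hgE⟩,
        Or.inr (by simp [hσσ g hg])⟩
  · exact fun i j hij => en.injective (Subtype.ext hij)
  · intro i j hij
    exact hdis _ (en j).2 (by rw [← show ((en i : E) : H) = σ (en j) from hij]; exact (en i).2)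
  · intro A _ φ
    have e1 : ∑ g ∈ B, φ g = φ 1 + φ (r * r) + ∑ g ∈ B', φ g := by
      rw [← Finset.add_sum_erase B φ h1,
        ← Finset.add_sum_erase (B.erase 1) φ (Finset.mem_erase.mpr ⟨h12.symm, h2⟩), add_assoc]
    have e2 : ∑ g ∈ B' with ¬ o g < o (σ g), φ g = ∑ g ∈ E, φ (σ g) := by
      refine Finset.sum_nbij' σ σ ?_ ?_ ?_ ?_ ?_
      · intro g hg
        rw [Finset.mem_filter] at hg
        exact hsplit g hg.1 fun hh => hg.2 ((memE g).mp hh).2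
      · intro g hg
        rw [Finset.mem_filter]
        refine ⟨hσB' g ((memE g).mp hg).1, fun hh => hdis g hg ?_⟩
        exact (memE _).mpr ⟨hσB' g ((memE g).mp hg).1, hh⟩
      · intro g hg
        exact hσσ g ((memB' g).mp (Finset.mem_filter.mp hg).1).1
      · intro g hg
        exact hσσ g (hEB g hg)
      · intro g hg
        rw [hσσ g ((memB' g).mp (Finset.mem_filter.mp hg).1).1]
    rw [e1, ← Finset.sum_filter_add_sum_filter_not B' (fun g => o g < o (σ g)), e2,
      ← Finset.sum_add_distrib, ← Finset.sum_coe_sort, ← en.sum_comp]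

/-- A function on the edges of a fundamental polygon that is compatible with the rotation of
triangles and, under the pairing of the sides, with the reversal of edges, extends to an
equivariant function on all edges. -/
theorem exists_equivariant (h : ActsFreely ι s r) (hP : IsFundamental ι s r P B)
    {A : Type*} [AddCommGroup A] (ρ : Γ →* AddMonoid.End A) (ψ : H → A)
    (hr : ∀ g ∈ P, ψ g + ψ (g * r) + ψ (g * (r * r)) = 0)
    (hs : ∀ g ∈ P, g ∉ B → ψ (g * s) = -ψ g)
    (hB : ∀ g ∈ B, ∃ γ, ∃ x ∈ B, g * s = ι γ * x ∧ ρ γ (ψ x) = -ψ g) :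
    ∃ Ψ : H → A, (∀ γ g, Ψ (ι γ * g) = ρ γ (Ψ g)) ∧ (∀ g ∈ P, Ψ g = ψ g) ∧
      (∀ g, Ψ (g * s) = -Ψ g) ∧ ∀ g, Ψ g + Ψ (g * r) + Ψ (g * (r * r)) = 0 := by
  choose δ hδ using hP.cover
  -- An edge is moved into `P`, evaluated there and moved back; `key` shows that the choice of `δ`
  -- does not matter.
  set Ψ : H → A := fun g => ρ (δ g)⁻¹ (ψ (ι (δ g) * g)) with hΨ
  have key : ∀ γ, ∀ g ∈ P, Ψ (ι γ * g) = ρ γ (ψ g) := by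
    intro γ g hg
    obtain ⟨e1, e2⟩ := hP.unique h (γ := (δ (ι γ * g))⁻¹) (γ' := γ) (hδ (ι γ * g)) hg (by simp)
    simp only [hΨ]
    rw [e1, e2]
  have rep : ∀ g, ∃ γ, ∃ x ∈ P, g = ι γ * x := fun g =>
    ⟨(δ g)⁻¹, ι (δ g) * g, hδ g, by simp⟩
  refine ⟨Ψ, ?_, ?_, ?_, ?_⟩
  · intro γ g
    obtain ⟨γ', x, hx, rfl⟩ := rep g
    rw [← mul_assoc, ← map_mul, key _ _ hx, key _ _ hx, map_mul]
    rfl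
  · intro g hg
    simpa using key 1 g hg
  · intro g
    obtain ⟨γ, x, hx, rfl⟩ := rep g
    rw [key _ _ hx, mul_assoc]
    by_cases hxB : x ∈ B
    · obtain ⟨γ', y, hy, e1, e2⟩ := hB x hxB
      rw [e1, ← mul_assoc, ← map_mul, key _ _ (hP.polygon.subset hy), map_mul]
      change ρ γ (ρ γ' (ψ y)) = _
      rw [e2, map_neg]
    · rw [key _ _ (hP.polygon.interior h x hx hxB).1, hs x hx hxB, map_neg]
  · intro g
    obtain ⟨γ, x, hx, rfl⟩ := rep g
    have h1 := hP.polygon.mul_r_mem h x hx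
    have h2 := hP.polygon.mul_r_mem h _ h1
    rw [mul_assoc] at h2
    rw [mul_assoc, mul_assoc, key _ _ hx, key _ _ h1, key _ _ h2, ← map_add, ← map_add, hr x hx,
      map_zero]

end IsFundamental

/-- The Manin relations for the edges of the tessellation: they are generated, as a
`Γ`-module, by `1` and edges `e_j`, and one relation suffices. -/
theorem exists_manin_edges {ι : Γ →* H} (h : ActsFreely ι s r) {τ : Γ} (hτ : ι τ * (r * r) = s)
    (F : Finset H) (hF : ∀ g, ∃ γ, ι γ * g ∈ F)
    (hgen : ∀ N : Set H, 1 ∈ N → (∀ g ∈ N, g * s ∈ N) → (∀ g ∈ N, g * r ∈ N) → ∀ g, g ∈ N)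
    (Q : H → Prop) (hQr : Q r) (hQ : ∀ g, Q g → Q (g * s * r) ∧ Q (g * s * (r * r))) :
    ∃ (t : ℕ) (γ : Fin t → Γ) (e e' : Fin t → H),
      (∀ j, e j * s = ι (γ j) * e' j) ∧ (∀ j, Q (e j) ∧ Q (e' j)) ∧
      (∀ {A : Type} [AddCommGroup A] (ψ : H → A), (∀ g, ψ (g * s) = -ψ g) →
        (∀ g, ψ g + ψ (g * r) + ψ (g * (r * r)) = 0) →
          ψ 1 + ψ (r * r) + ∑ j, (ψ (e j) + ψ (e' j)) = 0) ∧
      (∀ {A : Type} [AddCommGroup A] (ψ : H → A), (∀ g, ψ (g * s) = -ψ g) →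
        (∀ g, ψ g + ψ (g * r) + ψ (g * (r * r)) = 0) →
        ∀ N : AddSubgroup A, (∀ γ g, ψ g ∈ N → ψ (ι γ * g) ∈ N) → ψ 1 ∈ N → (∀ j, ψ (e j) ∈ N) →
          ∀ g, ψ g ∈ N) ∧
      ∀ {A : Type} [AddCommGroup A] (ρ : Γ →* AddMonoid.End A) (a₀ : A) (a : Fin t → A),
        a₀ - ρ τ⁻¹ a₀ + ∑ j, (a j - ρ (γ j)⁻¹ (a j)) = 0 →
        ∃ ψ : H → A, (∀ γ g, ψ (ι γ * g) = ρ γ (ψ g)) ∧ (∀ g, ψ (g * s) = -ψ g) ∧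
          (∀ g, ψ g + ψ (g * r) + ψ (g * (r * r)) = 0) ∧ ψ 1 = a₀ ∧ ∀ j, ψ (e j) = a j := by
  obtain ⟨P, B, hP, hcov⟩ := Polygon.exists_fundamental h F hF hgen
  have hPB : IsFundamental ι s r P B := ⟨hP, hcov⟩
  obtain ⟨h1, h2, h3⟩ := hP.boundary_spec h hτ Q hQr hQ
  obtain ⟨t, γ, e, e', he, heB, heB', hall, hinj, hne, hsum⟩ := hPB.exists_pairing h hτ h1 h2
  refine ⟨t, γ, e, e', he, fun j => ⟨?_, ?_⟩, ?_, ?_, ?_⟩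
  · exact ((h3 _ (heB j).1).resolve_left (heB j).2.1).resolve_left (heB j).2.2
  · exact ((h3 _ (heB' j).1).resolve_left (heB' j).2.1).resolve_left (heB' j).2.2
  · intro A _ ψ hs hr
    rw [← hP.sum_boundary h hs hr, hsum]
  · intro A _ ψ hs hr N hN hN1 hNe g
    have hmem : ∀ g ∈ P, ψ g ∈ N := by
      refine hP.mem_of_boundary hs hr N fun g hg => ?_
      rcases hall g hg with rfl | rfl | ⟨j, rfl | rfl⟩
      · exact hN1
      · have : r * r = ι τ⁻¹ * (1 * s) := by rw [one_mul, ← hτ, map_inv, inv_mul_cancel_left]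
        rw [this]
        apply hN
        rw [hs]
        exact N.neg_mem hN1
      · exact hNe j
      · have : e' j = ι (γ j)⁻¹ * (e j * s) := by rw [he, map_inv, inv_mul_cancel_left]
        rw [this]
        apply hN
        rw [hs]
        exact N.neg_mem (hNe j)
    obtain ⟨δ, hδ⟩ := hcov g
    have := hN δ⁻¹ _ (hmem _ hδ)
    rwa [map_inv, inv_mul_cancel_left] at this
  -- The absence of further relations, as a universal property. Prescribed values determine values
  -- on all sides through the pairing, and `ha` says that these sum to zero; `exists_extension`
  -- fills the polygon and `exists_equivariant` spreads the result over all edges.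
  · intro A _ ρ a₀ a ha
    classical
    set φ : H → A := fun g => if g = 1 then a₀ else if g = r * r then -ρ τ⁻¹ a₀ else
      if hg : ∃ j, g = e j then a hg.choose else
      if hg : ∃ j, g = e' j then -ρ (γ hg.choose)⁻¹ (a hg.choose) else 0 with hφ
    have hinj' : Function.Injective e' := by
      intro i j hij
      have h4 : ι (γ i)⁻¹ * (e i * s) = ι (γ j)⁻¹ * (e j * s) := by
        rw [he, he, map_inv, map_inv, inv_mul_cancel_left, inv_mul_cancel_left, hij]
      rw [← mul_assoc, ← mul_assoc, mul_left_inj] at h4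
      exact hinj (hPB.unique h (hP.subset (heB i).1) (hP.subset (heB j).1) h4).2
    have h12 : r * r ≠ 1 := by simpa using h.mul_rr_ne 1
    have φ1 : φ 1 = a₀ := by simp [hφ]
    have φ2 : φ (r * r) = -ρ τ⁻¹ a₀ := by simp [hφ, h12]
    have φe : ∀ j, φ (e j) = a j := by
      intro j
      have hg : ∃ i, e j = e i := ⟨j, rfl⟩
      have : hg.choose = j := (hinj hg.choose_spec).symm
      simp only [hφ, (heB j).2.1, (heB j).2.2, if_false, dif_pos hg, this]
    have φe' : ∀ j, φ (e' j) = -ρ (γ j)⁻¹ (a j) := by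
      intro j
      have hg : ∃ i, e' j = e' i := ⟨j, rfl⟩
      have hg' : ¬ ∃ i, e' j = e i := fun ⟨i, hi⟩ => hne i j hi.symm
      have : hg.choose = j := (hinj' hg.choose_spec).symm
      simp only [hφ, (heB' j).2.1, (heB' j).2.2, if_false, dif_neg hg', dif_pos hg, this]
    obtain ⟨ψ, hψB, hψr, hψs⟩ := hP.exists_extension h φ (by
      rw [hsum, φ1, φ2, ← ha]
      simp only [φe, φe', sub_eq_add_neg])
    have hρ : ∀ (γ : Γ) (x : A), ρ γ (ρ γ⁻¹ x) = x := by
      intro γ x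
      change (ρ γ * ρ γ⁻¹) x = x
      rw [← map_mul, mul_inv_cancel, map_one]
      rfl
    obtain ⟨Ψ, p1, p2, p3, p4⟩ := hPB.exists_equivariant h ρ ψ hψr hψs (by
      intro g hg
      rcases hall g hg with rfl | rfl | ⟨j, rfl | rfl⟩
      · exact ⟨τ, _, h2, by rw [hτ, one_mul], by rw [hψB _ h2, hψB _ h1, φ1, φ2, map_neg, hρ]⟩
      · refine ⟨τ⁻¹, _, h1, ?_, by rw [hψB _ h2, hψB _ h1, φ1, φ2, neg_neg]⟩
        rw [map_inv, eq_inv_mul_iff_mul_eq, ← mul_assoc, hτ, h.s_sq]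
      · exact ⟨γ j, _, (heB' j).1, he j, by
          rw [hψB _ (heB j).1, hψB _ (heB' j).1, φe, φe', map_neg, hρ]⟩
      · refine ⟨(γ j)⁻¹, _, (heB j).1, ?_, by
          rw [hψB _ (heB j).1, hψB _ (heB' j).1, φe, φe', neg_neg]⟩
        rw [map_inv, eq_inv_mul_iff_mul_eq, ← mul_assoc, ← he, h.mul_ss])
    refine ⟨Ψ, p1, p3, p4, ?_, fun j => ?_⟩
    · rw [p2 _ (hP.subset h1), hψB _ h1, φ1]
    · rw [p2 _ (hP.subset (heB j).1), hψB _ (heB j).1, φe]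

end Pairing


/-! ### The Farey tessellation -/

section Farey

open ModularGroup Matrix

/-- The element of order `6` that rotates the triangle with vertices `∞`, `0`, `-1`. -/
def U : SL(2, ℤ) := S * T

/-- The lower triangular unipotent matrix. -/
def L : SL(2, ℤ) := ⟨!![1, 0; 1, 1], by simp [det_fin_two]⟩

theorem coe_L : (L : Matrix (Fin 2) (Fin 2) ℤ) = !![1, 0; 1, 1] := rfl

theorem coe_U : (U : Matrix (Fin 2) (Fin 2) ℤ) = !![0, -1; 1, 1] := by decide

theorem S_mul_S : S * S = -1 := by decide

theorem U_cube : U * U * U = -1 := by decide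

theorem S_mul_U : S * U = -T := by rw [U, ← mul_assoc, S_mul_S, neg_one_mul]

theorem S_mul_U_sq : S * (U * U) = -L := by decide

theorem T_mul_U_sq : T * (U * U) = S := by decide

/-- The cusp `g ∞`. -/
def cusp (g : SL(2, ℤ)) : OnePoint ℚ := SpecialLinearGroup.mapGL ℚ g • (OnePoint.infty)

theorem cusp_eq (g : SL(2, ℤ)) :
    cusp g = if g 1 0 = 0 then OnePoint.infty else (((g 0 0 : ℚ) / (g 1 0 : ℚ) : ℚ) : OnePoint ℚ) := by
  rw [cusp, OnePoint.smul_infty_eq_ite]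
  simp

theorem cusp_neg (g : SL(2, ℤ)) : cusp (-g) = cusp g := by
  simp [cusp_eq]

theorem cusp_mul (g h : SL(2, ℤ)) : cusp (g * h) = SpecialLinearGroup.mapGL ℚ g • cusp h := by
  simp [cusp, mul_smul]

theorem cusp_mul_T_zpow (g : SL(2, ℤ)) (k : ℤ) : cusp (g * T ^ k) = cusp g := by
  rw [cusp_mul, cusp_eq (T ^ k)]
  simp [coe_T_zpow, cusp]

theorem cusp_mul_T (g : SL(2, ℤ)) : cusp (g * T) = cusp g := by
  simpa using cusp_mul_T_zpow g 1

theorem cusp_S : cusp S = ((0 : ℚ) : OnePoint ℚ) := by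
  simp [cusp_eq, coe_S]

theorem exists_cusp_eq (x : OnePoint ℚ) : ∃ g, cusp g = x := by
  induction x using OnePoint.rec with
  | infty => exact ⟨1, by simp [cusp_eq]⟩
  | coe q =>
    obtain ⟨g, h0, h1⟩ := IsCoprime.exists_SL2_col
      (Int.isCoprime_iff_gcd_eq_one.mpr (by simpa [Int.gcd] using q.reduced) :
        IsCoprime q.num (q.den : ℤ)) 0
    refine ⟨g, ?_⟩
    rw [cusp_eq, h0, h1, if_neg (by simp)]
    simp [Rat.num_div_den]

/-- The divisor `g ({0} - {∞})`. -/
def edge (g : SL(2, ℤ)) : DivZero := divAct g divInfty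

theorem coe_edge (g : SL(2, ℤ)) :
    (edge g : OnePoint ℚ →₀ ℤ) = Finsupp.single (cusp (g * S)) 1 - Finsupp.single (cusp g) 1 := by
  rw [cusp_mul, cusp_S]
  change Finsupp.mapDomain _ (Finsupp.single _ 1 - Finsupp.single _ 1) = _
  rw [Finsupp.mapDomain_sub, Finsupp.mapDomain_single, Finsupp.mapDomain_single]
  rfl

theorem divAct_edge (g h : SL(2, ℤ)) : divAct g (edge h) = edge (g * h) := by
  rw [edge, edge, map_mul]
  rfl

/-- The divisor `{x} - {∞}`. -/
def toInfty (x : OnePoint ℚ) : DivZero :=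
  ⟨Finsupp.single x 1 - Finsupp.single OnePoint.infty 1, by
    rw [DivZero, AddMonoidHom.mem_ker, map_sub]; simp⟩

theorem entries_mul_T_zpow (g : SL(2, ℤ)) (k : ℤ) :
    (g * T ^ k) 0 0 = g 0 0 ∧ (g * T ^ k) 1 0 = g 1 0 ∧
      (g * T ^ k) 0 1 = g 0 1 + k * g 0 0 ∧ (g * T ^ k) 1 1 = g 1 1 + k * g 1 0 := by
  refine ⟨?_, ?_, ?_, ?_⟩ <;>
    simp only [Matrix.SpecialLinearGroup.coe_mul, mul_apply, Fin.sum_univ_two, coe_T_zpow] <;>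
    simp [add_comm, mul_comm]

theorem entries_mul_S (g : SL(2, ℤ)) :
    (g * S) 0 0 = g 0 1 ∧ (g * S) 1 0 = g 1 1 ∧
      (g * S) 0 1 = -g 0 0 ∧ (g * S) 1 1 = -g 1 0 := by
  refine ⟨?_, ?_, ?_, ?_⟩ <;>
    simp only [Matrix.SpecialLinearGroup.coe_mul, mul_apply, Fin.sum_univ_two, coe_S] <;> simp

/-- Every cusp other than `∞` is joined to a cusp of smaller denominator. -/
theorem exists_reduced (g : SL(2, ℤ)) (hg : g 1 0 ≠ 0) :
    ∃ k : ℤ, 0 ≤ (g * T ^ k) 1 1 ∧ (g * T ^ k) 1 1 < |g 1 0| := by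
  refine ⟨-(g 1 1 / g 1 0), ?_⟩
  rw [(entries_mul_T_zpow g _).2.2.2]
  have : g 1 1 + -(g 1 1 / g 1 0) * g 1 0 = g 1 1 % g 1 0 := by
    rw [Int.emod_def]; ring
  rw [this]
  exact ⟨Int.emod_nonneg _ hg, Int.emod_lt_abs _ hg⟩

/-- The edges of the tessellation generate the divisors of degree zero. -/
theorem mem_of_edge_mem (N : AddSubgroup DivZero) (hN : ∀ g, edge g ∈ N) (D : DivZero) :
    D ∈ N := by
  have key : ∀ n : ℕ, ∀ g : SL(2, ℤ), (g 1 0).natAbs = n → toInfty (cusp g) ∈ N := by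
    intro n
    induction n using Nat.strong_induction_on with
    | _ n ih =>
      intro g hg
      by_cases h0 : g 1 0 = 0
      · rw [cusp_eq, if_pos h0]
        convert N.zero_mem
        exact Subtype.ext (by simp [toInfty])
      · obtain ⟨k, hk0, hk⟩ := exists_reduced g h0
        have hlt : ((g * T ^ k * S) 1 0).natAbs < n := by
          rw [(entries_mul_S _).2.1, ← hg]; zify; rwa [abs_of_nonneg hk0]
        have h1 := ih _ hlt _ rfl
        -- The edge of `g * T ^ k` joins the cusp of `g` to one whose denominator is the reduced
        -- lower right entry.
        have h2 : toInfty (cusp g) = toInfty (cusp (g * T ^ k * S)) - edge (g * T ^ k) := by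
          apply Subtype.ext
          rw [AddSubgroup.coe_sub, coe_edge, cusp_mul_T_zpow]
          simp only [toInfty]
          abel
        rw [h2]
        exact N.sub_mem h1 (hN _)
  have hD : D = ∑ x ∈ D.1.support, D.1 x • toInfty x := by
    apply Subtype.ext
    have h0 : D.1.sum (fun _ n => n) = 0 := D.2
    rw [AddSubgroup.val_finsetSum]
    simp only [AddSubgroup.coe_zsmul, toInfty, smul_sub, Finset.sum_sub_distrib,
      ← Finset.sum_smul]
    rw [show ∑ x ∈ D.1.support, D.1 x = 0 from h0, zero_smul, sub_zero]
    conv_lhs => rw [← Finsupp.sum_single D.1]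
    simp [Finsupp.sum]
  rw [hD]
  refine N.sum_mem fun x _ => N.zsmul_mem ?_ _
  obtain ⟨g, rfl⟩ := exists_cusp_eq x
  exact key _ g rfl

/-! ### Functions on edges as coboundaries of potentials on cusps. -/

section Potential

variable {A : Type*} [AddCommGroup A]

/-- The conditions stand behind the quantifier so that choice gives a total function, with a junk
value where they fail. -/
theorem exists_normalized (a : ℤ) (c : ℕ) : ∃ g : SL(2, ℤ), 0 < c → IsCoprime a (c : ℤ) →
    g 0 0 = a ∧ g 1 0 = c ∧ 0 ≤ g 1 1 ∧ g 1 1 < c := by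
  by_cases h : 0 < c ∧ IsCoprime a (c : ℤ)
  · obtain ⟨g, h0, h1⟩ := h.2.exists_SL2_col 0
    obtain ⟨k, hk0, hk⟩ := exists_reduced g (by rw [h1]; lia)
    have := entries_mul_T_zpow g k
    refine ⟨g * T ^ k, fun _ _ => ⟨by rw [this.1, h0], by rw [this.2.1, h1], hk0, ?_⟩⟩
    rw [h1, abs_of_pos (by lia)] at hk
    exact hk
  · exact ⟨1, fun h1 h2 => absurd ⟨h1, h2⟩ h⟩

/-- The matrix with first column `a`, `c` whose lower right entry is reduced modulo `c`. -/
def normalized (a : ℤ) (c : ℕ) : SL(2, ℤ) := (exists_normalized a c).choose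

/-- The determinant fixes the lower right entry modulo `c`, as an inverse of `a`, so only one choice
lies in `[0, c)`; it then fixes the upper right entry. -/
theorem eq_normalized (g : SL(2, ℤ)) (hc : 0 < g 1 0) (h0 : 0 ≤ g 1 1) (h1 : g 1 1 < g 1 0) :
    g = normalized (g 0 0) (g 1 0).toNat := by
  have hdet : g 0 0 * g 1 1 - g 0 1 * g 1 0 = 1 := by
    rw [← det_fin_two]; exact g.2
  have hcop : IsCoprime (g 0 0) ((g 1 0).toNat : ℤ) := by
    rw [Int.toNat_of_nonneg hc.le]
    exact ⟨g 1 1, -g 0 1, by linarith⟩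
  obtain ⟨n0, n1, n2, n3⟩ := (exists_normalized (g 0 0) (g 1 0).toNat).choose_spec (by lia) hcop
  change (normalized _ _) 0 0 = _ at n0
  change (normalized _ _) 1 0 = _ at n1
  change 0 ≤ (normalized _ _) 1 1 at n2
  change (normalized _ _) 1 1 < _ at n3
  set m := normalized (g 0 0) (g 1 0).toNat
  rw [Int.toNat_of_nonneg hc.le] at n1 n3
  have hdet' : m 0 0 * m 1 1 - m 0 1 * m 1 0 = 1 := by
    rw [← det_fin_two]; exact m.2
  rw [n0, n1] at hdet'
  have hk : m 1 1 - g 1 1 = g 1 0 * (g 1 1 * m 0 1 - g 0 1 * m 1 1) := by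
    linear_combination m 1 1 * (-hdet) + g 1 1 * hdet'
  have hd : g 1 1 = m 1 1 := by
    have hk0 : g 1 1 * m 0 1 - g 0 1 * m 1 1 = 0 := by
      by_contra hne
      rcases lt_or_gt_of_ne hne with h | h
      · nlinarith
      · nlinarith
    rw [hk0] at hk
    linarith
  have hb : g 0 1 = m 0 1 := by
    have : g 1 0 * (g 0 1 - m 0 1) = 0 := by
      rw [hd] at hdet
      linear_combination hdet' - hdet
    rcases mul_eq_zero.mp this with h | h
    · lia
    · linarith
  ext i j
  fin_cases i <;> fin_cases j
  · exact n0.symm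
  · exact hb
  · exact n1.symm
  · exact hd

/-- The value at the cusp `a / c` of the potential of `φ`. -/
def potentialAux (φ : SL(2, ℤ) → A) (c : ℕ) (a : ℤ) : A :=
  -- The recursion descends along the edge from `a / c` to the cusp given by the second column. For
  -- `c = 0` the test fails, and the cusp `∞` gets the base value `0`.
  if ((normalized a c) 1 1).toNat < c then
    potentialAux φ ((normalized a c) 1 1).toNat ((normalized a c) 0 1) - φ (normalized a c)
  else 0
termination_by c

/-- The function on cusps with differences `φ`. -/
def potential (φ : SL(2, ℤ) → A) (x : OnePoint ℚ) : A :=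
  x.elim 0 fun q => potentialAux φ q.den q.num

theorem potential_cusp (φ : SL(2, ℤ) → A) (g : SL(2, ℤ)) (hg : 0 ≤ g 1 0) :
    potential φ (cusp g) = potentialAux φ (g 1 0).toNat (g 0 0) := by
  rcases hg.eq_or_lt with h | h
  · rw [cusp_eq, if_pos h.symm, ← h]
    rw [potentialAux]
    simp [potential]
  · have hdet : g 0 0 * g 1 1 - g 0 1 * g 1 0 = 1 := by
      rw [← det_fin_two]; exact g.2
    have hcop : Nat.Coprime (g 0 0).natAbs (g 1 0).natAbs :=
      Int.isCoprime_iff_gcd_eq_one.mp ⟨g 1 1, -g 0 1, by linarith⟩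
    rw [cusp_eq, if_neg h.ne']
    change potentialAux φ ((g 0 0 : ℚ) / (g 1 0 : ℚ)).den ((g 0 0 : ℚ) / (g 1 0 : ℚ)).num = _
    rw [Rat.num_div_eq_of_coprime h hcop]
    congr 1
    have := Rat.den_div_eq_of_coprime h hcop
    lia

/-- A function on oriented edges satisfying the two- and three-term relations is the
coboundary of its potential. -/
theorem potential_sub {φ : SL(2, ℤ) → A} (hS : ∀ g, φ (g * S) = -φ g)
    (hU : ∀ g, φ g + φ (g * U) + φ (g * (U * U)) = 0) (g : SL(2, ℤ)) :
    potential φ (cusp (g * S)) - potential φ (cusp g) = φ g := by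
  set f : SL(2, ℤ) → A := fun g => potential φ (cusp g) with hf
  have fT : ∀ g, f (g * T) = f g := fun g => by simp only [hf, cusp_mul_T]
  have fneg : ∀ g, f (-g) = f g := fun g => by simp only [hf, cusp_neg]
  have φneg : ∀ g, φ (-g) = φ g := fun g => by
    rw [← neg_neg (φ g), ← hS, ← hS, mul_assoc, S_mul_S, mul_neg_one]
  -- The identity may be checked on the reversed edge (`cS`), for the opposite matrix (`cneg`), or
  -- on the other two edges of the triangle (`cU`).
  have cS : ∀ g, f (g * S * S) - f (g * S) = φ (g * S) → f (g * S) - f g = φ g := by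
    intro g h
    rw [mul_assoc, S_mul_S, mul_neg_one, fneg, hS] at h
    rw [← neg_sub, h, neg_neg]
  have cneg : ∀ g, f (-g * S) - f (-g) = φ (-g) → f (g * S) - f g = φ g := by
    intro g h
    rwa [neg_mul, fneg, fneg, φneg] at h
  have cU : ∀ g, f (g * U * S) - f (g * U) = φ (g * U) →
      f (g * (U * U) * S) - f (g * (U * U)) = φ (g * (U * U)) → f (g * S) - f g = φ g := by
    intro g h1 h2
    have e1 : f (g * U) = f (g * S) := by rw [U, ← mul_assoc, fT]
    have e2 : f (g * (U * U)) = f (g * U * S) := by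
      rw [← mul_assoc, show g * U * U = g * U * S * T by rw [mul_assoc (g * U) S T]; rfl, fT]
    have e3 : f (g * (U * U) * S) = f g := by
      rw [← fT, show g * (U * U) * S * T = -g by
        rw [mul_assoc _ S T, ← U, mul_assoc, U_cube, mul_neg_one], fneg]
    have := hU g
    rw [add_assoc, add_eq_zero_iff_eq_neg, ← h1, ← h2, e1, e2, e3] at this
    rw [this]
    abel
  -- For a normalized matrix the identity is the recursion that defines the potential.
  have cnorm : ∀ g : SL(2, ℤ), 0 < g 1 0 → 0 ≤ g 1 1 → g 1 1 < g 1 0 → f (g * S) - f g = φ g := by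
    intro g hc h0 h1
    have e1 := potential_cusp φ (g * S) (by rw [(entries_mul_S g).2.1]; exact h0)
    rw [(entries_mul_S g).1, (entries_mul_S g).2.1] at e1
    have e2 := potential_cusp φ g hc.le
    rw [potentialAux, ← eq_normalized g hc h0 h1, if_pos (by lia)] at e2
    simp only [hf]
    rw [e1, e2]
    abel
  have main : ∀ n : ℕ, ∀ g : SL(2, ℤ), (g 1 0).natAbs + (g 1 1).natAbs = n →
      f (g * S) - f g = φ g := by
    intro n
    induction n using Nat.strong_induction_on with
    | _ n ih =>
      have hpos : ∀ g : SL(2, ℤ), (g 1 0).natAbs + (g 1 1).natAbs = n → 0 < g 1 0 →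
          |g 1 1| ≤ g 1 0 → f (g * S) - f g = φ g := by
        intro g hn hc hd
        have hdet : g 0 0 * g 1 1 - g 0 1 * g 1 0 = 1 := by
          rw [← det_fin_two]; exact g.2
        have hL : g * (S * (U * U)) = -(g * L) := by rw [S_mul_U_sq, mul_neg]
        -- Let `(c, d)` be the bottom row. For `-c ≤ d < 0` the triangle across the edge has outer
        -- edges with bottom rows `(c, c + d)`, which is normalized, and `(c + d, d)`, which is
        -- smaller.
        rcases lt_or_ge (g 1 1) 0 with hneg | hnn
        · apply cS
          apply cU
          · rw [mul_assoc g S U, S_mul_U, mul_neg]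
            apply cneg
            rw [neg_neg]
            have := entries_mul_T_zpow g 1
            rw [zpow_one] at this
            rw [abs_le] at hd
            apply cnorm
            · lia
            · lia
            · lia
          · rw [mul_assoc g S (U * U), hL]
            apply cneg
            rw [neg_neg]
            apply ih _ _ _ rfl
            have e1 : (g * L) 1 0 = g 1 0 + g 1 1 := by
              simp [coe_L, mul_apply, Fin.sum_univ_two]
            have e2 : (g * L) 1 1 = g 1 1 := by
              simp [coe_L, mul_apply, Fin.sum_univ_two]
            rw [abs_le] at hd
            rw [e1, e2]
            lia
        · rcases (le_of_abs_le hd).lt_or_eq with hlt | heq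
          · exact cnorm g hc hnn hlt
          -- Here `c = d`, so both are `1` by the determinant; the other edges of the triangle have
          -- bottom row `(1, 0)`, one of them after a reversal.
          · have hone : g 1 0 = 1 := by
              rw [heq, ← sub_mul] at hdet
              exact Int.eq_one_of_mul_eq_one_left hc.le hdet
            have e1 : (g * U) 1 0 = g 1 1 := by
              simp [coe_U, mul_apply, Fin.sum_univ_two]
            have e2 : (g * U) 1 1 = g 1 1 - g 1 0 := by
              simp [coe_U, mul_apply, Fin.sum_univ_two]; ring
            apply cU
            · apply cnorm <;> lia
            · apply cS
              apply cneg
              have e3 : -(g * (U * U) * S) = g * T ^ (-1 : ℤ) := by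
                rw [mul_assoc, ← mul_neg]
                congr 1
                decide
              rw [e3]
              have := entries_mul_T_zpow g (-1)
              apply cnorm <;> lia
      have habs : ∀ g : SL(2, ℤ), (g 1 0).natAbs + (g 1 1).natAbs = n →
          |g 1 1| ≤ |g 1 0| → f (g * S) - f g = φ g := by
        intro g hn hd
        have hdet : g 0 0 * g 1 1 - g 0 1 * g 1 0 = 1 := by
          rw [← det_fin_two]; exact g.2
        rcases lt_trichotomy (g 1 0) 0 with hc | hc | hc
        · apply cneg
          have e1 : (-g) 1 0 = -g 1 0 := by simp
          have e2 : (-g) 1 1 = -g 1 1 := by simp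
          apply hpos
          · lia
          · lia
          · rw [e1, e2, abs_neg, ← abs_of_neg hc]; exact hd
        · rw [hc, abs_zero, abs_nonpos_iff] at hd
          rw [hc, hd] at hdet
          simp at hdet
        · exact hpos g hn hc (by rwa [abs_of_pos hc] at hd)
      intro g hn
      rcases le_total |g 1 1| |g 1 0| with h | h
      · exact habs g hn h
      · apply cS
        have := entries_mul_S g
        apply habs
        · lia
        · rw [this.2.1, this.2.2.2, abs_neg]; exact h
  exact main _ g rfl

/-- The universal property of the group of divisors of degree zero: it is presented by the edges
of the tessellation with the two- and three-term relations. -/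
theorem exists_hom_of_edges {φ : SL(2, ℤ) → A} (hS : ∀ g, φ (g * S) = -φ g)
    (hU : ∀ g, φ g + φ (g * U) + φ (g * (U * U)) = 0) :
    ∃ Φ : DivZero →+ A, ∀ g, Φ (edge g) = φ g := by
  refine ⟨(Finsupp.liftAddHom fun x => (zmultiplesHom A) (potential φ x)).comp
    DivZero.subtype, fun g => ?_⟩
  rw [AddMonoidHom.comp_apply, AddSubgroup.subtype_apply, coe_edge, map_sub,
    ← potential_sub hS hU g]
  simp

end Potential

end Farey


/-! ### Solutions of the Manin relations -/

section Manin

open ModularGroup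

/-- The group `PSL₂(ℤ)`. -/
abbrev PSL2 : Type := SL(2, ℤ) ⧸ Subgroup.center SL(2, ℤ)

theorem mem_center_iff_eq {g : SL(2, ℤ)} : g ∈ Subgroup.center SL(2, ℤ) ↔ g = 1 ∨ g = -1 := by
  rw [Matrix.SpecialLinearGroup.mem_center_iff]
  constructor
  · rintro ⟨r, hr, h⟩
    rw [Fintype.card_fin] at hr
    rcases (sq_eq_sq_iff_eq_or_eq_neg.mp (hr.trans (one_pow 2).symm)) with rfl | rfl
    · left; apply Subtype.ext; rw [← h]; simp
    · right; apply Subtype.ext; rw [← h]; simp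
  · rintro (rfl | rfl)
    · exact ⟨1, by simp, by simp⟩
    · exact ⟨-1, by simp, by simp⟩

theorem mk_eq_mk_iff {g h : SL(2, ℤ)} :
    (QuotientGroup.mk g : PSL2) = QuotientGroup.mk h ↔ h = g ∨ h = -g := by
  rw [QuotientGroup.eq, mem_center_iff_eq, inv_mul_eq_iff_eq_mul, inv_mul_eq_iff_eq_mul, mul_one,
    mul_neg_one]

theorem mk_neg (g : SL(2, ℤ)) : (QuotientGroup.mk (-g) : PSL2) = QuotientGroup.mk g :=
  mk_eq_mk_iff.mpr (Or.inr (neg_neg g).symm)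

theorem edge_neg (g : SL(2, ℤ)) : edge (-g) = edge g :=
  Subtype.ext (by rw [coe_edge, coe_edge, neg_mul, cusp_neg, cusp_neg])

/-- The divisor of an edge of the tessellation. -/
def edgeDiv (x : PSL2) : DivZero := edge x.out

theorem edgeDiv_mk (g : SL(2, ℤ)) : edgeDiv (QuotientGroup.mk g) = edge g := by
  have h : (QuotientGroup.mk g : PSL2) =
    QuotientGroup.mk (Quotient.out (QuotientGroup.mk g : PSL2)) := (QuotientGroup.out_eq' _).symm
  rcases mk_eq_mk_iff.mp h with h | h
  · rw [edgeDiv, h]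
  · rw [edgeDiv, h, edge_neg]

theorem edge_mul_S (g : SL(2, ℤ)) : edge (g * S) = -edge g := by
  apply Subtype.ext
  rw [AddSubgroup.coe_neg, coe_edge, coe_edge, mul_assoc, S_mul_S, mul_neg_one, cusp_neg]
  abel

theorem edge_triangle (g : SL(2, ℤ)) : edge g + edge (g * U) + edge (g * (U * U)) = 0 := by
  have e1 : cusp (g * U) = cusp (g * S) := by rw [U, ← mul_assoc, cusp_mul_T]
  have e2 : cusp (g * (U * U)) = cusp (g * U * S) := by
    rw [← mul_assoc, show g * U * U = g * U * S * T by rw [mul_assoc (g * U) S T]; rfl, cusp_mul_T]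
  have e3 : cusp (g * (U * U) * S) = cusp g := by
    rw [← cusp_mul_T, show g * (U * U) * S * T = -g by
      rw [mul_assoc _ S T, ← U, mul_assoc, U_cube, mul_neg_one], cusp_neg]
  apply Subtype.ext
  rw [AddSubgroup.coe_add, AddSubgroup.coe_add, coe_edge, coe_edge, coe_edge, e1, e2, e3,
    AddSubgroup.coe_zero]
  abel

theorem edgeDiv_mul_s (x : PSL2) : edgeDiv (x * QuotientGroup.mk S) = -edgeDiv x := by
  obtain ⟨g, rfl⟩ := QuotientGroup.mk_surjective x
  rw [← QuotientGroup.mk_mul, edgeDiv_mk, edgeDiv_mk, edge_mul_S]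

theorem edgeDiv_triangle (x : PSL2) :
    edgeDiv x + edgeDiv (x * QuotientGroup.mk U) +
      edgeDiv (x * (QuotientGroup.mk U * QuotientGroup.mk U)) = 0 := by
  obtain ⟨g, rfl⟩ := QuotientGroup.mk_surjective x
  rw [← QuotientGroup.mk_mul, ← QuotientGroup.mk_mul, ← QuotientGroup.mk_mul, edgeDiv_mk,
    edgeDiv_mk, edgeDiv_mk, edge_triangle]

theorem edgeDiv_one : edgeDiv 1 = divInfty := by
  rw [← QuotientGroup.mk_one, edgeDiv_mk, edge, map_one]
  rfl

variable (Γ : Subgroup SL(2, ℤ))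

/-- The map from a subgroup of `SL₂(ℤ)` to `PSL₂(ℤ)`. -/
def toPSL : Γ →* PSL2 := (QuotientGroup.mk' _).comp Γ.subtype

variable {Γ}

theorem toPSL_apply (γ : Γ) : toPSL Γ γ = QuotientGroup.mk (γ : SL(2, ℤ)) := rfl

theorem edgeDiv_smul (γ : Γ) (x : PSL2) :
    edgeDiv (toPSL Γ γ * x) = divAct (γ : SL(2, ℤ)) (edgeDiv x) := by
  obtain ⟨g, rfl⟩ := QuotientGroup.mk_surjective x
  rw [toPSL_apply, ← QuotientGroup.mk_mul, edgeDiv_mk, edgeDiv_mk, divAct_edge]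

/-- An element of `Γ` that reverses or rotates an edge is conjugate up to sign to `S` or `U`, hence
torsion. Torsion-freeness excludes this, and it excludes `-1`, which gives injectivity. -/
theorem actsFreely_toPSL (htors : ∀ g ∈ Γ, IsOfFinOrder g → g = 1) :
    ActsFreely (toPSL Γ) (QuotientGroup.mk S) (QuotientGroup.mk U) := by
  -- The exponent `12` is a common multiple of the orders `4` of `S` and `6` of `U`; being even, it
  -- also serves for `-S` and `-U`.
  have hfin : ∀ (γ : Γ) (g y : SL(2, ℤ)), y ^ 12 = 1 → g * y = γ * g → y = 1 := by
    intro γ g y hy h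
    have h1 : (γ : SL(2, ℤ)) = g * y * g⁻¹ := by rw [h]; group
    have h2 : (γ : SL(2, ℤ)) = 1 := by
      apply htors _ γ.2
      rw [isOfFinOrder_iff_pow_eq_one]
      exact ⟨12, by norm_num, by rw [h1, conj_pow, hy]; group⟩
    rw [h2, one_mul] at h
    simpa using h
  have hdich : ∀ (γ : Γ) (g x : SL(2, ℤ)), x ^ 12 = 1 → x ≠ 1 → -x ≠ 1 →
      toPSL Γ γ * QuotientGroup.mk g ≠ QuotientGroup.mk g * QuotientGroup.mk x := by
    intro γ g x hx h1 h2 h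
    rw [toPSL_apply, ← QuotientGroup.mk_mul, ← QuotientGroup.mk_mul, mk_eq_mk_iff] at h
    rcases h with h | h
    · exact h1 (hfin γ g x hx h)
    · refine h2 (hfin γ g (-x) ?_ (by rw [mul_neg, h, neg_neg]))
      rw [Even.neg_pow (by decide), hx]
  refine ⟨?_, ?_, ?_, ?_, ?_⟩
  · rw [injective_iff_map_eq_one]
    intro γ hγ
    rw [toPSL_apply, ← QuotientGroup.mk_one, mk_eq_mk_iff] at hγ
    rcases hγ with h | h
    · exact Subtype.ext h.symm
    · apply Subtype.ext
      apply htors _ γ.2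
      rw [isOfFinOrder_iff_pow_eq_one]
      exact ⟨2, by norm_num, by rw [← neg_sq, ← h, one_pow]⟩
  · rw [← QuotientGroup.mk_mul, S_mul_S, mk_neg]
    rfl
  · rw [← QuotientGroup.mk_mul, ← QuotientGroup.mk_mul, U_cube, mk_neg]
    rfl
  · intro γ x
    obtain ⟨g, rfl⟩ := QuotientGroup.mk_surjective x
    exact hdich γ g S (by decide) (by decide) (by decide)
  · intro γ x
    obtain ⟨g, rfl⟩ := QuotientGroup.mk_surjective x
    exact hdich γ g U (by decide) (by decide) (by decide)

/-- Orbits are cosets `Γ g`, whereas the quotient consists of cosets `g Γ`; hence the inverted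
representatives. -/
theorem exists_finset_orbits [Γ.FiniteIndex] :
    ∃ F : Finset PSL2, ∀ x, ∃ γ, toPSL Γ γ * x ∈ F := by
  classical
  have := Fintype.ofFinite (SL(2, ℤ) ⧸ Γ)
  refine ⟨Finset.univ.image fun q : SL(2, ℤ) ⧸ Γ => QuotientGroup.mk q.out⁻¹, fun x => ?_⟩
  obtain ⟨g, rfl⟩ := QuotientGroup.mk_surjective x
  obtain ⟨γ, hγ⟩ := QuotientGroup.mk_out_eq_mul Γ g⁻¹
  refine ⟨γ⁻¹, Finset.mem_image.mpr ⟨QuotientGroup.mk g⁻¹, Finset.mem_univ _, ?_⟩⟩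
  rw [hγ, toPSL_apply, ← QuotientGroup.mk_mul]
  simp

/-- `S` and `T` generate `SL₂(ℤ)`, and modulo the center `T = S U` and `T⁻¹ = U U S`. -/
theorem psl_induction (N : Set PSL2) (h1 : 1 ∈ N)
    (hs : ∀ g ∈ N, g * QuotientGroup.mk S ∈ N) (hr : ∀ g ∈ N, g * QuotientGroup.mk U ∈ N)
    (x : PSL2) : x ∈ N := by
  obtain ⟨g, rfl⟩ := QuotientGroup.mk_surjective x
  have hg : g ∈ Subgroup.closure {S, T} := by rw [SpecialLinearGroup.SL2Z_generators]; trivial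
  have hsT : ∀ y : PSL2, y * QuotientGroup.mk T = y * QuotientGroup.mk S * QuotientGroup.mk U := by
    intro y
    rw [mul_assoc, ← QuotientGroup.mk_mul, S_mul_U, mk_neg]
  have hsT' : ∀ y : PSL2, y * QuotientGroup.mk T⁻¹ =
      y * QuotientGroup.mk U * QuotientGroup.mk U * QuotientGroup.mk S := by
    intro y
    rw [mul_assoc, mul_assoc, ← QuotientGroup.mk_mul, ← QuotientGroup.mk_mul,
      show U * (U * S) = -T⁻¹ by decide, mk_neg]
  induction hg using Subgroup.closure_induction_right with
  | one => exact h1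
  | mul_right x _ y hy ih =>
    rw [QuotientGroup.mk_mul]
    rcases hy with rfl | rfl
    · exact hs _ ih
    · rw [hsT]; exact hr _ (hs _ ih)
  | mul_inv_cancel x _ y hy ih =>
    rw [QuotientGroup.mk_mul]
    rcases hy with rfl | rfl
    · rw [show S⁻¹ = -S by decide, mk_neg]; exact hs _ ih
    · rw [hsT']; exact hs _ (hr _ (hr _ ih))

/-- The edge is a Euclidean semicircle oriented from right to left. -/
def IsLeftward (x : PSL2) : Prop := ∃ g : SL(2, ℤ), QuotientGroup.mk g = x ∧ 0 < g 1 0 * g 1 1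

theorem IsLeftward.pos {g : SL(2, ℤ)} (h : IsLeftward (QuotientGroup.mk g)) :
    0 < g 1 0 * g 1 1 := by
  obtain ⟨g', e, h'⟩ := h
  rcases mk_eq_mk_iff.mp e with rfl | rfl
  · exact h'
  · simpa using h'

/-- From the bottom row `(c, d)` one passes, up to sign, to `(c, c + d)` and `(c + d, d)`; if `c d >
0`, both products are positive as well. -/
theorem isLeftward_step (x : PSL2) (hx : IsLeftward x) :
    IsLeftward (x * QuotientGroup.mk S * QuotientGroup.mk U) ∧
      IsLeftward (x * QuotientGroup.mk S * (QuotientGroup.mk U * QuotientGroup.mk U)) := by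
  obtain ⟨g, rfl, hg⟩ := hx
  constructor
  · refine ⟨g * T, ?_, ?_⟩
    · rw [mul_assoc, ← QuotientGroup.mk_mul, ← QuotientGroup.mk_mul, S_mul_U, mul_neg, mk_neg]
    · have := entries_mul_T_zpow g 1
      rw [zpow_one] at this
      rw [this.2.1, this.2.2.2]
      nlinarith [sq_nonneg (g 1 0)]
  · refine ⟨g * L, ?_, ?_⟩
    · rw [mul_assoc, ← QuotientGroup.mk_mul, ← QuotientGroup.mk_mul, ← QuotientGroup.mk_mul,
        S_mul_U_sq, mul_neg, mk_neg]
    · have e1 : (g * L) 1 0 = g 1 0 + g 1 1 := by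
        simp [coe_L, Matrix.mul_apply, Fin.sum_univ_two]
      have e2 : (g * L) 1 1 = g 1 1 := by
        simp [coe_L, Matrix.mul_apply, Fin.sum_univ_two]
      rw [e1, e2]
      nlinarith [sq_nonneg (g 1 1)]

/-- A parabolic element fixing `∞` cannot reverse the orientation of such an edge. -/
theorem lower_left_ne_zero {γ : Γ} {x y : PSL2} (h : x * QuotientGroup.mk S = toPSL Γ γ * y)
    (hx : IsLeftward x) (hy : IsLeftward y) : (γ : SL(2, ℤ)) 1 0 ≠ 0 := by
  intro h0
  obtain ⟨g, rfl⟩ := QuotientGroup.mk_surjective x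
  obtain ⟨k, rfl⟩ := QuotientGroup.mk_surjective y
  have hg := hx.pos
  have hk := hy.pos
  rw [toPSL_apply, ← QuotientGroup.mk_mul, ← QuotientGroup.mk_mul] at h
  -- With lower left entry zero, `γ` multiplies the bottom row of `k` by a nonzero integer, so `γ k`
  -- is still leftward; but reversing `g` changes the sign of the product of its bottom entries.
  have h' : IsLeftward (QuotientGroup.mk (g * S)) := by
    rw [h]
    refine ⟨_, rfl, ?_⟩
    have hd : ((γ : SL(2, ℤ)) 1 1) ≠ 0 := by
      intro h1
      have := (γ : SL(2, ℤ)).2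
      rw [Matrix.det_fin_two, h0, h1] at this
      simp at this
    have e : ∀ j, ((γ : SL(2, ℤ)) * k) 1 j = (γ : SL(2, ℤ)) 1 1 * k 1 j := by
      intro j
      simp [Matrix.mul_apply, Fin.sum_univ_two, h0]
    rw [e, e]
    have : 0 < ((γ : SL(2, ℤ)) 1 1) ^ 2 := by positivity
    nlinarith
  have h2 := h'.pos
  have := entries_mul_S g
  rw [this.2.1, this.2.2.2] at h2
  linarith

theorem ringAct_single (γ : Γ) (n : ℤ) (E : DivZero) :
    ringAct Γ (MonoidAlgebra.single γ n) E = n • divAct (γ : SL(2, ℤ)) E := by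
  rw [ringAct, MonoidAlgebra.lift_single]
  rfl

theorem ringAct_add (x y : MonoidAlgebra ℤ Γ) (E : DivZero) :
    ringAct Γ (x + y) E = ringAct Γ x E + ringAct Γ y E := by
  rw [map_add]
  rfl

theorem ringAct_neg (x : MonoidAlgebra ℤ Γ) (E : DivZero) :
    ringAct Γ (-x) E = -ringAct Γ x E := by
  rw [map_neg]
  rfl

theorem ringAct_mul (x y : MonoidAlgebra ℤ Γ) (E : DivZero) :
    ringAct Γ (x * y) E = ringAct Γ x (ringAct Γ y E) := by
  rw [map_mul]
  rfl

/-- The group ring as a ring of operators, on a module over it. -/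
theorem map_ringAct {A : Type*} [AddCommGroup A] [Module (MonoidAlgebra ℤ Γ) A]
    (Φ : DivZero →+ A)
    (h : ∀ (γ : Γ) E, Φ (divAct (γ : SL(2, ℤ)) E) = MonoidAlgebra.single γ (1 : ℤ) • Φ E)
    (x : MonoidAlgebra ℤ Γ) (E : DivZero) : Φ (ringAct Γ x E) = x • Φ E := by
  induction x using MonoidAlgebra.induction_linear with
  | zero => rw [map_zero, zero_smul]; exact map_zero _
  | add x y hx hy => rw [ringAct_add, map_add, hx, hy, add_smul]
  | single γ n =>
    rw [ringAct_single, map_zsmul, h, ← smul_assoc]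
    congr 1
    simp

/-- Part (A): the Manin relations have a solution none of whose matrices fixes `∞`. -/
theorem exists_solvesManinRelations [Γ.FiniteIndex] (htors : ∀ g ∈ Γ, IsOfFinOrder g → g = 1)
    (hT : T ∈ Γ) :
    ∃ (t : ℕ) (γ : Fin t → Γ) (D : Fin t → DivZero),
      SolvesManinRelations Γ hT γ D ∧ ∀ j, (γ j : SL(2, ℤ)) 1 0 ≠ 0 := by
  classical
  obtain ⟨F, hF⟩ := exists_finset_orbits (Γ := Γ)
  have hτ : toPSL Γ ⟨T, hT⟩ * (QuotientGroup.mk U * QuotientGroup.mk U) = QuotientGroup.mk S := by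
    rw [toPSL_apply, ← QuotientGroup.mk_mul, ← QuotientGroup.mk_mul, T_mul_U_sq]
  obtain ⟨t, γ, e, e', he, hQ, hsum, hgen, hext⟩ := exists_manin_edges (actsFreely_toPSL htors) hτ F
    hF psl_induction IsLeftward ⟨U, rfl, by rw [coe_U]; simp⟩ isLeftward_step
  have hinv : ∀ (γ : Γ) (x y : PSL2), x * QuotientGroup.mk S = toPSL Γ γ * y →
      edgeDiv y = -divAct ((γ : SL(2, ℤ))⁻¹) (edgeDiv x) := by
    intro γ x y h
    rw [← map_neg, ← edgeDiv_mul_s, ← Subgroup.coe_inv, ← edgeDiv_smul, h, map_inv,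
      inv_mul_cancel_left]
  -- The boundary sum consists of terms `e_j - γ_j⁻¹ e_j`; the sign turns them into `(γ_j⁻¹ - 1)
  -- D_j`.
  refine ⟨t, γ, fun j => -edgeDiv (e j), ⟨?_, ?_, ?_⟩,
    fun j => lower_left_ne_zero (he j) (hQ j).1 (hQ j).2⟩
  · set N : AddSubgroup DivZero :=
      { carrier := {E | ∃ (x : MonoidAlgebra ℤ Γ) (y : Fin t → MonoidAlgebra ℤ Γ),
          E = ringAct Γ x divInfty + ∑ j, ringAct Γ (y j) (-edgeDiv (e j))}
        zero_mem' := ⟨0, 0, by simp⟩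
        add_mem' := by
          rintro _ _ ⟨x, y, rfl⟩ ⟨x', y', rfl⟩
          refine ⟨x + x', y + y', ?_⟩
          simp only [Pi.add_apply, ringAct_add, Finset.sum_add_distrib]
          abel
        neg_mem' := by
          rintro _ ⟨x, y, rfl⟩
          refine ⟨-x, -y, ?_⟩
          simp only [Pi.neg_apply, ringAct_neg, Finset.sum_neg_distrib, neg_add] } with hN
    have hmem : ∀ x, edgeDiv x ∈ N := by
      apply hgen edgeDiv edgeDiv_mul_s edgeDiv_triangle N
      · rintro δ x ⟨z, y, h⟩
        refine ⟨MonoidAlgebra.single δ 1 * z, fun j => MonoidAlgebra.single δ 1 * y j, ?_⟩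
        have hm : ∀ (z : MonoidAlgebra ℤ Γ) (E : DivZero),
            ringAct Γ (MonoidAlgebra.single δ 1 * z) E = divAct (δ : SL(2, ℤ)) (ringAct Γ z E) := by
          intro z E
          rw [ringAct_mul, ringAct_single, one_smul]
        simp only [hm]
        rw [edgeDiv_smul, h, map_add, map_sum]
      · exact ⟨1, 0, by simp [edgeDiv_one]⟩
      · intro j
        refine ⟨0, -Pi.single j 1, ?_⟩
        rw [Finset.sum_eq_single j]
        · rw [map_zero, Pi.neg_apply, Pi.single_eq_same, ringAct_neg, map_one]
          change edgeDiv (e j) = 0 + -(-edgeDiv (e j))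
          rw [zero_add, neg_neg]
        · intro i _ hij
          simp [hij]
        · simp
    intro E
    exact mem_of_edge_mem N (fun g => by rw [← edgeDiv_mk]; exact hmem _) E
  · have h1 := hsum edgeDiv edgeDiv_mul_s edgeDiv_triangle
    rw [hinv ⟨T, hT⟩ 1 (QuotientGroup.mk U * QuotientGroup.mk U) (by rw [one_mul, hτ]), edgeDiv_one] at h1
    simp only [fun j => hinv (γ j) _ _ (he j)] at h1
    rw [← sub_eq_add_neg, add_eq_zero_iff_eq_neg, ← neg_inj, neg_sub, neg_neg] at h1
    rw [h1]
    refine Finset.sum_congr rfl fun j _ => ?_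
    rw [map_neg]
    abel
  · intro x y hxy
    -- The free module on `1 + t` generators modulo the expected relation `ρ` is used as a target.
    -- The universal properties of edges and divisors give an equivariant map from `DivZero` to it,
    -- so the coefficients of any relation lie in the span of `ρ`.
    set ρ : MonoidAlgebra ℤ Γ × (Fin t → MonoidAlgebra ℤ Γ) :=
      (MonoidAlgebra.single (⟨T, hT⟩ : Γ)⁻¹ 1 - 1,
        fun j => -(MonoidAlgebra.single (γ j)⁻¹ 1 - 1)) with hρ
    set R := Submodule.span (MonoidAlgebra ℤ Γ) {ρ}
    let act : Γ →* AddMonoid.End ((MonoidAlgebra ℤ Γ × (Fin t → MonoidAlgebra ℤ Γ)) ⧸ R) :=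
      (Module.toAddMonoidEnd (MonoidAlgebra ℤ Γ) _).toMonoidHom.comp (MonoidAlgebra.of ℤ Γ)
    have hact : ∀ δ a, act δ a = MonoidAlgebra.single δ (1 : ℤ) • a := fun _ _ => rfl
    obtain ⟨ψ, ψ1, ψ2, ψ3, ψ4, ψ5⟩ := hext act (R.mkQ (1, 0)) (fun j => R.mkQ (0, -Pi.single j 1))
      (by
        simp only [hact, ← map_smul, ← map_sub, ← map_sum, ← map_add]
        rw [Submodule.mkQ_apply, Submodule.Quotient.mk_eq_zero]
        refine Submodule.mem_span_singleton.mpr ⟨-1, ?_⟩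
        rw [neg_one_smul, hρ]
        apply Prod.ext
        · simp [Prod.fst_sum]
        · funext j
          simp only [Prod.snd_neg, Pi.neg_apply, Prod.snd_add, Prod.snd_sub, Prod.snd_sum,
            Prod.smul_snd, Pi.add_apply, Pi.sub_apply, Pi.smul_apply, Finset.sum_apply,
            Pi.zero_apply]
          rw [Finset.sum_eq_single j]
          · simp
            abel
          · intro i _ hij
            simp [Ne.symm hij]
          · simp)
    obtain ⟨Φ, hΦ⟩ := exists_hom_of_edges (φ := fun g => ψ (QuotientGroup.mk g))
      (fun g => by rw [QuotientGroup.mk_mul, ψ2])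
      (fun g => by rw [QuotientGroup.mk_mul, QuotientGroup.mk_mul, QuotientGroup.mk_mul, ψ3])
    have hΦ' : ∀ x, Φ (edgeDiv x) = ψ x := by
      intro x
      obtain ⟨g, rfl⟩ := QuotientGroup.mk_surjective x
      rw [edgeDiv_mk, hΦ]
    have hequiv : ∀ (δ : Γ) E,
        Φ (divAct (δ : SL(2, ℤ)) E) = MonoidAlgebra.single δ (1 : ℤ) • Φ E := by
      intro δ E
      refine mem_of_edge_mem (AddMonoidHom.eqLocus (Φ.comp (divAct (δ : SL(2, ℤ))))
        ((act δ).comp Φ)) (fun g => ?_) E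
      change Φ (divAct (δ : SL(2, ℤ)) (edge g)) = act δ (Φ (edge g))
      rw [divAct_edge, hΦ, hΦ, ← ψ1]
      rfl
    have h0 := congrArg Φ hxy
    rw [map_add, map_sum, map_ringAct Φ hequiv, map_zero, ← edgeDiv_one, hΦ', ψ4] at h0
    simp only [map_ringAct Φ hequiv, map_neg, hΦ', ψ5] at h0
    simp only [← map_neg, ← map_smul, ← map_sum, ← map_add] at h0
    rw [Submodule.mkQ_apply, Submodule.Quotient.mk_eq_zero] at h0
    obtain ⟨s, hs⟩ := Submodule.mem_span_singleton.mp h0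
    refine ⟨s, ?_, fun j => ?_⟩
    · have := congrArg Prod.fst hs
      simp [Prod.fst_sum, hρ] at this
      exact this.symm
    · have := congrFun (congrArg Prod.snd hs) j
      simp only [Prod.snd_add, Prod.snd_sum, Prod.smul_snd, Pi.add_apply, Pi.smul_apply,
        Finset.sum_apply, Prod.snd_neg, Pi.neg_apply, Pi.zero_apply, smul_zero, zero_add] at this
      rw [Finset.sum_eq_single j] at this
      · rw [Pi.single_eq_same, smul_neg, smul_eq_mul, smul_eq_mul, mul_neg_one, neg_neg] at this
        exact this.symm
      · intro i _ hij
        simp [Ne.symm hij]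
      · simp

end Manin


/-! ### Power series bounded on a disc -/

section Bounded

variable {p : ℕ} [Fact p.Prime]

/-- The coefficients of `f` satisfy `‖f_n‖ r ^ n ≤ C`. -/
def Bdd (r C : ℝ) (f : ℚ_[p]⟦X⟧) : Prop := ∀ n, ‖PowerSeries.coeff n f‖ * r ^ n ≤ C

namespace Bdd

variable {r s C C' : ℝ} {f g : ℚ_[p]⟦X⟧}

theorem nonneg (hf : Bdd r C f) : 0 ≤ C := by
  have := hf 0
  rw [pow_zero, mul_one] at this
  exact (norm_nonneg _).trans this

theorem mono (hf : Bdd r C f) (h : C ≤ C') : Bdd r C' f := fun n => (hf n).trans h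

theorem anti (hs : 0 ≤ s) (h : s ≤ r) (hf : Bdd r C f) : Bdd s C f := fun n =>
  (mul_le_mul_of_nonneg_left (pow_le_pow_left₀ hs h n) (norm_nonneg _)).trans (hf n)

theorem add (hr : 0 ≤ r) (hf : Bdd r C f) (hg : Bdd r C g) : Bdd r C (f + g) := fun n => by
  rw [map_add]
  refine (mul_le_mul_of_nonneg_right (IsUltrametricDist.norm_add_le_max _ _)
    (pow_nonneg hr n)).trans ?_
  rw [max_mul_of_nonneg _ _ (pow_nonneg hr n)]
  exact max_le (hf n) (hg n)

theorem neg (hf : Bdd r C f) : Bdd r C (-f) := fun n => by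
  rw [map_neg, norm_neg]
  exact hf n

theorem sub (hr : 0 ≤ r) (hf : Bdd r C f) (hg : Bdd r C g) : Bdd r C (f - g) := by
  rw [sub_eq_add_neg]
  exact hf.add hr hg.neg

theorem const (a : ℚ_[p]) : Bdd r ‖a‖ (PowerSeries.C a) := fun n => by
  rw [PowerSeries.coeff_C]
  split_ifs with h
  · simp [h]
  · simp

theorem X (hr : 0 ≤ r) : Bdd r r (PowerSeries.X : ℚ_[p]⟦X⟧) := fun n => by
  rw [PowerSeries.coeff_X]
  split_ifs with h
  · simp [h]
  · simpa using hr

theorem mul (hr : 0 ≤ r) (hf : Bdd r C f) (hg : Bdd r C' g) : Bdd r (C * C') (f * g) := fun n => by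
  rw [PowerSeries.coeff_mul]
  -- Radius zero is treated apart, since the main argument divides by `r ^ n`.
  rcases hr.eq_or_lt with rfl | hr'
  · rcases n with _ | n
    · have h1 := hf 0
      have h2 := hg 0
      simp only [pow_zero, mul_one] at h1 h2
      simp only [Finset.Nat.antidiagonal_zero, Finset.sum_singleton, norm_mul, pow_zero, mul_one]
      exact mul_le_mul h1 h2 (norm_nonneg _) hf.nonneg
    · simpa using mul_nonneg hf.nonneg hg.nonneg
  rw [← le_div_iff₀ (pow_pos hr' n)]
  refine IsUltrametricDist.norm_sum_le_of_forall_le_of_nonneg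
    (div_nonneg (mul_nonneg hf.nonneg hg.nonneg) (pow_nonneg hr n)) fun x hx => ?_
  rw [le_div_iff₀ (pow_pos hr' n), norm_mul, ← Finset.HasAntidiagonal.mem_antidiagonal.mp hx, pow_add,
    mul_mul_mul_comm]
  exact mul_le_mul (hf _) (hg _) (mul_nonneg (norm_nonneg _) (pow_nonneg hr _)) hf.nonneg

theorem one : Bdd r 1 (1 : ℚ_[p]⟦X⟧) := by
  simpa using const (p := p) (r := r) 1

theorem pow (hr : 0 ≤ r) (hf : Bdd r C f) (n : ℕ) : Bdd r (C ^ n) (f ^ n) := by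
  induction n with
  | zero => simpa using one
  | succ n ih => rw [pow_succ, pow_succ]; exact ih.mul hr hf

theorem natCast (n : ℕ) : Bdd r 1 (n : ℚ_[p]⟦X⟧) := by
  have := const (p := p) (r := r) (n : ℚ_[p])
  rw [map_natCast] at this
  exact this.mono (by simpa using Padic.norm_int_le_one (p := p) n)

theorem prod {ι : Type*} (hr : 0 ≤ r) (t : Finset ι) (F : ι → ℚ_[p]⟦X⟧)
    (h : ∀ i ∈ t, Bdd r C (F i)) : Bdd r (C ^ t.card) (∏ i ∈ t, F i) := by
  classical
  induction t using Finset.induction_on with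
  | empty => simpa using one
  | insert a t ha ih =>
    rw [Finset.prod_insert ha, Finset.card_insert_of_notMem ha, pow_succ, mul_comm (C ^ _)]
    exact (h a (by simp)).mul hr (ih fun i hi => h i (by simp [hi]))

theorem coeff_le (hr : 1 ≤ r) (hf : Bdd r C f) (n : ℕ) : ‖PowerSeries.coeff n f‖ ≤ C :=
  (le_mul_of_one_le_right (norm_nonneg _) (one_le_pow₀ hr)).trans (hf n)

theorem coeff_le' (hr : 0 < r) (hf : Bdd r C f) (n : ℕ) :
    ‖PowerSeries.coeff n f‖ ≤ C * r⁻¹ ^ n := by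
  rw [inv_pow, ← div_eq_mul_inv, le_div_iff₀ (pow_pos hr n)]
  exact hf n

/-- A power series with leading coefficient dominating has an inverse with the same property. -/
theorem inv (hr : 0 ≤ r) (hf : Bdd r 1 f) (h0 : ‖PowerSeries.constantCoeff f‖ = 1) :
    Bdd r 1 f⁻¹ := by
  intro n
  induction n using Nat.strong_induction_on with
  | _ n ih =>
    rw [PowerSeries.coeff_inv]
    split_ifs with hn
    · simp [hn, h0]
    · rcases hr.eq_or_lt with rfl | hr'
      · simp [hn]
      rw [norm_mul, norm_neg, norm_inv, h0, inv_one, one_mul, ← le_div_iff₀ (pow_pos hr' n)]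
      refine IsUltrametricDist.norm_sum_le_of_forall_le_of_nonneg
        (div_nonneg zero_le_one (pow_nonneg hr n)) fun x hx => ?_
      split_ifs with hx2
      · rw [le_div_iff₀ (pow_pos hr' n), norm_mul, ← Finset.HasAntidiagonal.mem_antidiagonal.mp hx, pow_add,
          mul_mul_mul_comm]
        exact mul_le_one₀ (hf _) (mul_nonneg (norm_nonneg _) (pow_nonneg hr _)) (ih _ hx2)
      · simpa using div_nonneg zero_le_one (pow_nonneg hr n)

theorem isRestricted (hs : 0 ≤ s) (h : s < r) (hf : Bdd r C f) : PowerSeries.IsRestricted s f := by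
  rw [PowerSeries.isRestricted_iff']
  have hr : 0 < r := hs.trans_lt h
  have h1 : Filter.Tendsto (fun n : ℕ => C * (s / r) ^ n) Filter.atTop (nhds 0) := by
    have := (tendsto_pow_atTop_nhds_zero_of_lt_one (div_nonneg hs hr.le)
      ((div_lt_one hr).mpr h)).const_mul C
    rwa [mul_zero] at this
  refine squeeze_zero (fun n => mul_nonneg (norm_nonneg _) (pow_nonneg hs n)) (fun n => ?_) h1
  rw [div_pow, ← mul_div_assoc, le_div_iff₀ (pow_pos hr n), mul_right_comm]
  exact mul_le_mul_of_nonneg_right (hf n) (pow_nonneg hs n)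

theorem discNorm_le (hf : Bdd r C f) : discNorm p r f ≤ C := by
  rw [discNorm, PowerSeries.gaussNorm_eq]
  exact ciSup_le hf

theorem mem_Adag (hr : 1 < r) (hf : Bdd r C f) : f ∈ Adag p :=
  ⟨(1 + r) / 2, by linarith, hf.isRestricted (by linarith) (by linarith)⟩

theorem mem_Tate (hr : 1 < r) (hf : Bdd r C f) : f ∈ Tate p :=
  hf.isRestricted zero_le_one hr

end Bdd

theorem bdd_of_isRestricted {r : ℝ} {f : ℚ_[p]⟦X⟧} (hf : PowerSeries.IsRestricted r f) :
    Bdd r (discNorm p r f) f := coeff_le_discNorm hf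

/-- Shrinking the radius is harmless; this lets all later estimates assume `r < √p`. -/
theorem exists_bdd_of_mem_Adag {f : ℚ_[p]⟦X⟧} (hf : f ∈ Adag p) {R : ℝ} (hR : 1 < R) :
    ∃ r, 1 < r ∧ r < R ∧ ∃ C, Bdd r C f := by
  obtain ⟨r, hr, h⟩ := hf
  refine ⟨min r ((1 + R) / 2), lt_min hr (by linarith), (min_le_right _ _).trans_lt (by linarith),
    _, (bdd_of_isRestricted h).anti (le_min (by linarith) (by linarith)) (min_le_left _ _)⟩

end Bounded

/-! ### Norms of factorials -/

section Norms

variable {p : ℕ} [Fact p.Prime]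

theorem one_lt_sqrt : 1 < √(p : ℝ) := by
  rw [Real.lt_sqrt zero_le_one, one_pow]
  exact_mod_cast (Fact.out : p.Prime).one_lt

theorem norm_p_eq : ‖(p : ℚ_[p])‖ = (√(p : ℝ))⁻¹ ^ 2 := by
  rw [Padic.norm_p, inv_pow, Real.sq_sqrt (Nat.cast_nonneg p)]

/-- For `n > 0` Legendre's formula gives `(p - 1) v(n!) < n`, and `p - 1 ≥ 2` for odd `p`. This is
the origin of the radius `√p`. -/
theorem norm_inv_factorial_le (hp : p ≠ 2) (n : ℕ) :
    ‖((n.factorial : ℚ_[p]))⁻¹‖ ≤ √(p : ℝ) ^ (n - 1) := by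
  rcases Nat.eq_zero_or_pos n with rfl | hn
  · simp
  have h1 : 2 * padicValNat p n.factorial ≤ n - 1 := by
    have h := sub_one_mul_padicValNat_factorial_lt_of_ne_zero (p := p) hn.ne'
    have h2 : 2 ≤ p - 1 := by
      have := (Fact.out : p.Prime).two_le
      lia
    have := Nat.mul_le_mul_right (padicValNat p n.factorial) h2
    lia
  have h3 : ‖((n.factorial : ℚ_[p]))⁻¹‖ = √(p : ℝ) ^ (2 * padicValNat p n.factorial) := by
    rw [norm_inv, Padic.norm_eq_zpow_neg_valuation (by exact_mod_cast n.factorial_ne_zero),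
      Padic.valuation_natCast, pow_mul, Real.sq_sqrt (Nat.cast_nonneg p), zpow_neg, inv_inv,
      zpow_natCast]
  rw [h3]
  exact pow_le_pow_right₀ one_lt_sqrt.le h1

theorem norm_inv_natCast_le (hp : p ≠ 2) (n : ℕ) :
    ‖((n : ℚ_[p]))⁻¹‖ ≤ √(p : ℝ) ^ (n - 1) := by
  refine le_trans ?_ (norm_inv_factorial_le hp n)
  rcases Nat.eq_zero_or_pos n with rfl | hn
  · simp
  rw [norm_inv, norm_inv]
  refine inv_anti₀ (norm_pos_iff.mpr (by exact_mod_cast n.factorial_ne_zero)) ?_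
  obtain ⟨k, hk⟩ := Nat.dvd_factorial hn le_rfl
  rw [hk, Nat.cast_mul, norm_mul]
  exact mul_le_of_le_one_right (norm_nonneg _) (by simpa using Padic.norm_int_le_one (p := p) k)

end Norms

/-! ### Teichmüller representatives -/

section Teichmuller

open Filter

variable {p : ℕ} [Fact p.Prime]

theorem dvd_iff_norm_le {x : ℤ_[p]} {n : ℕ} :
    (p : ℤ_[p]) ^ n ∣ x ↔ ‖x‖ ≤ (p : ℝ)⁻¹ ^ n := by
  rw [← Ideal.mem_span_singleton, ← PadicInt.norm_le_pow_iff_mem_span_pow, zpow_neg, zpow_natCast,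
    inv_pow]

theorem dvd_iff_norm_le' {x : ℤ_[p]} : (p : ℤ_[p]) ∣ x ↔ ‖x‖ ≤ (p : ℝ)⁻¹ := by
  simpa using dvd_iff_norm_le (x := x) (n := 1)

theorem dvd_iff_toZMod {x : ℤ_[p]} : (p : ℤ_[p]) ∣ x ↔ PadicInt.toZMod x = 0 := by
  rw [← RingHom.mem_ker, PadicInt.ker_toZMod, PadicInt.maximalIdeal_eq_span_p,
    Ideal.mem_span_singleton]

theorem dvd_pow_sub (a : ℤ_[p]) : (p : ℤ_[p]) ∣ a ^ p - a := by
  rw [dvd_iff_toZMod, map_sub, map_pow, ZMod.pow_card, sub_self]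

theorem norm_inv_lt_one : (p : ℝ)⁻¹ < 1 :=
  inv_lt_one_of_one_lt₀ (by exact_mod_cast (Fact.out : p.Prime).one_lt)

/-- Raising `a ^ p ≡ a` modulo `p` to the power `p ^ n` gives a congruence modulo `p ^ (n + 1)`, so
the sequence is Cauchy. -/
theorem tendsto_teich (a : ℤ_[p]) : Tendsto (fun n : ℕ => a ^ p ^ n) atTop (nhds (teich a)) := by
  refine CauchySeq.tendsto_limUnder ?_
  refine cauchySeq_of_le_geometric (p : ℝ)⁻¹ 1 norm_inv_lt_one fun n => ?_
  rw [one_mul, dist_eq_norm, norm_sub_rev, ← dvd_iff_norm_le, pow_succ' p n, pow_mul]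
  exact (pow_dvd_pow _ n.le_succ).trans (dvd_sub_pow_of_dvd_sub (dvd_pow_sub a) n)

theorem teich_mul (a b : ℤ_[p]) : teich (a * b) = teich a * teich b := by
  refine tendsto_nhds_unique (tendsto_teich _) ?_
  simpa only [mul_pow] using (tendsto_teich a).mul (tendsto_teich b)

theorem teich_one : teich (1 : ℤ_[p]) = 1 := by
  refine tendsto_nhds_unique (tendsto_teich _) ?_
  simp

theorem teich_pow (a : ℤ_[p]) (n : ℕ) : teich (a ^ n) = teich a ^ n := by
  induction n with
  | zero => simp [teich_one]
  | succ n ih => rw [pow_succ, pow_succ, teich_mul, ih]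

theorem teich_congr {a b : ℤ_[p]} (h : (p : ℤ_[p]) ∣ a - b) : teich a = teich b := by
  rw [← sub_eq_zero]
  refine tendsto_nhds_unique ((tendsto_teich a).sub (tendsto_teich b)) ?_
  rw [tendsto_zero_iff_norm_tendsto_zero]
  refine squeeze_zero (fun _ => norm_nonneg _) (fun n => ?_)
    (tendsto_pow_atTop_nhds_zero_of_lt_one (by positivity) (norm_inv_lt_one (p := p)))
  rw [← dvd_iff_norm_le]
  exact (pow_dvd_pow _ n.le_succ).trans (dvd_sub_pow_of_dvd_sub h n)

theorem dvd_teich_sub (a : ℤ_[p]) : (p : ℤ_[p]) ∣ teich a - a := by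
  rw [dvd_iff_norm_le']
  refine le_of_tendsto ((tendsto_teich a).sub_const a).norm (Eventually.of_forall fun n => ?_)
  rw [← dvd_iff_norm_le', dvd_iff_toZMod, map_sub, map_pow, ZMod.pow_card_pow, sub_self]

theorem norm_teich {a : ℤ_[p]} (ha : IsUnit a) : ‖(teich a : ℚ_[p])‖ = 1 := by
  have h := dvd_teich_sub a
  rw [dvd_iff_toZMod, map_sub, sub_eq_zero] at h
  have h1 : ¬ (p : ℤ_[p]) ∣ teich a := by
    rw [dvd_iff_toZMod, h]
    exact (ha.map _).ne_zero
  rw [← PadicInt.norm_lt_one_iff_dvd, not_lt] at h1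
  rw [← PadicInt.norm_def]
  exact le_antisymm (PadicInt.norm_le_one _) h1

theorem teich_ne_zero {a : ℤ_[p]} (ha : IsUnit a) : (teich a : ℚ_[p]) ≠ 0 := by
  rw [← norm_pos_iff, norm_teich ha]
  exact one_pos

theorem teich_pow_sub_one {a : ℤ_[p]} (ha : IsUnit a) : teich a ^ (p - 1) = 1 := by
  rw [← teich_pow, ← teich_one]
  apply teich_congr
  rw [dvd_iff_toZMod, map_sub, map_pow, ZMod.pow_card_sub_one_eq_one (ha.map _).ne_zero, map_one,
    sub_self]

end Teichmuller


/-! ### The logarithm -/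

section Logarithm

open Filter

variable {p : ℕ} [Fact p.Prime] {r C : ℝ} {F G : ℚ_[p]⟦X⟧}

/-- The coefficient `a` is arbitrary so that one summable bound dominates both the logarithm and its
approximations in `tendsto_logSeries`. -/
theorem norm_log_term_le (hp : p ≠ 2) (hr : 0 < r) (hF : Bdd r C (F - 1)) (i k : ℕ) {a : ℚ_[p]}
    (ha : ‖a‖ ≤ ‖((k : ℚ_[p]))⁻¹‖) :
    ‖a * PowerSeries.coeff i ((F - 1) ^ k)‖ ≤ (C * √(p : ℝ)) ^ k * r⁻¹ ^ i := by
  have hC := hF.nonneg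
  have hs := one_lt_sqrt (p := p)
  rw [norm_mul]
  calc ‖a‖ * ‖PowerSeries.coeff i ((F - 1) ^ k)‖
      ≤ √(p : ℝ) ^ (k - 1) * (C ^ k * r⁻¹ ^ i) :=
        mul_le_mul (ha.trans (norm_inv_natCast_le hp k)) ((hF.pow hr.le k).coeff_le' hr i)
          (norm_nonneg _) (by positivity)
    _ ≤ √(p : ℝ) ^ k * (C ^ k * r⁻¹ ^ i) := by
        gcongr
        · exact hs.le
        · lia
    _ = _ := by rw [mul_pow]; ring

theorem norm_log_coeff (k : ℕ) :
    ‖(-1 : ℚ_[p]) ^ (k + 1) / (k : ℚ_[p])‖ = ‖((k : ℚ_[p]))⁻¹‖ := by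
  rw [norm_div, norm_pow, norm_neg, norm_one, one_pow, norm_inv, one_div]

theorem summable_log_bound (hF : Bdd r C (F - 1)) (hC : C * √(p : ℝ) < 1) (i : ℕ) :
    Summable fun k : ℕ => (C * √(p : ℝ)) ^ k * r⁻¹ ^ i :=
  (summable_geometric_of_lt_one (mul_nonneg hF.nonneg (Real.sqrt_nonneg _)) hC).mul_right _

theorem summable_log (hp : p ≠ 2) (hr : 0 < r) (hF : Bdd r C (F - 1)) (hC : C * √(p : ℝ) < 1)
    (i : ℕ) : Summable fun k : ℕ =>
      (-1) ^ (k + 1) / (k : ℚ_[p]) * PowerSeries.coeff i ((F - 1) ^ k) :=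
  Summable.of_norm_bounded (summable_log_bound hF hC i) fun k =>
    norm_log_term_le hp hr hF i k (norm_log_coeff k).le

theorem norm_log_term_le' (hp : p ≠ 2) (hr : 0 < r) (hF : Bdd r C (F - 1)) (i k : ℕ) :
    ‖(-1) ^ (k + 1) / (k : ℚ_[p]) * PowerSeries.coeff i ((F - 1) ^ k)‖ * r ^ i ≤
      C * (C * √(p : ℝ)) ^ (k - 1) := by
  have hC := hF.nonneg
  rcases k with _ | k
  · simpa using hC
  rw [norm_mul, norm_log_coeff, mul_assoc]
  calc _ ≤ √(p : ℝ) ^ k * C ^ (k + 1) :=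
        mul_le_mul (norm_inv_natCast_le hp _) ((hF.pow hr.le _) i) (by positivity) (by positivity)
    _ = _ := by rw [Nat.add_sub_cancel, mul_pow, pow_succ]; ring

/-- The term of degree `k ≥ 1` is at most `C (C √p) ^ (k - 1)`, hence at most the bound for the
linear term. -/
theorem bdd_logSeries (hp : p ≠ 2) (hr : 0 < r) (hF : Bdd r C (F - 1)) (hC : C * √(p : ℝ) ≤ 1) :
    Bdd r C (logSeries F) := by
  intro i
  rw [logSeries, PowerSeries.coeff_mk, ← le_div_iff₀ (pow_pos hr i)]
  refine IsUltrametricDist.norm_tsum_le_of_forall_le_of_nonneg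
    (div_nonneg hF.nonneg (pow_nonneg hr.le i)) fun k => ?_
  rw [le_div_iff₀ (pow_pos hr i)]
  exact (norm_log_term_le' hp hr hF i k).trans (mul_le_of_le_one_right hF.nonneg
    (pow_le_one₀ (mul_nonneg hF.nonneg (Real.sqrt_nonneg _)) hC))

theorem tendsto_p_pow : Tendsto (fun n : ℕ => ((p ^ n : ℕ) : ℚ_[p])) atTop (nhds 0) := by
  have : ‖(p : ℚ_[p])‖ < 1 := Padic.norm_p_lt_one
  simpa using tendsto_pow_atTop_nhds_zero_of_norm_lt_one this

/-- By Pascal's rule it is enough that `(p ^ n).choose (j + 1)` tends to zero, being `p ^ n / (j +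
1)` times a sequence that converges by induction. -/
theorem tendsto_choose (j : ℕ) :
    Tendsto (fun n : ℕ => (((p ^ n - 1).choose j : ℕ) : ℚ_[p])) atTop (nhds ((-1) ^ j)) := by
  induction j with
  | zero => simp
  | succ j ih =>
    have h1 : Tendsto (fun n : ℕ => (((p ^ n).choose (j + 1) : ℕ) : ℚ_[p])) atTop (nhds 0) := by
      have h2 := ((tendsto_p_pow (p := p)).mul ih).mul_const ((j + 1 : ℕ) : ℚ_[p])⁻¹
      rw [zero_mul, zero_mul] at h2
      refine h2.congr fun n => ?_
      rw [← div_eq_mul_inv, div_eq_iff (by exact_mod_cast j.succ_ne_zero)]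
      have := Nat.add_one_mul_choose_eq (p ^ n - 1) j
      rw [Nat.sub_add_cancel (Nat.one_le_pow _ _ (Fact.out : p.Prime).pos)] at this
      exact_mod_cast this
    have h3 := h1.sub ih
    rw [zero_sub] at h3
    rw [pow_succ, mul_neg_one]
    refine h3.congr fun n => ?_
    have := Nat.choose_succ_succ (p ^ n - 1) j
    rw [Nat.succ_eq_add_one, Nat.sub_add_cancel (Nat.one_le_pow _ _ (Fact.out : p.Prime).pos)]
      at this
    rw [this]
    push_cast
    ring

/-- The logarithm as the limit of `(F ^ (p ^ n) - 1) / p ^ n`. -/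
theorem tendsto_logSeries (hp : p ≠ 2) (hr : 0 < r) (hF : Bdd r C (F - 1))
    (hC : C * √(p : ℝ) < 1) (i : ℕ) :
    Tendsto (fun n : ℕ => ((p ^ n : ℕ) : ℚ_[p])⁻¹ * PowerSeries.coeff i (F ^ p ^ n - 1)) atTop
      (nhds (PowerSeries.coeff i (logSeries F))) := by
  have hpos : ∀ n, 0 < p ^ n := fun n => Nat.pow_pos (Fact.out : p.Prime).pos
  -- The coefficient of `(F - 1) ^ k` in `(F ^ (p ^ n) - 1) / p ^ n`. For `k > 0` it equals `(p ^ n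
  -- - 1).choose (k - 1) / k`, which tends to `±1 / k` and is bounded by the norm of `1 / k`, so
  -- dominated convergence applies.
  set a : ℕ → ℕ → ℚ_[p] := fun n k =>
    if k = 0 then 0 else ((p ^ n : ℕ) : ℚ_[p])⁻¹ * ((p ^ n).choose k : ℕ) with ha
  have ha' : ∀ n k, a n (k + 1) = (((p ^ n - 1).choose k : ℕ) : ℚ_[p]) / ((k + 1 : ℕ) : ℚ_[p]) := by
    intro n k
    simp only [ha, Nat.add_one_ne_zero, if_false]
    rw [inv_mul_eq_iff_eq_mul₀ (by exact_mod_cast (hpos n).ne'), mul_div_assoc',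
      eq_div_iff (by exact_mod_cast k.succ_ne_zero)]
    have := Nat.add_one_mul_choose_eq (p ^ n - 1) k
    rw [Nat.sub_add_cancel (hpos n)] at this
    exact_mod_cast this.symm
  have hlim : ∀ k, Tendsto (fun n => a n k) atTop (nhds ((-1) ^ (k + 1) / (k : ℚ_[p]))) := by
    intro k
    rcases k with _ | k
    · simp [ha]
    · have := (tendsto_choose (p := p) k).div_const ((k + 1 : ℕ) : ℚ_[p])
      rw [show (-1 : ℚ_[p]) ^ (k + 1 + 1) = (-1) ^ k by rw [pow_add, pow_add]; simp]
      exact this.congr fun n => (ha' n k).symm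
  have hbd : ∀ n k, ‖a n k‖ ≤ ‖((k : ℚ_[p]))⁻¹‖ := by
    intro n k
    rcases k with _ | k
    · simp [ha]
    · rw [ha', norm_div, norm_inv, ← one_div]
      gcongr
      simpa using Padic.norm_int_le_one (p := p) ((p ^ n - 1).choose k)
  rw [logSeries, PowerSeries.coeff_mk]
  refine (tendsto_tsum_of_dominated_convergence (summable_log_bound hF hC i)
    (fun k => (hlim k).mul_const (PowerSeries.coeff i ((F - 1) ^ k)))
    (Eventually.of_forall fun n k => norm_log_term_le hp hr hF i k (hbd n k))).congr fun n => ?_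
  have hexp : F ^ p ^ n - 1 = ∑ k ∈ Finset.range (p ^ n),
      (F - 1) ^ (k + 1) * (((p ^ n).choose (k + 1) : ℕ) : ℚ_[p]⟦X⟧) := by
    conv_lhs => rw [← sub_add_cancel F 1, add_pow, Finset.sum_range_succ']
    simp
  rw [hexp, map_sum, Finset.mul_sum, tsum_eq_sum (s := Finset.range (p ^ n + 1)),
    Finset.sum_range_succ']
  · simp only [ha, Nat.add_one_ne_zero, if_false, if_true, zero_mul, add_zero]
    refine Finset.sum_congr rfl fun k _ => ?_
    rw [← map_natCast (PowerSeries.C (R := ℚ_[p])), PowerSeries.coeff_mul_C]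
    ring
  · intro k hk
    rw [Finset.mem_range, not_lt] at hk
    have h0 : (p ^ n).choose k = 0 := Nat.choose_eq_zero_of_lt (by lia)
    simp [ha, h0]

theorem bdd_mul_sub_one (hr : 0 ≤ r) (hF : Bdd r C (F - 1)) (hG : Bdd r C (G - 1)) (hC : C ≤ 1) :
    Bdd r C (F * G - 1) := by
  have h : F * G - 1 = (F - 1) * (G - 1) + ((F - 1) + (G - 1)) := by ring
  rw [h]
  exact ((hF.mul hr hG).mono (mul_le_of_le_one_left hG.nonneg hC)).add hr (hF.add hr hG)

/-- For `N = p ^ n` expand `(F G) ^ N - 1` in `F ^ N - 1` and `G ^ N - 1`. After division by `N` the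
product term is `N` times a convergent sequence, so only the sum survives in `tendsto_logSeries`. -/
theorem logSeries_mul (hp : p ≠ 2) (hr : 0 < r) (hF : Bdd r C (F - 1)) (hG : Bdd r C (G - 1))
    (hC : C * √(p : ℝ) < 1) : logSeries (F * G) = logSeries F + logSeries G := by
  have hC1 : C ≤ 1 := (le_mul_of_one_le_right hF.nonneg one_lt_sqrt.le).trans hC.le
  ext i
  refine tendsto_nhds_unique
    (tendsto_logSeries hp hr (bdd_mul_sub_one hr.le hF hG hC1) hC i) ?_
  have hprod : Tendsto (fun n : ℕ => ((p ^ n : ℕ) : ℚ_[p]) * ∑ x ∈ Finset.HasAntidiagonal.antidiagonal i,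
      (((p ^ n : ℕ) : ℚ_[p])⁻¹ * PowerSeries.coeff x.1 (F ^ p ^ n - 1)) *
      (((p ^ n : ℕ) : ℚ_[p])⁻¹ * PowerSeries.coeff x.2 (G ^ p ^ n - 1))) atTop (nhds 0) := by
    have := (tendsto_p_pow (p := p)).mul (tendsto_finsetSum (Finset.HasAntidiagonal.antidiagonal i) fun x _ =>
      (tendsto_logSeries hp hr hF hC x.1).mul (tendsto_logSeries hp hr hG hC x.2))
    rwa [zero_mul] at this
  have := hprod.add ((tendsto_logSeries hp hr hF hC i).add (tendsto_logSeries hp hr hG hC i))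
  rw [zero_add, ← map_add] at this
  refine this.congr fun n => ?_
  have h : (F * G) ^ p ^ n - 1 =
      (F ^ p ^ n - 1) * (G ^ p ^ n - 1) + ((F ^ p ^ n - 1) + (G ^ p ^ n - 1)) := by ring
  have hne : ((p ^ n : ℕ) : ℚ_[p]) ≠ 0 := by
    exact_mod_cast (Nat.pow_pos (Fact.out : p.Prime).pos).ne'
  rw [h, map_add, map_add, PowerSeries.coeff_mul, mul_add, mul_add, Finset.mul_sum,
    Finset.mul_sum]
  congr 1
  refine Finset.sum_congr rfl fun x _ => ?_
  field_simp

/-- The linear coefficient of `F ^ N / N` is `F_0 ^ (N - 1) F_1`, and `F_0 ^ N → 1` for `N = p ^ n`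
because `(F_0 ^ N - 1) / N` converges. -/
theorem coeff_one_logSeries (hp : p ≠ 2) (hr : 0 < r) (hF : Bdd r C (F - 1))
    (hC : C * √(p : ℝ) < 1) (h0 : PowerSeries.constantCoeff F ≠ 0) :
    PowerSeries.coeff 1 (logSeries F) =
      PowerSeries.coeff 1 F / PowerSeries.constantCoeff F := by
  refine tendsto_nhds_unique (tendsto_logSeries hp hr hF hC 1) ?_
  have h1 : Tendsto (fun n : ℕ => PowerSeries.constantCoeff F ^ p ^ n) atTop (nhds 1) := by
    have := ((tendsto_p_pow (p := p)).mul (tendsto_logSeries hp hr hF hC 0)).const_add 1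
    rw [zero_mul, add_zero] at this
    refine this.congr fun n => ?_
    have hne : ((p ^ n : ℕ) : ℚ_[p]) ≠ 0 := by
      exact_mod_cast (Nat.pow_pos (Fact.out : p.Prime).pos).ne'
    rw [mul_inv_cancel_left₀ hne]
    simp
  have h2 := h1.mul_const (PowerSeries.coeff 1 F / PowerSeries.constantCoeff F)
  rw [one_mul] at h2
  refine h2.congr fun n => ?_
  have hne : ((p ^ n : ℕ) : ℚ_[p]) ≠ 0 := by
    exact_mod_cast (Nat.pow_pos (Fact.out : p.Prime).pos).ne'
  rw [map_sub, PowerSeries.coeff_one_pow, PowerSeries.coeff_one, if_neg one_ne_zero, sub_zero,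
    ← Nat.sub_add_cancel (Nat.one_le_pow n p (Fact.out : p.Prime).pos), pow_succ]
  rw [Nat.sub_add_cancel (Nat.one_le_pow n p (Fact.out : p.Prime).pos)]
  field_simp

theorem logSeries_one : logSeries (1 : ℚ_[p]⟦X⟧) = 0 := by
  ext i
  rw [logSeries, PowerSeries.coeff_mk, map_zero, sub_self]
  convert tsum_zero with k
  rcases k with _ | k
  · simp
  · simp

theorem padicLog_eq (x : ℚ_[p]) :
    padicLog x = PowerSeries.constantCoeff (logSeries (PowerSeries.C x)) := by
  rw [← PowerSeries.coeff_zero_eq_constantCoeff_apply, logSeries, PowerSeries.coeff_mk, padicLog]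
  congr 1
  funext k
  congr 1
  rw [PowerSeries.coeff_zero_eq_constantCoeff_apply]
  simp

theorem inv_p_mul_sqrt : (p : ℝ)⁻¹ * √(p : ℝ) = (√(p : ℝ))⁻¹ := by
  have h : √(p : ℝ) ≠ 0 := (zero_lt_one.trans one_lt_sqrt).ne'
  nth_rewrite 1 [← Real.sq_sqrt (Nat.cast_nonneg (α := ℝ) p)]
  field_simp

theorem inv_sqrt_lt_one : (√(p : ℝ))⁻¹ < 1 := inv_lt_one_of_one_lt₀ one_lt_sqrt

/-- The linear term dominates strictly: every other one is smaller by a factor of at least `√p`. -/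
theorem norm_padicLog (hp : p ≠ 2) {x : ℚ_[p]} (hx : ‖x - 1‖ = (p : ℝ)⁻¹) :
    ‖padicLog x‖ = (p : ℝ)⁻¹ := by
  have hF : Bdd 1 (p : ℝ)⁻¹ (PowerSeries.C x - 1 : ℚ_[p]⟦X⟧) := by
    rw [← hx, ← map_one (PowerSeries.C (R := ℚ_[p])), ← map_sub]
    exact Bdd.const _
  have hC : (p : ℝ)⁻¹ * √(p : ℝ) < 1 := by rw [inv_p_mul_sqrt]; exact inv_sqrt_lt_one
  have hp0 : 0 < (p : ℝ)⁻¹ := inv_pos.mpr (by exact_mod_cast (Fact.out : p.Prime).pos)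
  have hs := summable_log hp one_pos hF hC 0
  have h1 : padicLog x = (x - 1) + ∑' k : ℕ, if k = 1 then 0 else
      (-1) ^ (k + 1) / (k : ℚ_[p]) * PowerSeries.coeff 0 ((PowerSeries.C x - 1) ^ k) := by
    rw [padicLog_eq, ← PowerSeries.coeff_zero_eq_constantCoeff_apply, logSeries,
      PowerSeries.coeff_mk, hs.tsum_eq_add_tsum_ite 1]
    simp
  have h2 : ‖padicLog x - (x - 1)‖ < ‖x - 1‖ := by
    rw [h1, add_sub_cancel_left, hx]
    refine lt_of_le_of_lt (b := (p : ℝ)⁻¹ * (√(p : ℝ))⁻¹) ?_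
      (mul_lt_of_lt_one_right hp0 inv_sqrt_lt_one)
    refine IsUltrametricDist.norm_tsum_le_of_forall_le_of_nonneg (by positivity) fun k => ?_
    split_ifs with hk
    · simpa using by positivity
    · have h3 := norm_log_term_le' hp one_pos hF 0 k
      rw [pow_zero, mul_one] at h3
      rcases k with _ | _ | k
      · simpa using by positivity
      · exact absurd rfl hk
      · refine h3.trans ?_
        rw [inv_p_mul_sqrt]
        gcongr
        exact pow_le_of_le_one (by positivity) inv_sqrt_lt_one.le (by simp)
  rw [← hx]
  exact Padic.norm_eq_of_norm_sub_lt_right h2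

/-- A topological generator of `1 + p ℤ_p` generates it modulo `p²`. -/
theorem IsTopGenerator.norm_sub_one {u : ℤ_[p]ˣ} (hu : IsTopGenerator u) :
    ‖((u : ℤ_[p]) : ℚ_[p]) - 1‖ = (p : ℝ)⁻¹ := by
  have hu1 : (p : ℤ_[p]) ∣ (u : ℤ_[p]) - 1 := by
    have h : u ∈ ((Subgroup.zpowers u).topologicalClosure : Set ℤ_[p]ˣ) :=
      Subgroup.le_topologicalClosure _ (Subgroup.mem_zpowers u)
    rw [hu] at h
    exact h
  rw [← PadicInt.coe_one, ← PadicInt.coe_sub, ← PadicInt.norm_def]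
  refine le_antisymm (dvd_iff_norm_le'.mp hu1) ?_
  by_contra hlt
  rw [not_le] at hlt
  -- The norm takes no value strictly between `p⁻²` and `p⁻¹`.
  have hu2 : (p : ℤ_[p]) ^ 2 ∣ (u : ℤ_[p]) - 1 := by
    rw [dvd_iff_norm_le]
    have := (PadicInt.norm_le_pow_iff_norm_lt_pow_add_one ((u : ℤ_[p]) - 1) (-2)).mpr
      (by simpa using hlt)
    simpa [zpow_neg] using this
  -- `V = 1 + p² ℤ_p` is a closed subgroup; containing `u`, it would contain the closure of the
  -- powers of `u`, hence `1 + p`.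
  set V : Subgroup ℤ_[p]ˣ := (Units.map (PadicInt.toZModPow (p := p) 2).toMonoidHom).ker with hV
  have memV : ∀ x : ℤ_[p]ˣ, x ∈ V ↔ (p : ℤ_[p]) ^ 2 ∣ (x : ℤ_[p]) - 1 := by
    intro x
    rw [← Ideal.mem_span_singleton, ← PadicInt.ker_toZModPow, RingHom.mem_ker, map_sub, map_one,
      sub_eq_zero, hV, MonoidHom.mem_ker, Units.ext_iff]
    rfl
  have hclosed : IsClosed (V : Set ℤ_[p]ˣ) := by
    have : (V : Set ℤ_[p]ˣ) =
        {x : ℤ_[p]ˣ | ‖(x : ℤ_[p]) - 1‖ ≤ (p : ℝ)⁻¹ ^ 2} := by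
      ext x
      rw [SetLike.mem_coe, memV, dvd_iff_norm_le]
      rfl
    rw [this]
    exact isClosed_le ((Units.continuous_val.sub continuous_const).norm) continuous_const
  have hle : (Subgroup.zpowers u).topologicalClosure ≤ V :=
    Subgroup.topologicalClosure_minimal _ ((Subgroup.zpowers_le).mpr ((memV u).mpr hu2)) hclosed
  have hunit : IsUnit (1 + p : ℤ_[p]) := by
    rw [PadicInt.isUnit_iff]
    have h : ‖(p : ℤ_[p])‖ < 1 := by rw [PadicInt.norm_p]; exact norm_inv_lt_one
    have h2 := IsUltrametricDist.norm_add_eq_max_of_norm_ne_norm (x := (1 : ℤ_[p])) (y := p)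
      (by rw [norm_one]; exact h.ne')
    rw [h2, norm_one, max_eq_left h.le]
  have h1 : hunit.unit ∈ V := by
    apply hle
    change hunit.unit ∈ ((Subgroup.zpowers u).topologicalClosure : Set ℤ_[p]ˣ)
    rw [hu]
    simp
  rw [memV, IsUnit.unit_spec, add_sub_cancel_left, dvd_iff_norm_le, PadicInt.norm_p] at h1
  have hp0 : 0 < (p : ℝ)⁻¹ := inv_pos.mpr (by exact_mod_cast (Fact.out : p.Prime).pos)
  have h3 := norm_inv_lt_one (p := p)
  nlinarith

end Logarithm


/-! ### Substitution into overconvergent power series -/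

section Substitution

variable {p : ℕ} [Fact p.Prime] {f g N M : ℚ_[p]⟦X⟧}

theorem mem_Adag_iff : f ∈ Adag p ↔ ∃ r, 1 < r ∧ r < √(p : ℝ) ∧ ∃ C, Bdd r C f :=
  ⟨fun h => exists_bdd_of_mem_Adag h one_lt_sqrt, fun ⟨_, hr, _, _, h⟩ => h.mem_Adag hr⟩

theorem exists_bdd_pair (hf : f ∈ Adag p) (hg : g ∈ Adag p) :
    ∃ r, 1 < r ∧ r < √(p : ℝ) ∧ ∃ C C', Bdd r C f ∧ Bdd r C' g := by
  obtain ⟨r, hr, hrp, C, h⟩ := mem_Adag_iff.mp hf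
  obtain ⟨s, hs, _, C', h'⟩ := mem_Adag_iff.mp hg
  have h0 : 0 ≤ min r s := le_min (by linarith) (by linarith)
  exact ⟨min r s, lt_min hr hs, (min_le_left _ _).trans_lt hrp, C, C',
    h.anti h0 (min_le_left _ _), h'.anti h0 (min_le_right _ _)⟩

theorem mul_mem_Adag (hf : f ∈ Adag p) (hg : g ∈ Adag p) : f * g ∈ Adag p := by
  obtain ⟨r, hr, _, C, C', h, h'⟩ := exists_bdd_pair hf hg
  exact (h.mul (by linarith) h').mem_Adag hr

theorem C_mem_Adag (a : ℚ_[p]) : (PowerSeries.C a : ℚ_[p]⟦X⟧) ∈ Adag p :=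
  (Bdd.const a).mem_Adag one_lt_two

theorem one_mem_Adag : (1 : ℚ_[p]⟦X⟧) ∈ Adag p := Bdd.one.mem_Adag one_lt_two

theorem X_pow_mem_Adag (n : ℕ) : (PowerSeries.X ^ n : ℚ_[p]⟦X⟧) ∈ Adag p := (monom p n).2

theorem pow_mem_Adag (hf : f ∈ Adag p) (n : ℕ) : f ^ n ∈ Adag p := by
  induction n with
  | zero => simpa using one_mem_Adag
  | succ n ih => rw [pow_succ]; exact mul_mem_Adag ih hf

/-- A power series mapping every disc of radius between `1` and `√p` into itself. -/
def Contracting (N : ℚ_[p]⟦X⟧) : Prop := ∀ ρ : ℝ, 1 ≤ ρ → ρ ≤ √(p : ℝ) → Bdd ρ ρ N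

theorem Contracting.mem_Adag (hN : Contracting N) : N ∈ Adag p :=
  (hN _ one_lt_sqrt.le le_rfl).mem_Adag one_lt_sqrt

theorem Contracting.norm_coeff_pow_le (hN : Contracting N) (n i : ℕ) :
    ‖PowerSeries.coeff i (N ^ n)‖ ≤ 1 := by
  simpa using ((hN 1 le_rfl one_lt_sqrt.le).pow zero_le_one n).coeff_le le_rfl i

/-- The substitution `f ↦ f ∘ N`. -/
def substSeries (N f : ℚ_[p]⟦X⟧) : ℚ_[p]⟦X⟧ :=
  PowerSeries.mk fun i => ∑' n : ℕ, PowerSeries.coeff n f * PowerSeries.coeff i (N ^ n)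

theorem coeff_substSeries (N f : ℚ_[p]⟦X⟧) (i : ℕ) : PowerSeries.coeff i (substSeries N f) =
    ∑' n : ℕ, PowerSeries.coeff n f * PowerSeries.coeff i (N ^ n) :=
  PowerSeries.coeff_mk _ _

theorem summable_norm_subst (hN : Contracting N) (hf : f ∈ Adag p) (i : ℕ) :
    Summable fun n : ℕ => ‖PowerSeries.coeff n f * PowerSeries.coeff i (N ^ n)‖ := by
  obtain ⟨r, hr, _, C, h⟩ := mem_Adag_iff.mp hf
  refine Summable.of_nonneg_of_le (fun _ => norm_nonneg _) (fun n => ?_)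
    ((summable_geometric_of_lt_one (by positivity) (inv_lt_one_of_one_lt₀ hr)).mul_left C)
  rw [norm_mul]
  exact (mul_le_of_le_one_right (norm_nonneg _) (hN.norm_coeff_pow_le n i)).trans
    (h.coeff_le' (by linarith) n)

theorem bdd_substSeries {r C : ℝ} (hr : 0 < r) (hN : Bdd r r N) (hf : Bdd r C f) :
    Bdd r C (substSeries N f) := by
  intro i
  rw [coeff_substSeries, ← le_div_iff₀ (pow_pos hr i)]
  refine IsUltrametricDist.norm_tsum_le_of_forall_le_of_nonneg
    (div_nonneg hf.nonneg (pow_nonneg hr.le i)) fun n => ?_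
  rw [le_div_iff₀ (pow_pos hr i), norm_mul, mul_assoc]
  exact (mul_le_mul_of_nonneg_left ((hN.pow hr.le n) i) (norm_nonneg _)).trans (hf n)

theorem Contracting.subst_mem (hN : Contracting N) (hf : f ∈ Adag p) :
    substSeries N f ∈ Adag p := by
  obtain ⟨r, hr, hrp, C, h⟩ := mem_Adag_iff.mp hf
  exact (bdd_substSeries (by linarith) (hN r hr.le hrp.le) h).mem_Adag hr

theorem substSeries_add (hN : Contracting N) (hf : f ∈ Adag p) (hg : g ∈ Adag p) :
    substSeries N (f + g) = substSeries N f + substSeries N g := by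
  ext i
  rw [map_add, coeff_substSeries, coeff_substSeries, coeff_substSeries,
    ← (summable_norm_subst hN hf i).of_norm.tsum_add (summable_norm_subst hN hg i).of_norm]
  simp only [map_add, add_mul]

theorem substSeries_C_mul (N f : ℚ_[p]⟦X⟧) (a : ℚ_[p]) :
    substSeries N (PowerSeries.C a * f) = PowerSeries.C a * substSeries N f := by
  ext i
  rw [PowerSeries.coeff_C_mul, coeff_substSeries, coeff_substSeries, ← tsum_mul_left]
  simp only [PowerSeries.coeff_C_mul, mul_assoc]

theorem substSeries_X_pow (N : ℚ_[p]⟦X⟧) (k : ℕ) : substSeries N (PowerSeries.X ^ k) = N ^ k := by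
  ext i
  rw [coeff_substSeries, tsum_eq_single k]
  · simp
  · intro n hn
    simp [PowerSeries.coeff_X_pow, hn]

theorem substSeries_X (N : ℚ_[p]⟦X⟧) : substSeries N PowerSeries.X = N := by
  simpa using substSeries_X_pow N 1

theorem substSeries_one (N : ℚ_[p]⟦X⟧) : substSeries N 1 = 1 := by
  simpa using substSeries_X_pow N 0

theorem substSeries_C (N : ℚ_[p]⟦X⟧) (a : ℚ_[p]) :
    substSeries N (PowerSeries.C a) = PowerSeries.C a := by
  simpa [substSeries_one] using substSeries_C_mul N 1 a

theorem substSeries_by_X (f : ℚ_[p]⟦X⟧) : substSeries PowerSeries.X f = f := by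
  ext i
  rw [coeff_substSeries, tsum_eq_single i]
  · simp
  · intro n hn
    simp [PowerSeries.coeff_X_pow, hn.symm]

theorem substSeries_sub (hN : Contracting N) (hf : f ∈ Adag p) (hg : g ∈ Adag p) :
    substSeries N (f - g) = substSeries N f - substSeries N g := by
  rw [eq_sub_iff_add_eq, ← substSeries_add hN ((Adag p).sub_mem hf hg) hg, sub_add_cancel]

theorem substSeries_mul (hN : Contracting N) (hf : f ∈ Adag p) (hg : g ∈ Adag p) :
    substSeries N (f * g) = substSeries N f * substSeries N g := by
  ext i
  have h1 : ∀ x : ℕ × ℕ, PowerSeries.coeff x.1 (substSeries N f) *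
      PowerSeries.coeff x.2 (substSeries N g) =
      ∑' n, ∑ y ∈ Finset.HasAntidiagonal.antidiagonal n,
        (PowerSeries.coeff y.1 f * PowerSeries.coeff x.1 (N ^ y.1)) *
          (PowerSeries.coeff y.2 g * PowerSeries.coeff x.2 (N ^ y.2)) := fun x => by
    rw [coeff_substSeries, coeff_substSeries]
    exact tsum_mul_tsum_eq_tsum_sum_antidiagonal_of_summable_norm
      (summable_norm_subst hN hf x.1) (summable_norm_subst hN hg x.2)
  have h2 : ∀ x : ℕ × ℕ, Summable fun n => ∑ y ∈ Finset.HasAntidiagonal.antidiagonal n,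
        (PowerSeries.coeff y.1 f * PowerSeries.coeff x.1 (N ^ y.1)) *
          (PowerSeries.coeff y.2 g * PowerSeries.coeff x.2 (N ^ y.2)) := fun x =>
    (summable_norm_sum_mul_antidiagonal_of_summable_norm
      (summable_norm_subst hN hf x.1) (summable_norm_subst hN hg x.2)).of_norm
  rw [PowerSeries.coeff_mul, coeff_substSeries, Finset.sum_congr rfl fun x _ => h1 x,
    ← Summable.tsum_finsetSum fun x _ => h2 x]
  congr 1
  funext n
  rw [PowerSeries.coeff_mul, Finset.sum_mul, Finset.sum_comm]
  refine Finset.sum_congr rfl fun y hy => ?_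
  rw [← Finset.HasAntidiagonal.mem_antidiagonal.mp hy, pow_add, PowerSeries.coeff_mul,
    Finset.mul_sum]
  refine Finset.sum_congr rfl fun x _ => ?_
  ring

theorem substSeries_pow (hN : Contracting N) (hf : f ∈ Adag p) (n : ℕ) :
    substSeries N (f ^ n) = substSeries N f ^ n := by
  induction n with
  | zero => simp [substSeries_one]
  | succ n ih => rw [pow_succ, pow_succ, substSeries_mul hN (pow_mem_Adag hf n) hf, ih]

/-- An interchange of summation: bounding the powers of `N` on a disc of radius `ρ` with `1 < ρ < r`
gives geometric decay in both indices. -/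
theorem substSeries_substSeries (hM : Contracting M) (hN : Contracting N) (hf : f ∈ Adag p) :
    substSeries M (substSeries N f) = substSeries (substSeries M N) f := by
  ext i
  obtain ⟨r, hr, hrp, C, h⟩ := mem_Adag_iff.mp hf
  obtain ⟨ρ, hρ1, hρ⟩ := exists_between hr
  have hρ0 : 0 < ρ := by linarith
  have hr0 : 0 < r := by linarith
  rw [coeff_substSeries, coeff_substSeries]
  simp only [← substSeries_pow hM hN.mem_Adag, coeff_substSeries, ← tsum_mul_left,
    ← tsum_mul_right]
  rw [Summable.tsum_comm]
  · simp only [mul_assoc]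
  · have hsum : Summable fun x : ℕ × ℕ => (C * (ρ / r) ^ x.1) * ρ⁻¹ ^ x.2 := by
      have h1 : Summable fun n : ℕ => C * (ρ / r) ^ n :=
        (summable_geometric_of_lt_one (by positivity) ((div_lt_one hr0).mpr hρ)).mul_left C
      have h2 : Summable fun n : ℕ => ρ⁻¹ ^ n :=
        summable_geometric_of_lt_one (by positivity) (inv_lt_one_of_one_lt₀ hρ1)
      have := h1.mul_of_nonneg h2
        (fun n => mul_nonneg h.nonneg (by positivity)) (fun n => by positivity)
      exact this
    refine Summable.of_norm_bounded hsum fun x => ?_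
    have b1 := h.coeff_le' hr0 x.1
    have b2 := ((hN ρ hρ1.le (hρ.le.trans hrp.le)).pow hρ0.le x.1).coeff_le' hρ0 x.2
    have b3 := hM.norm_coeff_pow_le x.2 i
    simp only [Function.uncurry, norm_mul]
    calc _ ≤ (C * r⁻¹ ^ x.1) * (ρ ^ x.1 * ρ⁻¹ ^ x.2) * 1 := by
          have := h.nonneg
          gcongr
      _ = _ := by rw [div_pow, inv_pow r]; ring

/-- An interchange of summation: `r > 1` gives decay in the powers of `z`, and `C √p < 1` in those
of `F - 1`. -/
theorem substSeries_logSeries (hp : p ≠ 2) (hN : Contracting N) {r C : ℝ} {F : ℚ_[p]⟦X⟧}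
    (hr : 1 < r) (hF : Bdd r C (F - 1)) (hC : C * √(p : ℝ) < 1) :
    substSeries N (logSeries F) = logSeries (substSeries N F) := by
  have hr0 : 0 < r := by linarith
  have hF1 : F - 1 ∈ Adag p := hF.mem_Adag hr
  have hFA : F ∈ Adag p := by
    have := (Adag p).add_mem hF1 one_mem_Adag
    rwa [sub_add_cancel] at this
  ext i
  rw [coeff_substSeries, logSeries, logSeries, PowerSeries.coeff_mk]
  simp only [PowerSeries.coeff_mk]
  have h1 : ∀ k, (substSeries N F - 1) ^ k = substSeries N ((F - 1) ^ k) := fun k => by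
    rw [substSeries_pow hN hF1, substSeries_sub hN hFA one_mem_Adag, substSeries_one]
  simp only [h1, coeff_substSeries, ← tsum_mul_left, ← tsum_mul_right]
  rw [Summable.tsum_comm]
  · simp only [mul_assoc]
  · have hC0 : 0 ≤ C * √(p : ℝ) := mul_nonneg hF.nonneg (Real.sqrt_nonneg _)
    have hsum : Summable fun x : ℕ × ℕ => (C * √(p : ℝ)) ^ x.1 * r⁻¹ ^ x.2 := by
      exact (summable_geometric_of_lt_one hC0 hC).mul_of_nonneg
        (summable_geometric_of_lt_one (by positivity) (inv_lt_one_of_one_lt₀ hr))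
        (fun n => by positivity) (fun n => by positivity)
    refine Summable.of_norm_bounded hsum fun x => ?_
    rw [Function.uncurry, norm_mul]
    exact (mul_le_of_le_one_right (norm_nonneg _) (hN.norm_coeff_pow_le x.2 i)).trans
      (norm_log_term_le hp hr0 hF x.2 x.1 (norm_log_coeff _).le)

end Substitution

/-! ### Linear fractional transformations -/

section Mobius

variable {p : ℕ} [Fact p.Prime]

/-- The conditions on `a` and `c` in the definition of `Σ₀(p)`. -/
def IsSigma (g : Matrix (Fin 2) (Fin 2) ℤ_[p]) : Prop := IsUnit (g 0 0) ∧ (p : ℤ_[p]) ∣ g 1 0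

theorem IsSigma.mul {g h : Matrix (Fin 2) (Fin 2) ℤ_[p]} (hg : IsSigma g) (hh : IsSigma h) :
    IsSigma (g * h) := by
  constructor
  · rw [Matrix.mul_apply, Fin.sum_univ_two, PadicInt.isUnit_iff]
    have h1 : ‖g 0 0 * h 0 0‖ = 1 := PadicInt.isUnit_iff.mp (hg.1.mul hh.1)
    have h2 : ‖g 0 1 * h 1 0‖ < 1 := PadicInt.norm_lt_one_iff_dvd _ |>.mpr (hh.2.mul_left _)
    rw [IsUltrametricDist.norm_add_eq_max_of_norm_ne_norm (by rw [h1]; exact h2.ne'), h1,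
      max_eq_left h2.le]
  · rw [Matrix.mul_apply, Fin.sum_univ_two]
    exact dvd_add (hg.2.mul_right _) (hh.2.mul_left _)

theorem sqrt_le_self : √(p : ℝ) ≤ p := by
  have h1 : (1 : ℝ) ≤ p := by exact_mod_cast (Fact.out : p.Prime).one_lt.le
  rw [Real.sqrt_le_left (by linarith)]
  nlinarith

theorem norm_unit {a : ℤ_[p]} (ha : IsUnit a) : ‖(a : ℚ_[p])‖ = 1 := by
  rw [← PadicInt.norm_def]
  exact PadicInt.isUnit_iff.mp ha

theorem norm_coe_le_one (a : ℤ_[p]) : ‖(a : ℚ_[p])‖ ≤ 1 := PadicInt.norm_le_one a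

theorem norm_coe_of_dvd {c : ℤ_[p]} (hc : (p : ℤ_[p]) ∣ c) : ‖(c : ℚ_[p])‖ ≤ (p : ℝ)⁻¹ := by
  rw [← PadicInt.norm_def]
  exact dvd_iff_norm_le'.mp hc

theorem bdd_linear {a c : ℤ_[p]} (hc : (p : ℤ_[p]) ∣ c) {ρ : ℝ} (h0 : 0 ≤ ρ) (h : ρ ≤ √(p : ℝ)) :
    Bdd ρ 1 (linear a c) := by
  have hp : (0 : ℝ) < p := by exact_mod_cast (Fact.out : p.Prime).pos
  refine ((Bdd.const _).mono (norm_coe_le_one a)).add h0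
    (((Bdd.const _).mul h0 (Bdd.X h0)).mono ?_)
  calc ‖(c : ℚ_[p])‖ * ρ ≤ (p : ℝ)⁻¹ * p :=
        mul_le_mul (norm_coe_of_dvd hc) (h.trans sqrt_le_self) h0 (inv_nonneg.mpr hp.le)
    _ = 1 := inv_mul_cancel₀ hp.ne'

theorem constantCoeff_linear (a c : ℤ_[p]) : PowerSeries.constantCoeff (linear a c) = a := by
  simp [linear]

theorem coeff_one_linear (a c : ℤ_[p]) : PowerSeries.coeff 1 (linear a c) = c := by
  simp [linear, PowerSeries.coeff_C]

theorem linear_ne_zero {a c : ℤ_[p]} (ha : IsUnit a) :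
    PowerSeries.constantCoeff (linear a c) ≠ 0 := by
  rw [constantCoeff_linear, ← norm_pos_iff, norm_unit ha]
  exact one_pos

/-- The power series `(b + d z) / (a + c z)`. -/
def mobiusSeries (g : Matrix (Fin 2) (Fin 2) ℤ_[p]) : ℚ_[p]⟦X⟧ :=
  linear (g 0 1) (g 1 1) * (linear (g 0 0) (g 1 0))⁻¹

theorem mobius_eq (g : Matrix (Fin 2) (Fin 2) ℤ_[p]) (f : ℚ_[p]⟦X⟧) :
    mobius g f = substSeries (mobiusSeries g) f := rfl

variable {g h : Matrix (Fin 2) (Fin 2) ℤ_[p]}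

/-- Since `p ∣ c` and `ρ ≤ √p ≤ p`, the denominator is bounded by `1` with a unit constant term, so
its inverse is bounded by `1`; the numerator has integral coefficients and is bounded by `ρ ≥ 1`. -/
theorem IsSigma.contracting (hg : IsSigma g) : Contracting (mobiusSeries g) := by
  intro ρ h1 h2
  have h0 : 0 ≤ ρ := by linarith
  have hnum : Bdd ρ ρ (linear (g 0 1) (g 1 1)) :=
    ((Bdd.const _).mono ((norm_coe_le_one _).trans h1)).add h0
      (((Bdd.const _).mul h0 (Bdd.X h0)).mono (mul_le_of_le_one_left h0 (norm_coe_le_one _)))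
  have hden := (bdd_linear (a := g 0 0) hg.2 h0 h2).inv h0
    (by rw [constantCoeff_linear]; exact norm_unit hg.1)
  simpa only [mobiusSeries, mul_one] using hnum.mul h0 hden

theorem linear_mem_Adag (a c : ℤ_[p]) : linear a c ∈ Adag p :=
  (Adag p).add_mem (C_mem_Adag _) (mul_mem_Adag (C_mem_Adag _) (by simpa using X_pow_mem_Adag 1))

theorem substSeries_linear {N : ℚ_[p]⟦X⟧} (hN : Contracting N) (a c : ℤ_[p]) :
    substSeries N (linear a c) =
      PowerSeries.C (a : ℚ_[p]) + PowerSeries.C (c : ℚ_[p]) * N := by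
  rw [linear, substSeries_add hN (C_mem_Adag _)
    (mul_mem_Adag (C_mem_Adag _) (by simpa using X_pow_mem_Adag 1)), substSeries_C,
    substSeries_C_mul, substSeries_X]

theorem mobiusSeries_mul_linear (hg : IsSigma g) :
    mobiusSeries g * linear (g 0 0) (g 1 0) = linear (g 0 1) (g 1 1) := by
  rw [mobiusSeries, mul_assoc, PowerSeries.inv_mul_cancel _ (linear_ne_zero hg.1), mul_one]

/-- The automorphy relation for `a + c z`, and similarly for `b + d z`. -/
theorem linear_cocycle (hg : IsSigma g) (h : Matrix (Fin 2) (Fin 2) ℤ_[p]) (j : Fin 2) :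
    linear (g 0 0) (g 1 0) * substSeries (mobiusSeries g) (linear (h 0 j) (h 1 j)) =
      linear ((g * h) 0 j) ((g * h) 1 j) := by
  rw [substSeries_linear hg.contracting, mul_add, mul_left_comm, mul_comm _ (mobiusSeries g),
    mobiusSeries_mul_linear hg]
  simp only [linear, Matrix.mul_apply, Fin.sum_univ_two, PadicInt.coe_add, PadicInt.coe_mul,
    map_add, map_mul]
  ring

/-- `linear_cocycle` is applied to the numerator and the denominator of the transformation of `h`;
the common factor `a + c z` of `g` cancels. -/
theorem mobiusSeries_mul (hg : IsSigma g) (hh : IsSigma h) :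
    mobiusSeries (g * h) = substSeries (mobiusSeries g) (mobiusSeries h) := by
  have h1 := congrArg (substSeries (mobiusSeries g)) (mobiusSeries_mul_linear hh)
  rw [substSeries_mul hg.contracting hh.contracting.mem_Adag (linear_mem_Adag _ _)] at h1
  have h2 := congrArg (linear (g 0 0) (g 1 0) * ·) h1
  beta_reduce at h2
  rw [mul_left_comm, linear_cocycle hg, linear_cocycle hg] at h2
  rw [mobiusSeries, ← h2, mul_assoc,
    PowerSeries.mul_inv_cancel _ (linear_ne_zero (hg.mul hh).1), mul_one]

theorem mobius_mul (hg : IsSigma g) (hh : IsSigma h) {f : ℚ_[p]⟦X⟧} (hf : f ∈ Adag p) :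
    mobius (g * h) f = mobius g (mobius h f) := by
  rw [mobius_eq, mobius_eq, mobius_eq, substSeries_substSeries hg.contracting hh.contracting hf,
    mobiusSeries_mul hg hh]

end Mobius


/-! ### Binomial coefficients of power series -/

section Binomial

variable {p : ℕ} [Fact p.Prime]

theorem binom_zero (L : ℚ_[p]⟦X⟧) : binom L 0 = 1 := by simp [binom]

theorem natCast_mul_binom_succ (L : ℚ_[p]⟦X⟧) (n : ℕ) :
    ((n + 1 : ℕ) : ℚ_[p]⟦X⟧) * binom L (n + 1) = binom L n * (L - (n : ℚ_[p]⟦X⟧)) := by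
  have h : ((n + 1 : ℕ) : ℚ_[p]⟦X⟧) * PowerSeries.C (((n + 1).factorial : ℚ_[p])⁻¹) =
      PowerSeries.C ((n.factorial : ℚ_[p])⁻¹) := by
    rw [← map_natCast (PowerSeries.C (R := ℚ_[p])), ← map_mul, Nat.factorial_succ, Nat.cast_mul,
      mul_inv, mul_inv_cancel_left₀ (by exact_mod_cast n.succ_ne_zero)]
  rw [binom, ← mul_assoc, h, Finset.prod_range_succ, binom, mul_assoc]

theorem binom_zero_succ (n : ℕ) : binom (0 : ℚ_[p]⟦X⟧) (n + 1) = 0 := by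
  rw [binom, Finset.prod_range_succ']
  simp

/-- The Chu–Vandermonde identity. -/
theorem binom_add (L M : ℚ_[p]⟦X⟧) (n : ℕ) :
    binom (L + M) n = ∑ x ∈ Finset.HasAntidiagonal.antidiagonal n, binom L x.1 * binom M x.2 := by
  induction n with
  | zero => simp [binom_zero]
  | succ n ih =>
    have hn : ((n + 1 : ℕ) : ℚ_[p]⟦X⟧) ≠ 0 := by
      rw [← map_natCast (PowerSeries.C (R := ℚ_[p]))]
      exact (map_ne_zero_iff _ PowerSeries.C_injective).mpr (by exact_mod_cast n.succ_ne_zero)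
    apply mul_left_cancel₀ hn
    rw [natCast_mul_binom_succ, ih, Finset.sum_mul, Finset.mul_sum]
    -- The weight `n + 1` is split as `x.1 + x.2`, and `natCast_mul_binom_succ` absorbs each part.
    have h1 : ∑ x ∈ Finset.HasAntidiagonal.antidiagonal (n + 1),
        ((n + 1 : ℕ) : ℚ_[p]⟦X⟧) * (binom L x.1 * binom M x.2) =
        ∑ x ∈ Finset.HasAntidiagonal.antidiagonal (n + 1), (x.1 : ℚ_[p]⟦X⟧) * binom L x.1 * binom M x.2 +
        ∑ x ∈ Finset.HasAntidiagonal.antidiagonal (n + 1),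
          binom L x.1 * ((x.2 : ℚ_[p]⟦X⟧) * binom M x.2) := by
      rw [← Finset.sum_add_distrib]
      refine Finset.sum_congr rfl fun x hx => ?_
      rw [← Finset.HasAntidiagonal.mem_antidiagonal.mp hx, Nat.cast_add]
      ring
    rw [h1, Finset.Nat.sum_antidiagonal_succ, Finset.Nat.sum_antidiagonal_succ']
    simp only [natCast_mul_binom_succ, Nat.cast_zero, zero_mul, zero_add, mul_zero]
    rw [← Finset.sum_add_distrib]
    refine Finset.sum_congr rfl fun x hx => ?_
    rw [← Finset.HasAntidiagonal.mem_antidiagonal.mp hx, Nat.cast_add]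
    ring

theorem natCast_mem_Adag (n : ℕ) : (n : ℚ_[p]⟦X⟧) ∈ Adag p := by
  rw [← map_natCast (PowerSeries.C (R := ℚ_[p]))]
  exact C_mem_Adag _

theorem prod_mem_Adag {ι : Type*} (t : Finset ι) {F : ι → ℚ_[p]⟦X⟧} (hF : ∀ i ∈ t, F i ∈ Adag p) :
    ∏ i ∈ t, F i ∈ Adag p :=
  Finset.prod_induction F (· ∈ Adag p) (fun _ _ => mul_mem_Adag) one_mem_Adag hF

theorem substSeries_prod {N : ℚ_[p]⟦X⟧} (hN : Contracting N) {ι : Type*} (t : Finset ι)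
    {F : ι → ℚ_[p]⟦X⟧} (hF : ∀ i ∈ t, F i ∈ Adag p) :
    substSeries N (∏ i ∈ t, F i) = ∏ i ∈ t, substSeries N (F i) := by
  classical
  induction t using Finset.induction_on with
  | empty => simp [substSeries_one]
  | insert a t ha ih =>
    rw [Finset.prod_insert ha, Finset.prod_insert ha, substSeries_mul hN
      (hF _ (Finset.mem_insert_self _ _))
      (prod_mem_Adag t fun i hi => hF i (Finset.mem_insert_of_mem hi)),
      ih fun i hi => hF i (Finset.mem_insert_of_mem hi)]

theorem substSeries_binom {N L : ℚ_[p]⟦X⟧} (hN : Contracting N) (hL : L ∈ Adag p) (n : ℕ) :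
    substSeries N (binom L n) = binom (substSeries N L) n := by
  rw [binom, binom, substSeries_C_mul, substSeries_prod hN _ fun i _ =>
    (Adag p).sub_mem hL (natCast_mem_Adag i)]
  congr 1
  refine Finset.prod_congr rfl fun i _ => ?_
  rw [substSeries_sub hN hL (natCast_mem_Adag i), ← map_natCast (PowerSeries.C (R := ℚ_[p])),
    substSeries_C]

theorem bdd_binom {L : ℚ_[p]⟦X⟧} {r : ℝ} (hr : 1 ≤ r) (hL : Bdd r r L) (n : ℕ) :
    Bdd r (‖((n.factorial : ℚ_[p]))⁻¹‖ * r ^ n) (binom L n) := by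
  have hr0 : 0 ≤ r := zero_le_one.trans hr
  have h := Bdd.prod hr0 (Finset.range n) (fun k => L - (k : ℚ_[p]⟦X⟧))
    fun k _ => hL.sub hr0 ((Bdd.natCast k).mono hr)
  rw [Finset.card_range] at h
  exact (Bdd.const _).mul hr0 h

end Binomial

/-! ### The coefficients of the automorphy factor -/

section AutFactor

variable {p : ℕ} [Fact p.Prime] {u : ℤ_[p]ˣ} {m : ℕ} {a c : ℤ_[p]}

/-- The power series `(a + c z) / ω(a)`. -/
def unitFactor (a c : ℤ_[p]) : ℚ_[p]⟦X⟧ := PowerSeries.C ((teich a : ℚ_[p])⁻¹) * linear a c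

/-- Both `a / ω(a) - 1` and `c / ω(a)` have norm at most `1 / p`. -/
theorem bdd_unitFactor (ha : IsUnit a) (hc : (p : ℤ_[p]) ∣ c) {r : ℝ} (hr : 1 ≤ r) :
    Bdd r (r * (p : ℝ)⁻¹) (unitFactor a c - 1) := by
  have hp : (0 : ℝ) < (p : ℝ)⁻¹ := inv_pos.mpr (by exact_mod_cast (Fact.out : p.Prime).pos)
  have hr0 : 0 ≤ r := zero_le_one.trans hr
  have h : unitFactor a c - 1 = PowerSeries.C ((teich a : ℚ_[p])⁻¹ * ((a - teich a : ℤ_[p]) : ℚ_[p])) +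
      PowerSeries.C ((teich a : ℚ_[p])⁻¹ * (c : ℚ_[p])) * PowerSeries.X := by
    rw [unitFactor, linear, PadicInt.coe_sub, mul_sub, inv_mul_cancel₀ (teich_ne_zero ha)]
    simp only [map_mul, map_sub, map_one]
    ring
  rw [h]
  have hd : ∀ x : ℤ_[p], (p : ℤ_[p]) ∣ x → ‖(teich a : ℚ_[p])⁻¹ * (x : ℚ_[p])‖ ≤ (p : ℝ)⁻¹ :=
    fun x hx => by
      rw [norm_mul, norm_inv, norm_teich ha, inv_one, one_mul]
      exact norm_coe_of_dvd hx
  refine ((Bdd.const _).mono ((hd _ ?_).trans (le_mul_of_one_le_left hp.le hr))).add hr0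
    (((Bdd.const _).mul hr0 (Bdd.X hr0)).mono ?_)
  · rw [dvd_sub_comm]
    exact dvd_teich_sub a
  · rw [mul_comm r]
    exact mul_le_mul_of_nonneg_right (hd _ hc) hr0

theorem unitFactor_bound_le {r : ℝ} (h : r ≤ √(p : ℝ)) : r * (p : ℝ)⁻¹ * √(p : ℝ) ≤ 1 := by
  have hs : 0 < √(p : ℝ) := zero_lt_one.trans one_lt_sqrt
  rw [mul_assoc, inv_p_mul_sqrt, ← div_eq_mul_inv]
  exact (div_le_one hs).mpr h

theorem unitFactor_bound_lt {r : ℝ} (h : r < √(p : ℝ)) : r * (p : ℝ)⁻¹ * √(p : ℝ) < 1 := by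
  have hs : 0 < √(p : ℝ) := zero_lt_one.trans one_lt_sqrt
  rw [mul_assoc, inv_p_mul_sqrt, ← div_eq_mul_inv]
  exact (div_lt_one hs).mpr h

theorem logFactor_eq (u : ℤ_[p]ˣ) (a c : ℤ_[p]) : logFactor u a c =
    PowerSeries.C (padicLog ((u : ℤ_[p]) : ℚ_[p]))⁻¹ * logSeries (unitFactor a c) := rfl

/-- The bound `r / p` for the logarithm is divided by the norm of `log u`, which is exactly `1 / p`.
-/
theorem bdd_logFactor (hp : p ≠ 2) (hu : IsTopGenerator u) (ha : IsUnit a)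
    (hc : (p : ℤ_[p]) ∣ c) {r : ℝ} (hr : 1 ≤ r) (h : r ≤ √(p : ℝ)) :
    Bdd r r (logFactor u a c) := by
  have hp0 : (p : ℝ) ≠ 0 := by exact_mod_cast (Fact.out : p.Prime).ne_zero
  have hr0 : 0 < r := zero_lt_one.trans_le hr
  refine ((Bdd.const _).mul hr0.le
    (bdd_logSeries hp hr0 (bdd_unitFactor ha hc hr) (unitFactor_bound_le h))).mono ?_
  rw [norm_inv, norm_padicLog hp hu.norm_sub_one, inv_inv]
  field_simp
  exact le_rfl

theorem logFactor_mem_Adag (hp : p ≠ 2) (hu : IsTopGenerator u) (ha : IsUnit a)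
    (hc : (p : ℤ_[p]) ∣ c) : logFactor u a c ∈ Adag p :=
  (bdd_logFactor hp hu ha hc one_lt_sqrt.le le_rfl).mem_Adag one_lt_sqrt

/-- The coefficient of `w ^ k` in the automorphy factor. -/
def autCoeff (u : ℤ_[p]ˣ) (m : ℕ) (a c : ℤ_[p]) (k : ℕ) : ℚ_[p]⟦X⟧ :=
  PowerSeries.C ((teich a : ℚ_[p]) ^ m * (p : ℚ_[p]) ^ k) * binom (logFactor u a c) k

theorem coeff_coeff_autFactor (u : ℤ_[p]ˣ) (m : ℕ) (a c : ℤ_[p]) (i n : ℕ) :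
    PowerSeries.coeff n (PowerSeries.coeff i (autFactor u m a c)) =
      PowerSeries.coeff i (autCoeff u m a c n) := by
  rw [autFactor, PowerSeries.coeff_mk, PowerSeries.coeff_mk, autCoeff, PowerSeries.coeff_C_mul]

theorem norm_p_pow_mul_inv_factorial (hp : p ≠ 2) (n : ℕ) :
    ‖(p : ℚ_[p])‖ ^ n * ‖((n.factorial : ℚ_[p]))⁻¹‖ ≤ (√(p : ℝ))⁻¹ ^ n := by
  have hs : 1 < √(p : ℝ) := one_lt_sqrt
  have hs0 : 0 < √(p : ℝ) := by linarith
  calc ‖(p : ℚ_[p])‖ ^ n * ‖((n.factorial : ℚ_[p]))⁻¹‖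
      ≤ ((√(p : ℝ))⁻¹ ^ 2) ^ n * √(p : ℝ) ^ n := by
        rw [norm_p_eq]
        gcongr
        exact (norm_inv_factorial_le hp n).trans (pow_le_pow_right₀ hs.le (Nat.sub_le n 1))
    _ = _ := by
        rw [← mul_pow]
        congr 1
        field_simp

/-- The norm of `p ^ k / k!` is at most `√p ^ (-k)`, and the `k` factors of the binomial product
contribute `r ^ k`. For `r < √p` this decays in `k`, which is why the action takes values in the
Tate algebra. -/
theorem bdd_autCoeff (hp : p ≠ 2) (hu : IsTopGenerator u) (ha : IsUnit a)
    (hc : (p : ℤ_[p]) ∣ c) {r : ℝ} (hr : 1 ≤ r) (h : r ≤ √(p : ℝ)) (k : ℕ) :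
    Bdd r ((r / √(p : ℝ)) ^ k) (autCoeff u m a c k) := by
  have hr0 : 0 ≤ r := by linarith
  refine ((Bdd.const _).mul hr0 (bdd_binom hr (bdd_logFactor hp hu ha hc hr h) k)).mono ?_
  rw [norm_mul, norm_pow, norm_pow, norm_teich ha, one_pow, one_mul, ← mul_assoc, div_eq_mul_inv,
    mul_pow, mul_comm (r ^ k)]
  exact mul_le_mul_of_nonneg_right (norm_p_pow_mul_inv_factorial hp k) (pow_nonneg hr0 k)

theorem autCoeff_mem_Adag (hp : p ≠ 2) (hu : IsTopGenerator u) (ha : IsUnit a)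
    (hc : (p : ℤ_[p]) ∣ c) (k : ℕ) : autCoeff u m a c k ∈ Adag p :=
  (bdd_autCoeff hp hu ha hc one_lt_sqrt.le le_rfl k).mem_Adag one_lt_sqrt

theorem logFactor_one_zero (u : ℤ_[p]ˣ) : logFactor u 1 0 = 0 := by
  rw [logFactor_eq, unitFactor, teich_one, linear]
  simp [logSeries_one]

theorem autCoeff_one_zero (u : ℤ_[p]ˣ) (m k : ℕ) :
    autCoeff u m 1 0 k = if k = 0 then 1 else 0 := by
  rw [autCoeff, logFactor_one_zero, teich_one]
  rcases k with _ | k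
  · simp [binom_zero]
  · simp [binom_zero_succ]

variable {g h : Matrix (Fin 2) (Fin 2) ℤ_[p]}

theorem teich_mul_apply (hh : IsSigma h) (g : Matrix (Fin 2) (Fin 2) ℤ_[p]) :
    teich ((g * h) 0 0) = teich (g 0 0) * teich (h 0 0) := by
  rw [← teich_mul, Matrix.mul_apply, Fin.sum_univ_two]
  apply teich_congr
  rw [add_sub_cancel_left]
  exact hh.2.mul_left _

theorem unitFactor_mem_Adag (a c : ℤ_[p]) : unitFactor a c ∈ Adag p :=
  mul_mem_Adag (C_mem_Adag _) (linear_mem_Adag a c)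

theorem unitFactor_mul (hg : IsSigma g) (hh : IsSigma h) :
    unitFactor ((g * h) 0 0) ((g * h) 1 0) = unitFactor (g 0 0) (g 1 0) *
      substSeries (mobiusSeries g) (unitFactor (h 0 0) (h 1 0)) := by
  simp only [unitFactor]
  rw [teich_mul_apply hh, ← linear_cocycle hg h 0, PadicInt.coe_mul, mul_inv, map_mul,
    substSeries_C_mul]
  ring

theorem logFactor_mul (hp : p ≠ 2) (u : ℤ_[p]ˣ) (hg : IsSigma g) (hh : IsSigma h) :
    logFactor u ((g * h) 0 0) ((g * h) 1 0) = logFactor u (g 0 0) (g 1 0) +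
      substSeries (mobiusSeries g) (logFactor u (h 0 0) (h 1 0)) := by
  obtain ⟨r, hr, hrp⟩ := exists_between (one_lt_sqrt (p := p))
  have hr0 : 0 < r := by linarith
  have hC := unitFactor_bound_lt hrp
  have h1 := bdd_unitFactor hg.1 hg.2 hr.le
  have h2 := bdd_unitFactor hh.1 hh.2 hr.le
  have h3 : Bdd r (r * (p : ℝ)⁻¹)
      (substSeries (mobiusSeries g) (unitFactor (h 0 0) (h 1 0)) - 1) := by
    rw [← substSeries_one (mobiusSeries g), ← substSeries_sub hg.contracting
      (unitFactor_mem_Adag _ _) one_mem_Adag]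
    exact bdd_substSeries hr0 (hg.contracting r hr.le hrp.le) h2
  rw [logFactor_eq, logFactor_eq, logFactor_eq, unitFactor_mul hg hh,
    logSeries_mul hp hr0 h1 h3 hC, substSeries_C_mul,
    substSeries_logSeries hp hg.contracting hr h2 hC, mul_add]

/-- The cocycle relation for the automorphy factor. -/
theorem autCoeff_mul (hp : p ≠ 2) (hu : IsTopGenerator u) (m : ℕ) (hg : IsSigma g) (hh : IsSigma h)
    (n : ℕ) : autCoeff u m ((g * h) 0 0) ((g * h) 1 0) n =
      ∑ x ∈ Finset.HasAntidiagonal.antidiagonal n, autCoeff u m (g 0 0) (g 1 0) x.1 *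
        mobius g (autCoeff u m (h 0 0) (h 1 0) x.2) := by
  rw [autCoeff, logFactor_mul hp u hg hh, binom_add, Finset.mul_sum]
  refine Finset.sum_congr rfl fun x hx => ?_
  rw [autCoeff, autCoeff, mobius_eq, substSeries_C_mul, substSeries_binom hg.contracting
    (logFactor_mem_Adag hp hu hh.1 hh.2), teich_mul_apply hh,
    ← Finset.HasAntidiagonal.mem_antidiagonal.mp hx, PadicInt.coe_mul, mul_pow, pow_add]
  simp only [map_mul]
  ring

end AutFactor


/-! ### Evaluation of distributions -/

section Evaluation

open Filter

variable {p : ℕ} [Fact p.Prime]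

/-- The coefficient of `w ^ l` in `μ(f)`. -/
def evalCoeff (μ : Ddag p) (l : ℕ) : Adag p →ₗ[ℚ_[p]] ℚ_[p] :=
  PowerSeries.coeff (R := ℚ_[p]) l ∘ₗ (Tate p).val.toLinearMap ∘ₗ (μ : Adag p →ₗ[ℚ_[p]] Tate p)

theorem evalCoeff_apply (μ : Ddag p) (l : ℕ) (f : Adag p) : evalCoeff μ l f =
    PowerSeries.coeff l ((μ : Adag p →ₗ[ℚ_[p]] Tate p) f : ℚ_[p]⟦X⟧) := rfl

theorem coe_monom (j : ℕ) : (monom p j : ℚ_[p]⟦X⟧) = PowerSeries.X ^ j := rfl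

theorem evalCoeff_add (μ ν : Ddag p) (l : ℕ) (f : Adag p) :
    evalCoeff (μ + ν) l f = evalCoeff μ l f + evalCoeff ν l f := by
  simp [evalCoeff_apply]

/-- Continuity concerns restricted series, and a bound at radius `r` gives restrictedness only at
smaller radii; hence the passage to `(1 + r) / 2`. -/
theorem exists_evalCoeff_bound (μ : Ddag p) {r : ℝ} (hr : 1 < r) :
    ∃ C, 0 ≤ C ∧ ∀ (f : Adag p) (B : ℝ), Bdd r B (f : ℚ_[p]⟦X⟧) → ∀ l,
      ‖evalCoeff μ l f‖ ≤ C * B := by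
  obtain ⟨C, hC⟩ := μ.2 ((1 + r) / 2) (by linarith)
  refine ⟨max C 0, le_max_right _ _, fun f B hB l => ?_⟩
  have h1 := coeff_le_discNorm ((μ : Adag p →ₗ[ℚ_[p]] Tate p) f).2 l
  rw [one_pow, mul_one] at h1
  refine (h1.trans (hC f (hB.isRestricted (by linarith) (by linarith)))).trans ?_
  exact mul_le_mul (le_max_left _ _) (hB.anti (by linarith) (by linarith)).discNorm_le
    (discNorm_nonneg _ _) (le_max_right _ _)

theorem bdd_sub_sum_range {r s C : ℝ} (hs : 0 ≤ s) (hsr : s ≤ r) (hr : 0 < r) {f : ℚ_[p]⟦X⟧}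
    (hf : Bdd r C f) (n : ℕ) :
    Bdd s (C * (s / r) ^ n)
      (f - ∑ i ∈ Finset.range n, PowerSeries.C (PowerSeries.coeff i f) * PowerSeries.X ^ i) := by
  intro j
  have h : PowerSeries.coeff j
      (f - ∑ i ∈ Finset.range n, PowerSeries.C (PowerSeries.coeff i f) * PowerSeries.X ^ i) =
      if j < n then 0 else PowerSeries.coeff j f := by
    simp only [map_sub, map_sum, PowerSeries.coeff_C_mul, PowerSeries.coeff_X_pow, mul_ite, mul_one,
      mul_zero, Finset.sum_ite_eq, Finset.mem_range]
    split_ifs <;> simp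
  rw [h]
  have hC := hf.nonneg
  split_ifs with hj
  · rw [norm_zero, zero_mul]
    positivity
  · have h1 := hf.coeff_le' hr j
    calc ‖PowerSeries.coeff j f‖ * s ^ j ≤ (C * r⁻¹ ^ j) * s ^ j := by gcongr
      _ = C * (s / r) ^ j := by rw [div_eq_mul_inv, mul_pow]; ring
      _ ≤ C * (s / r) ^ n := by
        have := pow_le_pow_of_le_one (by positivity) ((div_le_one hr).mpr hsr) (not_lt.mp hj)
        gcongr

/-- A distribution is determined by its moments. -/
theorem hasSum_evalCoeff (μ : Ddag p) (l : ℕ) (f : Adag p) :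
    HasSum (fun i => PowerSeries.coeff i (f : ℚ_[p]⟦X⟧) * evalCoeff μ l (monom p i))
      (evalCoeff μ l f) := by
  obtain ⟨r, hr, -, B, hB⟩ := mem_Adag_iff.mp f.2
  obtain ⟨s, hs1, hsr⟩ := exists_between hr
  have hr0 : 0 < r := by linarith
  have hs0 : 0 < s := by linarith
  obtain ⟨C, hC0, hC⟩ := exists_evalCoeff_bound μ hs1
  have hlt : s / r < 1 := (div_lt_one hr0).mpr hsr
  have hB0 := hB.nonneg
  have hsum : Summable fun i =>
      PowerSeries.coeff i (f : ℚ_[p]⟦X⟧) * evalCoeff μ l (monom p i) := by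
    refine Summable.of_norm_bounded ((summable_geometric_of_lt_one (by positivity) hlt).mul_left
      (B * C)) fun i => ?_
    have h1 := hB.coeff_le' hr0 i
    have h2 := hC (monom p i) (s ^ i) ((Bdd.X hs0.le).pow hs0.le i) l
    rw [norm_mul]
    calc _ ≤ (B * r⁻¹ ^ i) * (C * s ^ i) := by gcongr
      _ = _ := by rw [div_eq_mul_inv, mul_pow]; ring
  -- The partial sums are the values of `μ` on Taylor polynomials of `f`, and the remainders tend to
  -- zero on the smaller disc of radius `s`.
  convert hsum.hasSum
  refine tendsto_nhds_unique ?_ hsum.hasSum.tendsto_sum_nat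
  have h0 : Tendsto (fun n => C * (B * (s / r) ^ n)) atTop (nhds 0) := by
    simpa using ((tendsto_pow_atTop_nhds_zero_of_lt_one (by positivity) hlt).const_mul B).const_mul C
  rw [tendsto_iff_norm_sub_tendsto_zero]
  refine squeeze_zero (fun _ => norm_nonneg _) (fun n => ?_) h0
  set f' : Adag p := f - ∑ i ∈ Finset.range n, PowerSeries.coeff i (f : ℚ_[p]⟦X⟧) • monom p i
    with hf'
  have h1 : Bdd s (B * (s / r) ^ n) (f' : ℚ_[p]⟦X⟧) := by
    convert bdd_sub_sum_range hs0.le hsr.le hr0 hB n using 1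
    simp [hf', monom, PowerSeries.smul_eq_C_mul]
  have h2 := hC f' _ h1 l
  rw [norm_sub_rev]
  rwa [hf', map_sub, map_sum, Finset.sum_congr rfl fun i _ => map_smul _ _ _] at h2

theorem Ddag.ext_evalCoeff {μ ν : Ddag p} (h : ∀ f l, evalCoeff μ l f = evalCoeff ν l f) :
    μ = ν := by
  apply Subtype.ext
  ext f : 1
  apply Subtype.ext
  ext l
  exact h f l

theorem Ddag.ext_monom {μ ν : Ddag p}
    (h : ∀ j l, evalCoeff μ l (monom p j) = evalCoeff ν l (monom p j)) : μ = ν := by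
  refine Ddag.ext_evalCoeff fun f l => (hasSum_evalCoeff μ l f).unique ?_
  simpa only [h] using hasSum_evalCoeff ν l f

/-- The series is `∑ w ^ k G_k`. The terms with `k ≥ k₀` are uniformly small, and each of the
finitely many others has coefficients tending to zero. -/
theorem mem_Tate_of_antidiagonal (G : ℕ → Tate p) (ε : ℕ → ℝ) (hε : Tendsto ε atTop (nhds 0))
    (hG : ∀ k l, ‖PowerSeries.coeff l (G k : ℚ_[p]⟦X⟧)‖ ≤ ε k) :
    (PowerSeries.mk fun n => ∑ x ∈ Finset.HasAntidiagonal.antidiagonal n,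
      PowerSeries.coeff x.2 (G x.1 : ℚ_[p]⟦X⟧)) ∈ Tate p := by
  change PowerSeries.IsRestricted 1 _
  rw [PowerSeries.isRestricted_iff', Metric.tendsto_atTop']
  intro δ hδ
  have hδ2 : 0 < δ / 2 := by linarith
  obtain ⟨k₀, hk₀⟩ := eventually_atTop.mp (hε.eventually_le_const hδ2)
  have h1 : ∀ k, ∀ᶠ n in atTop, ‖PowerSeries.coeff (n - k) (G k : ℚ_[p]⟦X⟧)‖ ≤ δ / 2 := fun k => by
    have h2 : PowerSeries.IsRestricted 1 (G k : ℚ_[p]⟦X⟧) := (G k).2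
    rw [PowerSeries.isRestricted_iff'] at h2
    simp only [one_pow, mul_one] at h2
    exact (h2.comp (tendsto_sub_atTop_nat k)).eventually_le_const hδ2
  have h2 := (Finset.range k₀).eventually_all.mpr fun k _ => h1 k
  obtain ⟨n₀, hn₀⟩ := eventually_atTop.mp h2
  refine ⟨n₀, fun n hn => ?_⟩
  rw [one_pow, mul_one, PowerSeries.coeff_mk, dist_zero_right, norm_norm]
  refine lt_of_le_of_lt (IsUltrametricDist.norm_sum_le_of_forall_le_of_nonneg hδ2.le
    fun x hx => ?_) (by linarith : δ / 2 < δ)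
  rcases lt_or_ge x.1 k₀ with hk | hk
  · have := hn₀ n hn.le x.1 (Finset.mem_range.mpr hk)
    rwa [← Finset.HasAntidiagonal.mem_antidiagonal.mp hx, Nat.add_sub_cancel_left] at this
  · exact (hG _ _).trans (hk₀ _ hk)

end Evaluation

/-! ### The action on distributions -/

section SlashAction

open Filter

variable {p : ℕ} [Fact p.Prime] {u : ℤ_[p]ˣ} {g h : Matrix (Fin 2) (Fin 2) ℤ_[p]}

theorem mobius_mem_Adag (hg : IsSigma g) {f : ℚ_[p]⟦X⟧} (hf : f ∈ Adag p) : mobius g f ∈ Adag p :=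
  hg.contracting.subst_mem hf

theorem mobius_add (hg : IsSigma g) {f f' : ℚ_[p]⟦X⟧} (hf : f ∈ Adag p) (hf' : f' ∈ Adag p) :
    mobius g (f + f') = mobius g f + mobius g f' :=
  substSeries_add hg.contracting hf hf'

theorem mobius_smul (g : Matrix (Fin 2) (Fin 2) ℤ_[p]) (a : ℚ_[p]) (f : ℚ_[p]⟦X⟧) :
    mobius g (a • f) = a • mobius g f := by
  rw [PowerSeries.smul_eq_C_mul, PowerSeries.smul_eq_C_mul]
  exact substSeries_C_mul _ f a

theorem mobius_map_mul (hg : IsSigma g) {f f' : ℚ_[p]⟦X⟧} (hf : f ∈ Adag p) (hf' : f' ∈ Adag p) :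
    mobius g (f * f') = mobius g f * mobius g f' :=
  substSeries_mul hg.contracting hf hf'

/-- The overconvergent function `κ_k · (f ∘ g)`, where `κ_k` is the coefficient of `w ^ k` in the
automorphy factor. -/
def twist (hp : p ≠ 2) (hu : IsTopGenerator u) (m : ℕ) (hg : IsSigma g) (k : ℕ) (f : Adag p) :
    Adag p :=
  ⟨autCoeff u m (g 0 0) (g 1 0) k * mobius g f,
    mul_mem_Adag (autCoeff_mem_Adag hp hu hg.1 hg.2 k) (mobius_mem_Adag hg f.2)⟩

variable (hp : p ≠ 2) (hu : IsTopGenerator u) (m : ℕ)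

theorem coe_twist (hg : IsSigma g) (k : ℕ) (f : Adag p) : (twist hp hu m hg k f : ℚ_[p]⟦X⟧) =
    autCoeff u m (g 0 0) (g 1 0) k * mobius g f := rfl

theorem bdd_twist (hg : IsSigma g) {r : ℝ} (hr : 1 ≤ r) (h : r ≤ √(p : ℝ)) {f : Adag p} {B : ℝ}
    (hf : Bdd r B (f : ℚ_[p]⟦X⟧)) (k : ℕ) :
    Bdd r ((r / √(p : ℝ)) ^ k * B) (twist hp hu m hg k f : ℚ_[p]⟦X⟧) :=
  (bdd_autCoeff hp hu hg.1 hg.2 hr h k).mul (by linarith)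
    (bdd_substSeries (by linarith) (hg.contracting r hr h) hf)

theorem twist_add (hg : IsSigma g) (k : ℕ) (f f' : Adag p) :
    twist hp hu m hg k (f + f') = twist hp hu m hg k f + twist hp hu m hg k f' := by
  apply Subtype.ext
  simp only [coe_twist, Submodule.coe_add]
  rw [mobius_add hg f.2 f'.2, mul_add]

theorem twist_smul (hg : IsSigma g) (k : ℕ) (a : ℚ_[p]) (f : Adag p) :
    twist hp hu m hg k (a • f) = a • twist hp hu m hg k f := by
  apply Subtype.ext
  simp only [coe_twist, Submodule.coe_smul]
  rw [mobius_smul, mul_smul_comm]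

/-- The sum over moments in `pairing` collapses to values of `μ` by `hasSum_evalCoeff`. The
resulting finite formula is the source of all properties of the action. -/
theorem coeff_slash (μ : Ddag p) (hg : IsSigma g) (f : Adag p) (n : ℕ) :
    PowerSeries.coeff n (slash u m μ g f) = ∑ x ∈ Finset.HasAntidiagonal.antidiagonal n,
      evalCoeff μ x.2 (twist hp hu m hg x.1 f) := by
  have h1 : ∀ i k, PowerSeries.coeff k (PowerSeries.coeff i (autFactor u m (g 0 0) (g 1 0) *
      PowerSeries.map PowerSeries.C (mobius g (f : ℚ_[p]⟦X⟧)))) =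
      PowerSeries.coeff i (twist hp hu m hg k f : ℚ_[p]⟦X⟧) := fun i k => by
    rw [PowerSeries.coeff_mul, map_sum, coe_twist, PowerSeries.coeff_mul]
    refine Finset.sum_congr rfl fun y _ => ?_
    rw [PowerSeries.coeff_map, PowerSeries.coeff_mul_C, coeff_coeff_autFactor]
  have h2 := hasSum_sum (s := Finset.HasAntidiagonal.antidiagonal n)
    fun x _ => hasSum_evalCoeff μ x.2 (twist hp hu m hg x.1 f)
  rw [slash, pairing, PowerSeries.coeff_mk, ← h2.tsum_eq]
  congr 1
  funext i
  rw [PowerSeries.coeff_mul]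
  exact Finset.sum_congr rfl fun x _ => by rw [h1]; rfl

/-- The radius `s` must be below `r`, where `f` is controlled, and below `√p`, for decay in `k`. -/
theorem norm_evalCoeff_twist (μ : Ddag p) (hg : IsSigma g) {r : ℝ} (hr : 1 < r) :
    ∃ s C, 1 < s ∧ s < √(p : ℝ) ∧ 0 ≤ C ∧ ∀ (f : Adag p) (B : ℝ), Bdd r B (f : ℚ_[p]⟦X⟧) → ∀ k l,
      ‖evalCoeff μ l (twist hp hu m hg k f)‖ ≤ C * ((s / √(p : ℝ)) ^ k * B) := by
  have hs := one_lt_sqrt (p := p)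
  obtain ⟨s, hs1, hs2⟩ := exists_between (lt_min hr hs)
  obtain ⟨C, hC0, hC⟩ := exists_evalCoeff_bound μ hs1
  have hsp := hs2.trans_le (min_le_right _ _)
  refine ⟨s, C, hs1, hsp, hC0, fun f B hB k l => hC _ _ ?_ l⟩
  exact bdd_twist hp hu m hg hs1.le hsp.le
    (hB.anti (by linarith) (hs2.le.trans (min_le_left _ _))) k

theorem slash_mem_Tate (hp : p ≠ 2) (hu : IsTopGenerator u) (m : ℕ) (μ : Ddag p) (hg : IsSigma g) (f : Adag p) : slash u m μ g f ∈ Tate p := by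
  obtain ⟨r, hr, -, B, hB⟩ := mem_Adag_iff.mp f.2
  obtain ⟨s, C, hs1, hs2, -, hC⟩ := norm_evalCoeff_twist hp hu m μ hg hr
  have hε : Tendsto (fun k => C * ((s / √(p : ℝ)) ^ k * B)) atTop (nhds 0) := by
    simpa using ((tendsto_pow_atTop_nhds_zero_of_lt_one (by positivity)
      ((div_lt_one (by linarith)).mpr hs2)).mul_const B).const_mul C
  have h := mem_Tate_of_antidiagonal
    (fun k => (μ : Adag p →ₗ[ℚ_[p]] Tate p) (twist hp hu m hg k f)) _ hε
    fun k l => hC f B hB k l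
  convert h
  ext n
  rw [coeff_slash hp hu m μ hg, PowerSeries.coeff_mk]
  rfl

/-- The operator `μ ↦ μ | g` on distributions. -/
def slashD (hp : p ≠ 2) (hu : IsTopGenerator u) (m : ℕ) (hg : IsSigma g) : Ddag p →+ Ddag p where
  toFun μ :=
    ⟨{  toFun := fun f => ⟨slash u m μ g f, slash_mem_Tate hp hu m μ hg f⟩
        map_add' := fun f f' => by
          apply Subtype.ext
          ext n
          change PowerSeries.coeff n (slash u m μ g (f + f')) =
            PowerSeries.coeff n (slash u m μ g f + slash u m μ g f')
          simp only [map_add, coeff_slash hp hu m μ hg, twist_add, Finset.sum_add_distrib]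
        map_smul' := fun a f => by
          apply Subtype.ext
          ext n
          change PowerSeries.coeff n (slash u m μ g (a • f)) =
            PowerSeries.coeff n (a • slash u m μ g f)
          simp only [map_smul, coeff_slash hp hu m μ hg, twist_smul, Finset.smul_sum] }, by
      intro r hr
      obtain ⟨s, C, hs1, hs2, hC0, hC⟩ := norm_evalCoeff_twist hp hu m μ hg hr
      refine ⟨C, fun f hf => discNorm_one_le fun n => ?_⟩
      change ‖PowerSeries.coeff n (slash u m μ g f)‖ ≤ _
      rw [coeff_slash hp hu m μ hg]
      refine IsUltrametricDist.norm_sum_le_of_forall_le_of_nonneg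
        (mul_nonneg hC0 (discNorm_nonneg _ _)) fun x _ =>
        (hC f _ (bdd_of_isRestricted hf) _ _).trans ?_
      exact mul_le_mul_of_nonneg_left (mul_le_of_le_one_left (discNorm_nonneg _ _)
        (pow_le_one₀ (by positivity) ((div_le_one (by linarith)).mpr hs2.le))) hC0⟩
  map_zero' := Ddag.ext_evalCoeff fun f n => by
    change PowerSeries.coeff n (slash u m 0 g f) = 0
    rw [coeff_slash hp hu m 0 hg]
    exact Finset.sum_eq_zero fun x _ => by simp [evalCoeff_apply]
  map_add' μ ν := Ddag.ext_evalCoeff fun f n => by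
    change PowerSeries.coeff n (slash u m (μ + ν) g f) =
      PowerSeries.coeff n (slash u m μ g f + slash u m ν g f)
    simp only [map_add, coeff_slash hp hu m _ hg, evalCoeff_add, Finset.sum_add_distrib]

theorem slashD_apply (hg : IsSigma g) (μ : Ddag p) (f : Adag p) :
    ((slashD hp hu m hg μ : Adag p →ₗ[ℚ_[p]] Tate p) f : ℚ_[p]⟦X⟧) = slash u m μ g f := rfl

theorem evalCoeff_slashD (hg : IsSigma g) (μ : Ddag p) (f : Adag p) (n : ℕ) :
    evalCoeff (slashD hp hu m hg μ) n f = ∑ x ∈ Finset.HasAntidiagonal.antidiagonal n,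
      evalCoeff μ x.2 (twist hp hu m hg x.1 f) := by
  rw [evalCoeff_apply, slashD_apply, coeff_slash hp hu m μ hg]

theorem twist_mul (hg : IsSigma g) (hh : IsSigma h) (n : ℕ) (f : Adag p) :
    twist hp hu m (hg.mul hh) n f = ∑ x ∈ Finset.HasAntidiagonal.antidiagonal n,
      twist hp hu m hg x.2 (twist hp hu m hh x.1 f) := by
  apply Subtype.ext
  rw [AddSubmonoidClass.coe_finsetSum, ← Finset.Nat.sum_antidiagonal_swap]
  rw [coe_twist, autCoeff_mul hp hu m hg hh, mobius_mul hg hh f.2, Finset.sum_mul]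
  refine Finset.sum_congr rfl fun x _ => ?_
  rw [Prod.snd_swap, Prod.fst_swap, coe_twist, coe_twist,
    mobius_map_mul hg (autCoeff_mem_Adag hp hu hh.1 hh.2 _) (mobius_mem_Adag hh f.2), mul_assoc]

theorem slashD_mul (hg : IsSigma g) (hh : IsSigma h) (μ : Ddag p) :
    slashD hp hu m (hg.mul hh) μ = slashD hp hu m hh (slashD hp hu m hg μ) := by
  refine Ddag.ext_evalCoeff fun f n => ?_
  have h1 : ∀ x : ℕ × ℕ, evalCoeff μ x.2 (twist hp hu m (hg.mul hh) x.1 f) =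
      ∑ y ∈ Finset.HasAntidiagonal.antidiagonal x.1,
        evalCoeff μ x.2 (twist hp hu m hg y.2 (twist hp hu m hh y.1 f)) := fun x => by
    rw [twist_mul hp hu m hg hh, map_sum]
  simp only [evalCoeff_slashD]
  rw [Finset.sum_congr rfl fun x _ => h1 x, Finset.sum_sigma', Finset.sum_sigma']
  -- Both sides run over triples of indices with sum `n`, grouped differently.
  refine Finset.sum_nbij' (fun x => ⟨(x.2.1, x.2.2 + x.1.2), (x.2.2, x.1.2)⟩)
    (fun x => ⟨(x.1.1 + x.2.1, x.2.2), (x.1.1, x.2.1)⟩) ?_ ?_ ?_ ?_ ?_ <;>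
  simp only [Sigma.forall, Finset.mem_sigma, Finset.HasAntidiagonal.mem_antidiagonal, Prod.forall,
    and_imp] <;> intros <;> subst_vars <;> simp [add_assoc]

/-- Translation `f(z) ↦ f(z + b)` and the trivial automorphy factor. -/
theorem evalCoeff_slashD_unipotent (hg : IsSigma g) (h0 : g 0 0 = 1) (h1 : g 1 0 = 0) (μ : Ddag p)
    (f f' : Adag p) (hf : mobius g f = f') (n : ℕ) :
    evalCoeff (slashD hp hu m hg μ) n f = evalCoeff μ n f' := by
  rw [evalCoeff_slashD, Finset.sum_eq_single (0, n)]
  · congr 1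
    apply Subtype.ext
    simp [twist, h0, h1, autCoeff_one_zero, hf]
  · rintro ⟨k, l⟩ hx hne
    have hk : k ≠ 0 := by
      rintro rfl
      exact hne (by simpa using hx)
    have : twist hp hu m hg k f = 0 := by
      apply Subtype.ext
      simp [twist, h0, h1, autCoeff_one_zero, hk]
    rw [this, map_zero]
  · intro hx
    simp at hx

theorem isSigma_one : IsSigma (1 : Matrix (Fin 2) (Fin 2) ℤ_[p]) := by
  simp [IsSigma]

theorem slashD_one (μ : Ddag p) : slashD hp hu m isSigma_one μ = μ := by
  refine Ddag.ext_evalCoeff fun f n =>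
    evalCoeff_slashD_unipotent hp hu m isSigma_one (by simp) (by simp) μ f f ?_ n
  have h1 : mobiusSeries (1 : Matrix (Fin 2) (Fin 2) ℤ_[p]) = PowerSeries.X := by
    simp [mobiusSeries, linear]
  rw [mobius_eq, h1, substSeries_by_X]

end SlashAction


/-! ### The difference equation -/

section Difference

open Filter

variable {p : ℕ} [Fact p.Prime]

/-- The power of `p` dividing `n` is at most `n`. Linear growth is enough here, since a geometric
factor will beat it. -/
theorem norm_inv_natCast_le_self {n : ℕ} (hn : n ≠ 0) : ‖((n : ℚ_[p]))⁻¹‖ ≤ n := by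
  have h0 : (n : ℚ_[p]) ≠ 0 := by exact_mod_cast hn
  rw [norm_inv, Padic.norm_eq_zpow_neg_valuation h0, Padic.valuation_natCast, zpow_neg, inv_inv,
    zpow_natCast]
  exact_mod_cast Nat.le_of_dvd (Nat.pos_of_ne_zero hn) pow_padicValNat_dvd

theorem norm_inv_prime_le {q : ℕ} (hq : q.Prime) : ‖((q : ℚ_[p]))⁻¹‖ ≤ p := by
  have hp1 : (1 : ℝ) ≤ p := by exact_mod_cast (Fact.out : p.Prime).one_lt.le
  by_cases h : p = q
  · subst h
    rw [norm_inv, Padic.norm_p, inv_inv]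
  · have h1 : padicValNat p q = 0 := by
      have := Fact.mk hq
      exact padicValNat_primes h
    have h0 : (q : ℚ_[p]) ≠ 0 := by exact_mod_cast hq.ne_zero
    rw [norm_inv, Padic.norm_eq_zpow_neg_valuation h0, Padic.valuation_natCast, h1]
    simpa using hp1

/-- The Bernoulli numbers have a simple pole at `p` at worst. -/
theorem norm_bernoulli_le (k : ℕ) : ‖((bernoulli k : ℚ) : ℚ_[p])‖ ≤ p := by
  have hp0 : (0 : ℝ) ≤ p := Nat.cast_nonneg p
  have hp1 : (1 : ℝ) ≤ p := by exact_mod_cast (Fact.out : p.Prime).one_lt.le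
  rcases Nat.even_or_odd k with ⟨k, rfl⟩ | hk
  · rw [← two_mul]
    -- Up to an integer, the Bernoulli number is minus a sum of reciprocals of distinct primes, each
    -- of norm at most `p`.
    obtain ⟨z, hz⟩ := Bernoulli.vonStaudt_clausen k
    have h1 : ((bernoulli (2 * k) : ℚ) : ℚ_[p]) = (z : ℚ_[p]) -
        ∑ q ∈ Finset.range (2 * k + 2) with q.Prime ∧ (q - 1) ∣ 2 * k, ((q : ℚ_[p]))⁻¹ := by
      rw [eq_sub_iff_add_eq]
      have := congrArg (fun x : ℚ => (x : ℚ_[p])) hz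
      push_cast at this
      simpa only [one_div] using this.symm
    rw [h1, sub_eq_add_neg]
    refine (IsUltrametricDist.norm_add_le_max _ _).trans (max_le
      ((Padic.norm_int_le_one z).trans hp1) ?_)
    rw [norm_neg]
    refine IsUltrametricDist.norm_sum_le_of_forall_le_of_nonneg hp0 fun q hq => ?_
    exact norm_inv_prime_le (Finset.mem_filter.mp hq).2.1
  · rcases (Nat.succ_le_of_lt hk.pos).eq_or_lt with h | h
    · rw [← h, Nat.succ_eq_add_one, zero_add, bernoulli_one]
      push_cast
      rw [norm_div, norm_neg, norm_one, one_div, ← norm_inv]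
      exact_mod_cast norm_inv_prime_le (p := p) Nat.prime_two
    · rw [bernoulli_eq_zero_of_odd hk h]
      simp

variable (p) in
/-- A rational polynomial as a power series over `ℚ_p`. -/
def ratSeries : Polynomial ℚ →+* ℚ_[p]⟦X⟧ :=
  Polynomial.coeToPowerSeries.ringHom.comp (Polynomial.mapRingHom (Rat.castHom ℚ_[p]))

theorem coeff_ratSeries (P : Polynomial ℚ) (i : ℕ) :
    PowerSeries.coeff i (ratSeries p P) = ((P.coeff i : ℚ) : ℚ_[p]) := by
  simp [ratSeries]

theorem ratSeries_C (a : ℚ) : ratSeries p (Polynomial.C a) = PowerSeries.C (a : ℚ_[p]) := by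
  simp [ratSeries]

theorem ratSeries_X : ratSeries p Polynomial.X = PowerSeries.X := by
  simp [ratSeries]

variable (p) in
/-- The primitive `B_{n+1}(z) / (n + 1)` of `z ^ n` with respect to the difference operator. -/
def bernoulliPrimitive (n : ℕ) : ℚ_[p]⟦X⟧ :=
  PowerSeries.C (((n + 1 : ℕ) : ℚ_[p])⁻¹) * ratSeries p (Polynomial.bernoulli (n + 1))

theorem bdd_bernoulliPrimitive {s : ℝ} (hs : 1 ≤ s) (n : ℕ) :
    Bdd s (((n + 1 : ℕ) : ℝ) * (p * s ^ (n + 1))) (bernoulliPrimitive p n) := by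
  have hs0 : 0 ≤ s := by linarith
  refine ((Bdd.const _).mul hs0 (C' := p * s ^ (n + 1)) fun i => ?_).mono
    (mul_le_mul_of_nonneg_right (norm_inv_natCast_le_self n.succ_ne_zero) (by positivity))
  rw [coeff_ratSeries, Polynomial.coeff_bernoulli]
  split_ifs with hi
  · rw [Rat.cast_mul, norm_mul, Rat.cast_natCast]
    have h1 : ‖(((n + 1).choose i : ℕ) : ℚ_[p])‖ ≤ 1 := by
      exact_mod_cast Padic.norm_int_le_one (p := p) ((n + 1).choose i)
    exact mul_le_mul ((mul_le_of_le_one_right (norm_nonneg _) h1).trans (norm_bernoulli_le _))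
      (pow_le_pow_right₀ hs hi) (by positivity) (by positivity)
  · simp
    positivity

omit [Fact p.Prime] in
theorem exists_growth_bound {r s : ℝ} (hs : 0 < s) (hsr : s < r) : ∃ D, 0 ≤ D ∧
    (∀ n : ℕ, r⁻¹ ^ n * (((n + 1 : ℕ) : ℝ) * (p * s ^ (n + 1))) ≤ D) ∧
    Summable fun n : ℕ => r⁻¹ ^ n * (((n + 1 : ℕ) : ℝ) * (p * s ^ (n + 1))) := by
  have hr : 0 < r := hs.trans hsr
  have hlt : ‖s / r‖ < 1 := by
    rw [Real.norm_of_nonneg (by positivity)]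
    exact (div_lt_one hr).mpr hsr
  have h1 : Summable fun n : ℕ => r⁻¹ ^ n * (((n + 1 : ℕ) : ℝ) * (p * s ^ (n + 1))) := by
    have h2 := ((summable_pow_mul_geometric_of_norm_lt_one 1 hlt).add
      (summable_geometric_of_norm_lt_one hlt)).mul_left (p * s)
    refine h2.congr fun n => ?_
    rw [div_eq_mul_inv, mul_pow]
    push_cast
    ring
  refine ⟨∑' n : ℕ, r⁻¹ ^ n * (((n + 1 : ℕ) : ℝ) * (p * s ^ (n + 1))),
    tsum_nonneg fun n => by positivity, fun n => h1.le_tsum n fun j _ => by positivity, h1⟩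

/-- The indefinite sum of an overconvergent function. -/
def indefSum (f : ℚ_[p]⟦X⟧) : ℚ_[p]⟦X⟧ :=
  PowerSeries.mk fun j => ∑' n : ℕ, PowerSeries.coeff n f *
    PowerSeries.coeff j (bernoulliPrimitive p n)

theorem norm_indefSum_term_le {r s C : ℝ} (hr : 0 < r) (hs : 1 ≤ s) {f : ℚ_[p]⟦X⟧} (hf : Bdd r C f)
    (n j : ℕ) : ‖PowerSeries.coeff n f * PowerSeries.coeff j (bernoulliPrimitive p n)‖ * s ^ j ≤
      C * (r⁻¹ ^ n * (((n + 1 : ℕ) : ℝ) * (p * s ^ (n + 1)))) := by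
  rw [norm_mul, mul_assoc, ← mul_assoc C]
  exact mul_le_mul (hf.coeff_le' hr n) (bdd_bernoulliPrimitive hs n j) (by positivity)
    (mul_nonneg hf.nonneg (by positivity))

theorem summable_indefSum {f : ℚ_[p]⟦X⟧} (hf : f ∈ Adag p) (j : ℕ) : Summable fun n : ℕ =>
    PowerSeries.coeff n f * PowerSeries.coeff j (bernoulliPrimitive p n) := by
  obtain ⟨r, hr, -, C, hC⟩ := mem_Adag_iff.mp hf
  obtain ⟨D, -, -, hD⟩ := exists_growth_bound (p := p) one_pos hr
  refine Summable.of_norm_bounded (hD.mul_left C) fun n => ?_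
  simpa using norm_indefSum_term_le (by linarith) le_rfl hC n j

/-- The primitive of `z ^ n` is bounded by `(n + 1) p s ^ (n + 1)`, so an arbitrarily small loss of
radius makes the operator bounded; overconvergent functions can afford it. -/
theorem bdd_indefSum {r s : ℝ} (hs : 1 ≤ s) (hsr : s < r) :
    ∃ D, 0 ≤ D ∧ ∀ (f : ℚ_[p]⟦X⟧) (C : ℝ), Bdd r C f → Bdd s (C * D) (indefSum f) := by
  obtain ⟨D, hD0, hD, -⟩ := exists_growth_bound (p := p) (by linarith) hsr
  refine ⟨D, hD0, fun f C hf j => ?_⟩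
  have hs0 : 0 < s ^ j := by positivity
  rw [indefSum, PowerSeries.coeff_mk, ← le_div_iff₀ hs0]
  refine IsUltrametricDist.norm_tsum_le_of_forall_le_of_nonneg
    (div_nonneg (mul_nonneg hf.nonneg hD0) hs0.le) fun n => ?_
  rw [le_div_iff₀ hs0]
  exact (norm_indefSum_term_le (by linarith) hs hf n j).trans
    (mul_le_mul_of_nonneg_left (hD n) hf.nonneg)

theorem indefSum_mem_Adag {f : ℚ_[p]⟦X⟧} (hf : f ∈ Adag p) : indefSum f ∈ Adag p := by
  obtain ⟨r, hr, -, C, hC⟩ := mem_Adag_iff.mp hf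
  obtain ⟨s, hs1, hsr⟩ := exists_between hr
  obtain ⟨D, -, hD⟩ := bdd_indefSum (p := p) hs1.le hsr
  exact (hD f C hC).mem_Adag hs1

variable (p) in
/-- The indefinite sum as a linear operator. -/
def indefSumL : Adag p →ₗ[ℚ_[p]] Adag p where
  toFun f := ⟨indefSum (f : ℚ_[p]⟦X⟧), indefSum_mem_Adag f.2⟩
  map_add' f g := by
    apply Subtype.ext
    ext j
    simp only [indefSum, Submodule.coe_add, map_add, PowerSeries.coeff_mk, add_mul]
    exact (summable_indefSum f.2 j).tsum_add (summable_indefSum g.2 j)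
  map_smul' a f := by
    apply Subtype.ext
    ext j
    simp only [indefSum, Submodule.coe_smul, PowerSeries.coeff_mk, map_smul, smul_eq_mul, mul_assoc,
      RingHom.id_apply, tsum_mul_left]

theorem coe_indefSumL_monom (j : ℕ) :
    (indefSumL p (monom p j) : ℚ_[p]⟦X⟧) = bernoulliPrimitive p j := by
  ext i
  change PowerSeries.coeff i (indefSum (monom p j : ℚ_[p]⟦X⟧)) = _
  rw [indefSum, PowerSeries.coeff_mk, tsum_eq_single j]
  · simp [coe_monom]
  · intro n hn
    simp [coe_monom, PowerSeries.coeff_X_pow, hn]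

/-- The indefinite sum is a right inverse of the difference operator, up to constants. -/
theorem sum_bernoulliPrimitive (j : ℕ) :
    ∑ k ∈ Finset.range j, PowerSeries.C ((j.choose k : ℕ) : ℚ_[p]) * bernoulliPrimitive p k =
      PowerSeries.X ^ j - PowerSeries.C (((j + 1 : ℕ) : ℚ_[p])⁻¹) := by
  have hj : ((j + 1 : ℕ) : ℚ_[p]) ≠ 0 := by exact_mod_cast j.succ_ne_zero
  -- This writes `(j + 1) z ^ j` through `B_0, …, B_j`; the term `B_0 = 1` becomes the constant `1 /
  -- (j + 1)`, and shifting the index gives the primitives.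
  have h1 := congrArg (ratSeries p) (Polynomial.sum_bernoulli j)
  rw [Finset.sum_range_succ', map_add, map_sum] at h1
  simp only [Polynomial.smul_eq_C_mul, map_mul, ratSeries_C, ← Polynomial.C_mul_X_pow_eq_monomial,
    map_pow, ratSeries_X, Polynomial.bernoulli_zero, map_one, mul_one, Nat.choose_zero_right,
    Nat.cast_one, Rat.cast_one, Rat.cast_add, Rat.cast_natCast] at h1
  have h2 : ∀ k, PowerSeries.C ((j.choose k : ℕ) : ℚ_[p]) * bernoulliPrimitive p k =
      PowerSeries.C (((j + 1 : ℕ) : ℚ_[p])⁻¹) * (PowerSeries.C (((j + 1).choose (k + 1) : ℕ) : ℚ_[p]) *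
        ratSeries p (Polynomial.bernoulli (k + 1))) := fun k => by
    have hk : ((k + 1 : ℕ) : ℚ_[p]) ≠ 0 := by exact_mod_cast k.succ_ne_zero
    rw [bernoulliPrimitive, ← mul_assoc, ← mul_assoc, ← map_mul, ← map_mul]
    congr 2
    have := Nat.add_one_mul_choose_eq j k
    have h3 : ((j + 1 : ℕ) : ℚ_[p]) * (j.choose k : ℕ) =
      ((j + 1).choose (k + 1) : ℕ) * ((k + 1 : ℕ) : ℚ_[p]) := by exact_mod_cast this
    field_simp
    linear_combination h3
  rw [Finset.sum_congr rfl fun k _ => h2 k, ← Finset.mul_sum, eq_sub_of_add_eq h1, mul_sub, mul_one,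
    ← mul_assoc, ← map_mul]
  push_cast at hj ⊢
  rw [inv_mul_cancel₀ hj, map_one, one_mul]

/-- The transpose of the indefinite sum. -/
def indefSumDual (ν : Ddag p) : Ddag p :=
  ⟨(ν : Adag p →ₗ[ℚ_[p]] Tate p) ∘ₗ indefSumL p, by
    intro r hr
    have h1 : 1 < (1 + r) / 2 := by linarith
    obtain ⟨D, hD0, hD⟩ := bdd_indefSum (p := p) h1.le (by linarith : (1 + r) / 2 < r)
    obtain ⟨C, -, hC⟩ := exists_evalCoeff_bound ν h1
    refine ⟨C * D, fun f hf => discNorm_one_le fun n => ?_⟩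
    have h2 := hC (indefSumL p f) _ (hD f _ (bdd_of_isRestricted hf)) n
    rw [mul_assoc, mul_comm D]
    exact h2⟩

theorem evalCoeff_indefSum (ν : Ddag p) (l : ℕ) (f : Adag p) :
    evalCoeff (indefSumDual ν) l f = evalCoeff ν l (indefSumL p f) := rfl

variable {u : ℤ_[p]ˣ} {g : Matrix (Fin 2) (Fin 2) ℤ_[p]}

instance : Neg (Ddag p) := ⟨fun μ => (-1 : Tate p) • μ⟩

instance : AddCommGroup (Ddag p) :=
  { (inferInstance : AddCommMonoid (Ddag p)) with
    neg_add_cancel := fun μ => by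
      refine Ddag.ext_evalCoeff fun f l => ?_
      change evalCoeff ((-1 : Tate p) • μ + μ) l f = 0
      rw [evalCoeff_add, evalCoeff_apply]
      change PowerSeries.coeff l ((-1 : ℚ_[p]⟦X⟧) *
        ((μ : Adag p →ₗ[ℚ_[p]] Tate p) f : ℚ_[p]⟦X⟧)) + _ = 0
      rw [neg_one_mul, map_neg, ← evalCoeff_apply, neg_add_cancel]
    zsmul := zsmulRec }

/-- Distributions of total measure zero are of the form `μ | T - μ`. -/
theorem slashD_indefSum_sub (hp : p ≠ 2) (hu : IsTopGenerator u) (m : ℕ) (hg : IsSigma g)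
    (h00 : g 0 0 = 1) (h01 : g 0 1 = 1) (h10 : g 1 0 = 0) (h11 : g 1 1 = 1) (ν : Ddag p)
    (hν : ∀ l, evalCoeff ν l (monom p 0) = 0) :
    slashD hp hu m hg (indefSumDual ν) - (indefSumDual ν) = ν := by
  rw [sub_eq_iff_eq_add]
  refine Ddag.ext_monom fun j l => ?_
  have hN : mobiusSeries g = PowerSeries.X + 1 := by
    simp [mobiusSeries, linear, h00, h01, h10, h11, add_comm]
  have hT : mobius g (monom p j : ℚ_[p]⟦X⟧) = (PowerSeries.X + 1) ^ j := by
    rw [mobius_eq, coe_monom, substSeries_X_pow, hN]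
  -- Under `T` the monomial `z ^ j` acquires lower terms whose indefinite sum is `z ^ j - 1 / (j +
  -- 1)`; the constant is killed by `ν`, whose total measure vanishes.
  have h1 : mobius g (monom p j : ℚ_[p]⟦X⟧) =
      ((∑ k ∈ Finset.range j, ((j.choose k : ℕ) : ℚ_[p]) • monom p k + monom p j : Adag p) :
        ℚ_[p]⟦X⟧) := by
    rw [hT, add_pow, Finset.sum_range_succ]
    simp only [one_pow, mul_one, Nat.choose_self, Nat.cast_one, Submodule.coe_add, coe_monom,
      AddSubmonoidClass.coe_finsetSum, Submodule.coe_smul, PowerSeries.smul_eq_C_mul, map_natCast,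
      mul_comm _ (Nat.cast _)]
  have h2 : indefSumL p (∑ k ∈ Finset.range j, ((j.choose k : ℕ) : ℚ_[p]) • monom p k) =
      monom p j - ((j + 1 : ℕ) : ℚ_[p])⁻¹ • monom p 0 := by
    apply Subtype.ext
    rw [map_sum, AddSubmonoidClass.coe_finsetSum]
    simp only [map_smul, Submodule.coe_smul, coe_indefSumL_monom, PowerSeries.smul_eq_C_mul,
      Submodule.coe_sub, coe_monom, pow_zero, mul_one]
    exact sum_bernoulliPrimitive j
  rw [evalCoeff_slashD_unipotent hp hu m hg h00 h10 _ _ _ h1, evalCoeff_add, map_add,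
    evalCoeff_indefSum, evalCoeff_indefSum, h2, map_sub, map_smul, hν]
  simp

end Difference


/-! ### Integral matrices over the `p`-adic integers -/

section Integral

variable {p : ℕ} [Fact p.Prime]

theorem toPadic_mul (g h : SL(2, ℤ)) : toPadic (p := p) (g * h) = toPadic g * toPadic h := by
  rw [toPadic, Matrix.SpecialLinearGroup.coe_mul, Matrix.map_mul]
  rfl

theorem toPadic_one : toPadic (p := p) 1 = 1 := by
  rw [toPadic, Matrix.SpecialLinearGroup.coe_one]
  exact Matrix.map_one _ (map_zero _) (map_one _)

theorem toPadic_apply (g : SL(2, ℤ)) (i j : Fin 2) :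
    toPadic (p := p) g i j = ((g : Matrix (Fin 2) (Fin 2) ℤ) i j : ℤ_[p]) := rfl

/-- If `p` divided the whole first column, it would divide the determinant `1`. -/
theorem isSigma_toPadic {g : SL(2, ℤ)} (hg : g ∈ CongruenceSubgroup.Gamma0 p) :
    IsSigma (toPadic (p := p) g) := by
  have hc : (p : ℤ_[p]) ∣ toPadic g 1 0 := by
    rw [dvd_iff_toZMod, toPadic_apply, map_intCast]
    exact CongruenceSubgroup.Gamma0_mem.mp hg
  refine ⟨?_, hc⟩
  have hdet : toPadic (p := p) g 0 0 * toPadic g 1 1 - toPadic g 0 1 * toPadic g 1 0 = 1 := by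
    simp only [toPadic_apply]
    have := g.det_coe
    rw [Matrix.det_fin_two] at this
    exact_mod_cast this
  by_contra hu
  have h1 : (p : ℤ_[p]) ∣ toPadic g 0 0 := by
    rwa [← PadicInt.norm_lt_one_iff_dvd, ← PadicInt.not_isUnit_iff]
  have h2 : (p : ℤ_[p]) ∣ 1 := by
    rw [← hdet]
    exact dvd_sub (h1.mul_right _) (hc.mul_left _)
  exact PadicInt.prime_p.not_dvd_one h2

end Integral

/-! ### The denominator `h` -/

section Denominator

variable {p : ℕ} [Fact p.Prime] {u : ℤ_[p]ˣ} {a c : ℤ_[p]}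

theorem coeff_coeff_autFactor_zero (u : ℤ_[p]ˣ) (m : ℕ) (a c : ℤ_[p]) (i : ℕ) :
    PowerSeries.coeff 0 (PowerSeries.coeff i (autFactor u m a c)) =
      if i = 0 then (teich a : ℚ_[p]) ^ m else 0 := by
  rw [coeff_coeff_autFactor, autCoeff, binom_zero, mul_one, pow_zero, mul_one, PowerSeries.coeff_C]

theorem norm_pow_teich_sub_one {m : ℕ} (h : PadicInt.toZMod a ^ m ≠ 1) :
    ‖(teich a : ℚ_[p]) ^ m - 1‖ = 1 := by
  have h1 : ¬ (p : ℤ_[p]) ∣ teich a ^ m - 1 := by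
    have h2 := dvd_teich_sub a
    rw [dvd_iff_toZMod, map_sub, sub_eq_zero] at h2
    rw [dvd_iff_toZMod, map_sub, map_pow, map_one, h2, sub_eq_zero]
    exact h
  rw [← PadicInt.norm_lt_one_iff_dvd, not_lt] at h1
  have h3 := le_antisymm (PadicInt.norm_le_one _) h1
  rw [PadicInt.norm_def] at h3
  exact_mod_cast h3

/-- The constant term in `w` is the unit `ω(a) ^ m - 1`, and the series is bounded by `1` at radius
`√p > 1`, so `Bdd.inv` puts its inverse in the Tate algebra. -/
theorem constantCoeff_autFactor_sub_one (hp : p ≠ 2) (hu : IsTopGenerator u) (m : ℕ)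
    (ha : IsUnit a) (hc : (p : ℤ_[p]) ∣ c) (hm : PadicInt.toZMod a ^ m ≠ 1) :
    PowerSeries.constantCoeff (autFactor u m a c) - 1 ≠ 0 ∧ ∀ g ∈ Tate p, ∃ q : Tate p,
      (q : ℚ_[p]⟦X⟧) * (PowerSeries.constantCoeff (autFactor u m a c) - 1) = g := by
  set h := PowerSeries.constantCoeff (autFactor u m a c) - 1 with hh
  have h0 : ‖PowerSeries.constantCoeff h‖ = 1 := by
    rw [hh, map_sub, map_one, ← PowerSeries.coeff_zero_eq_constantCoeff_apply,
      ← PowerSeries.coeff_zero_eq_constantCoeff_apply, coeff_coeff_autFactor_zero, if_pos rfl]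
    exact norm_pow_teich_sub_one hm
  have hne : PowerSeries.constantCoeff h ≠ 0 := by
    rw [← norm_pos_iff, h0]
    exact one_pos
  have hs : 0 < √(p : ℝ) := zero_lt_one.trans one_lt_sqrt
  have hb : Bdd √(p : ℝ) 1 h := by
    refine Bdd.sub hs.le (fun n => ?_) Bdd.one
    rw [← PowerSeries.coeff_zero_eq_constantCoeff_apply, coeff_coeff_autFactor]
    have h1 := (bdd_autCoeff (m := m) hp hu ha hc le_rfl one_lt_sqrt.le n).coeff_le le_rfl 0
    calc _ ≤ (1 / √(p : ℝ)) ^ n * √(p : ℝ) ^ n := by gcongr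
      _ = 1 := by rw [← mul_pow, one_div, inv_mul_cancel₀ hs.ne', one_pow]
  refine ⟨fun h1 => hne (by rw [h1, map_zero]), fun g hg => ?_⟩
  refine ⟨⟨g * h⁻¹, (Tate p).mul_mem hg ((hb.inv hs.le h0).mem_Tate one_lt_sqrt)⟩, ?_⟩
  change g * h⁻¹ * h = g
  rw [mul_assoc, PowerSeries.inv_mul_cancel _ hne, mul_one]

/-- By the product rule all factors have the same derivative, so the linear coefficient of `L` comes
out and leaves an integral cofactor. -/
theorem coeff_one_prod (L : ℚ_[p]⟦X⟧) (hL : ‖PowerSeries.coeff 0 L‖ ≤ 1) (n : ℕ) :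
    ‖PowerSeries.coeff 0 (∏ k ∈ Finset.range n, (L - (k : ℚ_[p]⟦X⟧)))‖ ≤ 1 ∧
    ∃ e : ℚ_[p], ‖e‖ ≤ 1 ∧ PowerSeries.coeff 1 (∏ k ∈ Finset.range n, (L - (k : ℚ_[p]⟦X⟧))) =
      PowerSeries.coeff 1 L * e := by
  induction n with
  | zero => exact ⟨by simp, 0, by simp, by simp [PowerSeries.coeff_one]⟩
  | succ n ih =>
    obtain ⟨h0, e, he, h1⟩ := ih
    have hn0 : PowerSeries.coeff 0 (L - (n : ℚ_[p]⟦X⟧)) = PowerSeries.coeff 0 L - (n : ℚ_[p]) := by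
      rw [map_sub, ← map_natCast (PowerSeries.C (R := ℚ_[p])), PowerSeries.coeff_zero_C]
    have hn1 : PowerSeries.coeff 1 (L - (n : ℚ_[p]⟦X⟧)) = PowerSeries.coeff 1 L := by
      rw [map_sub, ← map_natCast (PowerSeries.C (R := ℚ_[p])), PowerSeries.coeff_C]
      simp
    have hl : ‖PowerSeries.coeff 0 L - (n : ℚ_[p])‖ ≤ 1 := by
      rw [sub_eq_add_neg]
      refine (IsUltrametricDist.norm_add_le_max _ _).trans (max_le hL ?_)
      rw [norm_neg]
      exact_mod_cast Padic.norm_int_le_one (p := p) n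
    have hmul : ∀ F G : ℚ_[p]⟦X⟧, PowerSeries.coeff 1 (F * G) =
        PowerSeries.coeff 0 F * PowerSeries.coeff 1 G +
          PowerSeries.coeff 1 F * PowerSeries.coeff 0 G := fun F G => by
      rw [PowerSeries.coeff_mul, Finset.Nat.antidiagonal_succ]
      simp
    rw [Finset.prod_range_succ]
    refine ⟨?_, PowerSeries.coeff 0 (∏ k ∈ Finset.range n, (L - (k : ℚ_[p]⟦X⟧))) +
      e * (PowerSeries.coeff 0 L - (n : ℚ_[p])), ?_, ?_⟩
    · rw [PowerSeries.coeff_zero_eq_constantCoeff_apply, map_mul,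
        ← PowerSeries.coeff_zero_eq_constantCoeff_apply,
        ← PowerSeries.coeff_zero_eq_constantCoeff_apply, hn0, norm_mul]
      exact mul_le_one₀ h0 (norm_nonneg _) hl
    · refine (IsUltrametricDist.norm_add_le_max _ _).trans (max_le h0 ?_)
      rw [norm_mul]
      exact mul_le_one₀ he (norm_nonneg _) hl
    · rw [hmul, hn0, hn1, h1]
      ring

/-- By `coeff_one_logSeries` the coefficient is `c / a` divided by `log u`. -/
theorem coeff_one_logFactor_ne_zero (hp : p ≠ 2) (hu : IsTopGenerator u)
    (ha : IsUnit a) (hc : (p : ℤ_[p]) ∣ c) (hc0 : c ≠ 0) :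
    PowerSeries.coeff 1 (logFactor u a c) ≠ 0 := by
  have hlog : padicLog ((u : ℤ_[p]) : ℚ_[p]) ≠ 0 := by
    rw [← norm_pos_iff, norm_padicLog hp hu.norm_sub_one]
    exact inv_pos.mpr (by exact_mod_cast (Fact.out : p.Prime).pos)
  have ha0 : (a : ℚ_[p]) ≠ 0 := by
    rw [← norm_pos_iff, norm_unit ha]
    exact one_pos
  have hF0 : PowerSeries.constantCoeff (unitFactor a c) = (teich a : ℚ_[p])⁻¹ * a := by
    rw [unitFactor, map_mul, constantCoeff_linear, PowerSeries.constantCoeff_C]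
  have hF1 : PowerSeries.coeff 1 (unitFactor a c) = (teich a : ℚ_[p])⁻¹ * c := by
    rw [unitFactor, PowerSeries.coeff_C_mul, coeff_one_linear]
  have ht := inv_ne_zero (teich_ne_zero ha)
  rw [logFactor_eq, PowerSeries.coeff_C_mul, coeff_one_logSeries hp one_pos
    (bdd_unitFactor ha hc le_rfl) (unitFactor_bound_lt one_lt_sqrt)
    (by rw [hF0]; exact mul_ne_zero ht ha0), hF0, hF1]
  exact mul_ne_zero (inv_ne_zero hlog) (div_ne_zero (mul_ne_zero ht (fun h => hc0 (Subtype.ext h)))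
    (mul_ne_zero ht ha0))

/-- The term `w ^ 0` of the automorphy factor is constant in `z`, which gives the factor `w`. Taking
out `p` and the linear coefficient of `logFactor` leaves a series starting with `1`, because `ω(a) ^
m = 1`. -/
theorem coeff_one_autFactor_eq (hp : p ≠ 2) (hu : IsTopGenerator u) {m : ℕ} (hm : p - 1 ∣ m)
    (ha : IsUnit a) (hc : (p : ℤ_[p]) ∣ c) (hc0 : c ≠ 0) :
    ∃ (b : ℚ_[p]) (y : ℚ_[p]⟦X⟧), b ≠ 0 ∧ PowerSeries.constantCoeff y = 1 ∧ Bdd √(p : ℝ) 1 y ∧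
      PowerSeries.coeff 1 (autFactor u m a c) = PowerSeries.C b * (PowerSeries.X * y) := by
  have hL1 := coeff_one_logFactor_ne_zero hp hu ha hc hc0
  have hL0 := (bdd_logFactor hp hu ha hc le_rfl one_lt_sqrt.le).coeff_le le_rfl 0
  have hpp : (p : ℚ_[p]) ≠ 0 := by exact_mod_cast (Fact.out : p.Prime).ne_zero
  have hs : 1 < √(p : ℝ) := one_lt_sqrt
  set L := logFactor u a c with hL
  choose e he1 he using fun n => (coeff_one_prod L hL0 n).2
  have hteich : (teich a : ℚ_[p]) ^ m = 1 := by
    obtain ⟨k, rfl⟩ := hm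
    have := teich_pow_sub_one ha
    rw [pow_mul, ← PadicInt.coe_pow, this, PadicInt.coe_one, one_pow]
  have e0 : e 0 = 0 := by
    have := he 0
    simpa [PowerSeries.coeff_one, hL1] using this.symm
  have e1 : e 1 = 1 := by
    have := he 1
    simpa [hL1] using this.symm
  refine ⟨(p : ℚ_[p]) * PowerSeries.coeff 1 L, PowerSeries.mk fun n =>
    (p : ℚ_[p]) ^ n * (((n + 1).factorial : ℚ_[p])⁻¹) * e (n + 1), mul_ne_zero hpp hL1, ?_, ?_, ?_⟩
  · rw [← PowerSeries.coeff_zero_eq_constantCoeff_apply, PowerSeries.coeff_mk]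
    simp [e1]
  · intro n
    rw [PowerSeries.coeff_mk, norm_mul, norm_mul, norm_pow, norm_p_eq]
    -- The exponent `n - 1` instead of `n` in this bound matters here: the factorial is one step
    -- ahead of the power of `p`.
    have h1 := norm_inv_factorial_le hp (n + 1)
    rw [Nat.add_sub_cancel] at h1
    have hs0 : 0 < √(p : ℝ) := by linarith
    calc _ ≤ ((√(p : ℝ))⁻¹ ^ 2) ^ n * √(p : ℝ) ^ n * 1 * √(p : ℝ) ^ n := by
          gcongr
          exact he1 _
      _ = 1 := by
        rw [mul_one, ← mul_pow, ← mul_pow]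
        field_simp
        simp
  · ext n
    rw [coeff_coeff_autFactor, autCoeff, hteich, one_mul, PowerSeries.coeff_C_mul, binom,
      PowerSeries.coeff_C_mul, ← hL, he, PowerSeries.coeff_C_mul]
    rcases n with _ | n
    · simp [e0]
    · rw [mul_comm PowerSeries.X, PowerSeries.coeff_succ_mul_X, PowerSeries.coeff_mk]
      ring

theorem divX_mem_Tate {g : ℚ_[p]⟦X⟧} (hg : g ∈ Tate p) :
    (PowerSeries.mk fun n => PowerSeries.coeff (n + 1) g) ∈ Tate p := by
  change PowerSeries.IsRestricted 1 _
  change PowerSeries.IsRestricted 1 g at hg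
  rw [PowerSeries.isRestricted_iff'] at hg ⊢
  simpa [Function.comp_def] using hg.comp (Filter.tendsto_add_atTop_nat 1)

/-- Apart from the factor `w`, everything in `coeff_one_autFactor_eq` is invertible in the Tate
algebra, so vanishing at `w = 0` suffices for divisibility. -/
theorem coeff_one_autFactor (hp : p ≠ 2) (hu : IsTopGenerator u) {m : ℕ} (hm : p - 1 ∣ m)
    (ha : IsUnit a) (hc : (p : ℤ_[p]) ∣ c) (hc0 : c ≠ 0) :
    PowerSeries.coeff 1 (autFactor u m a c) ≠ 0 ∧
    ∀ g ∈ Tate p, PowerSeries.constantCoeff g = 0 → ∃ q : Tate p,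
      (q : ℚ_[p]⟦X⟧) * PowerSeries.coeff 1 (autFactor u m a c) = g := by
  obtain ⟨b, y, hb, hy0, hy, h⟩ := coeff_one_autFactor_eq hp hu hm ha hc hc0
  have hyne : PowerSeries.constantCoeff y ≠ 0 := by rw [hy0]; exact one_ne_zero
  have hs : 0 < √(p : ℝ) := zero_lt_one.trans one_lt_sqrt
  rw [h]
  constructor
  · refine mul_ne_zero ((map_ne_zero_iff _ PowerSeries.C_injective).mpr hb)
      (mul_ne_zero PowerSeries.X_ne_zero fun h1 => hyne (by rw [h1, map_zero]))
  · intro g hg hg0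
    set g' : ℚ_[p]⟦X⟧ := PowerSeries.mk fun n => PowerSeries.coeff (n + 1) g with hg'
    have hgX : g = PowerSeries.X * g' := by
      ext n
      rcases n with _ | n
      · simpa using hg0
      · rw [mul_comm, PowerSeries.coeff_succ_mul_X, hg', PowerSeries.coeff_mk]
    refine ⟨⟨PowerSeries.C b⁻¹ * g' * y⁻¹, (Tate p).mul_mem ((Tate p).mul_mem
      ((Tate p).algebraMap_mem b⁻¹) (divX_mem_Tate hg))
      ((hy.inv hs.le (by rw [hy0, norm_one])).mem_Tate one_lt_sqrt)⟩, ?_⟩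
    change PowerSeries.C b⁻¹ * g' * y⁻¹ * (PowerSeries.C b * (PowerSeries.X * y)) = g
    calc _ = PowerSeries.C (b⁻¹ * b) * (PowerSeries.X * g') * (y⁻¹ * y) := by rw [map_mul]; ring
      _ = g := by rw [inv_mul_cancel₀ hb, PowerSeries.inv_mul_cancel _ hyne, map_one, one_mul,
        mul_one, hgX]

end Denominator

/-! ### The total measure -/

section TotalMeasure

variable {p : ℕ} [Fact p.Prime] {u : ℤ_[p]ˣ}

theorem evalCoeff_smul_momentDist (q : Tate p) (k l : ℕ) (f : Adag p) :
    evalCoeff (q • momentDist p k) l f =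
      PowerSeries.coeff l (q : ℚ_[p]⟦X⟧) * PowerSeries.coeff k (f : ℚ_[p]⟦X⟧) := by
  rw [evalCoeff_apply]
  change PowerSeries.coeff l ((q : ℚ_[p]⟦X⟧) * PowerSeries.C (PowerSeries.coeff k (f : ℚ_[p]⟦X⟧))) = _
  rw [PowerSeries.coeff_mul_C]

theorem coe_twist_monom_zero (hp : p ≠ 2) (hu : IsTopGenerator u) (m : ℕ)
    {g : Matrix (Fin 2) (Fin 2) ℤ_[p]} (hg : IsSigma g) (k : ℕ) :
    (twist hp hu m hg k (monom p 0) : ℚ_[p]⟦X⟧) = autCoeff u m (g 0 0) (g 1 0) k := by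
  rw [coe_twist, coe_monom, pow_zero, mobius_eq, substSeries_one, mul_one]

theorem slash_smul_momentDist (hp : p ≠ 2) (hu : IsTopGenerator u) (m : ℕ)
    {g : Matrix (Fin 2) (Fin 2) ℤ_[p]} (hg : IsSigma g) (q : Tate p) (k : ℕ) :
    slash u m (q • momentDist p k) g (monom p 0) =
      (q : ℚ_[p]⟦X⟧) * PowerSeries.coeff k (autFactor u m (g 0 0) (g 1 0)) := by
  ext n
  rw [coeff_slash hp hu m _ hg, PowerSeries.coeff_mul, ← Finset.Nat.sum_antidiagonal_swap]
  refine Finset.sum_congr rfl fun x _ => ?_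
  rw [evalCoeff_smul_momentDist, coe_twist_monom_zero, coeff_coeff_autFactor, Prod.snd_swap,
    Prod.fst_swap]

theorem coe_smul_momentDist_monom_zero (q : Tate p) (k : ℕ) :
    (((q • momentDist p k : Ddag p) : Adag p →ₗ[ℚ_[p]] Tate p) (monom p 0) : ℚ_[p]⟦X⟧) =
      (q : ℚ_[p]⟦X⟧) * PowerSeries.C (if k = 0 then 1 else 0) := by
  ext n
  rw [← evalCoeff_apply, evalCoeff_smul_momentDist, PowerSeries.coeff_mul_C, coe_monom, pow_zero,
    PowerSeries.coeff_one]

theorem slash_add (hp : p ≠ 2) (hu : IsTopGenerator u) (m : ℕ)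
    {g : Matrix (Fin 2) (Fin 2) ℤ_[p]} (hg : IsSigma g) (μ ν : Ddag p) (f : Adag p) :
    slash u m (μ + ν) g f = slash u m μ g f + slash u m ν g f := by
  rw [← slashD_apply hp hu m hg, ← slashD_apply hp hu m hg, ← slashD_apply hp hu m hg, map_add]
  rfl

variable {t : ℕ} {γ : Fin t → SL(2, ℤ)}

/-- Only the `i`-th summand changes. There `μ_k` picks the coefficient of `z ^ k` in the automorphy
factor, and its own total measure is `1` or `0` according to whether `k = 0`. -/
theorem totalMeasure_update (hp : p ≠ 2) (hu : IsTopGenerator u) (m : ℕ)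
    (hγ : ∀ j, γ j ∈ CongruenceSubgroup.Gamma0 p) (v : Fin t → Ddag p) (i : Fin t) (q : Tate p)
    (k : ℕ) : totalMeasure u m γ (Function.update v i (v i + q • momentDist p k)) =
      totalMeasure u m γ v + (q : ℚ_[p]⟦X⟧) * (PowerSeries.coeff k (autFactor u m
        (toPadic (γ i) 0 0) (toPadic (γ i) 1 0)) - PowerSeries.C (if k = 0 then 1 else 0)) := by
  rw [totalMeasure, totalMeasure, ← Finset.add_sum_erase _ _ (Finset.mem_univ i),
    ← Finset.add_sum_erase (Finset.univ) _ (Finset.mem_univ i), Function.update_self,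
    Finset.sum_congr rfl fun j hj => by
      rw [Function.update_of_ne (Finset.ne_of_mem_erase hj)],
    slash_add hp hu m (isSigma_toPadic (hγ i)),
    slash_smul_momentDist hp hu m (isSigma_toPadic (hγ i)), mul_sub,
    ← coe_smul_momentDist_monom_zero q k]
  simp only [Submodule.coe_add, LinearMap.add_apply, Subalgebra.coe_add]
  ring

theorem totalMeasure_mem_Tate (hp : p ≠ 2) (hu : IsTopGenerator u) (m : ℕ)
    (hγ : ∀ j, γ j ∈ CongruenceSubgroup.Gamma0 p) (v : Fin t → Ddag p) :
    totalMeasure u m γ v ∈ Tate p :=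
  (Tate p).sum_mem fun j _ => (Tate p).sub_mem
    (slash_mem_Tate hp hu m (v j) (isSigma_toPadic (hγ j)) _) (SetLike.coe_mem _)

/-- At `w = 0` the automorphy factor reduces to `ω(a) ^ m = 1`, so `μ | γ` and `μ` agree there on
the constant function. -/
theorem constantCoeff_totalMeasure (hp : p ≠ 2) (hu : IsTopGenerator u) {m : ℕ} (hm : p - 1 ∣ m)
    (hγ : ∀ j, γ j ∈ CongruenceSubgroup.Gamma0 p) (v : Fin t → Ddag p) :
    PowerSeries.constantCoeff (totalMeasure u m γ v) = 0 := by
  rw [totalMeasure, map_sum]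
  refine Finset.sum_eq_zero fun j _ => ?_
  have hσ := isSigma_toPadic (hγ j)
  have hteich : (teich (toPadic (p := p) (γ j) 0 0) : ℚ_[p]) ^ m = 1 := by
    obtain ⟨k, rfl⟩ := hm
    rw [pow_mul, ← PadicInt.coe_pow, teich_pow_sub_one hσ.1, PadicInt.coe_one, one_pow]
  have h1 : twist hp hu m hσ 0 (monom p 0) = monom p 0 := by
    apply Subtype.ext
    rw [coe_twist_monom_zero, autCoeff, binom_zero, hteich, coe_monom]
    simp
  rw [← PowerSeries.coeff_zero_eq_constantCoeff_apply, map_sub, coeff_slash hp hu m _ hσ,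
    Finset.Nat.antidiagonal_zero, Finset.sum_singleton, h1, evalCoeff_apply, sub_self]

end TotalMeasure


/-! ### Pointwise operations on endomorphisms. -/

section Endomorphisms

variable {A : Type*} [AddCommGroup A] (f g : AddMonoid.End A) (a : A)

theorem end_add_apply : (f + g) a = f a + g a := rfl

theorem end_sub_apply : (f - g) a = f a - g a := rfl

theorem end_neg_apply : (-f) a = -f a := rfl

theorem end_mul_apply : (f * g) a = f (g a) := rfl

theorem end_one_apply : (1 : AddMonoid.End A) a = a := rfl

theorem end_zero_apply : (0 : AddMonoid.End A) a = 0 := rfl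

end Endomorphisms

/-! ### Modular symbols from solutions of the Manin relations -/

section Symbols

variable {Γ : Subgroup SL(2, ℤ)} {hT : ModularGroup.T ∈ Γ} {t : ℕ} {γ : Fin t → Γ}
  {D : Fin t → DivZero}

/-- Values on the generators that satisfy the Manin relation extend to an equivariant
homomorphism. -/
theorem SolvesManinRelations.exists_hom (hD : SolvesManinRelations Γ hT γ D) {A : Type*}
    [AddCommGroup A] (ρ : Γ →* AddMonoid.End A) (w : A) (v : Fin t → A)
    (hw : ρ (⟨ModularGroup.T, hT⟩ : Γ)⁻¹ w - w = ∑ j, (ρ (γ j)⁻¹ (v j) - v j)) :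
    ∃ Φ : DivZero →+ A, (∀ (g : Γ) (E : DivZero), Φ (divAct g E) = ρ g (Φ E)) ∧
      ∀ j, Φ (D j) = v j := by
  classical
  set R : MonoidAlgebra ℤ Γ →ₐ[ℤ] AddMonoid.End A := MonoidAlgebra.lift ℤ (AddMonoid.End A) Γ ρ
    with hR
  have hRs : ∀ g : Γ, R (MonoidAlgebra.single g 1) = ρ g := fun g => by
    rw [hR, MonoidAlgebra.lift_single, one_smul]
  -- `ψ` presents the divisors and `Ψ` is the candidate on the same coefficients. By `only_relation`
  -- and `hw` the kernel of `ψ` lies in that of `Ψ`, so arbitrary chosen coefficients define the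
  -- homomorphism.
  set Ψ : MonoidAlgebra ℤ Γ → (Fin t → MonoidAlgebra ℤ Γ) → A :=
    fun x y => R x w + ∑ j, R (y j) (v j) with hΨ
  set ψ : MonoidAlgebra ℤ Γ → (Fin t → MonoidAlgebra ℤ Γ) → DivZero :=
    fun x y => ringAct Γ x divInfty + ∑ j, ringAct Γ (y j) (D j) with hψ
  have hΨsub : ∀ x x' y y', Ψ (x - x') (y - y') = Ψ x y - Ψ x' y' := fun x x' y y' => by
    simp only [hΨ, map_sub, Pi.sub_apply, end_sub_apply, Finset.sum_sub_distrib]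
    abel
  have hψsub : ∀ x x' y y', ψ (x - x') (y - y') = ψ x y - ψ x' y' := fun x x' y y' => by
    simp only [hψ, map_sub, Pi.sub_apply, end_sub_apply, Finset.sum_sub_distrib]
    abel
  have hΨadd : ∀ x x' y y', Ψ (x + x') (y + y') = Ψ x y + Ψ x' y' := fun x x' y y' => by
    simp only [hΨ, map_add, Pi.add_apply, end_add_apply, Finset.sum_add_distrib]
    abel
  have hψadd : ∀ x x' y y', ψ (x + x') (y + y') = ψ x y + ψ x' y' := fun x x' y y' => by
    simp only [hψ, map_add, Pi.add_apply, end_add_apply, Finset.sum_add_distrib]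
    abel
  have hΨmul : ∀ s x y, Ψ (s * x) (fun j => s * y j) = R s (Ψ x y) := fun s x y => by
    simp only [hΨ, map_mul, map_add, map_sum, end_mul_apply]
  have hψmul : ∀ s x y, ψ (s * x) (fun j => s * y j) = ringAct Γ s (ψ x y) := fun s x y => by
    simp only [hψ, map_mul, map_add, map_sum, end_mul_apply]
  have hker : ∀ x y, ψ x y = 0 → Ψ x y = 0 := fun x y h => by
    obtain ⟨s, hx, hy⟩ := hD.only_relation x y h
    have hy' : y = fun j => s * (-(MonoidAlgebra.single (γ j)⁻¹ 1 - 1)) := by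
      funext j
      rw [hy, mul_neg]
    rw [hx, hy', hΨmul]
    have h0 : Ψ (MonoidAlgebra.single (⟨ModularGroup.T, hT⟩ : Γ)⁻¹ 1 - 1)
        (fun j => -(MonoidAlgebra.single (γ j)⁻¹ 1 - 1)) = 0 := by
      simp only [hΨ, map_sub, map_neg, map_one, hRs, end_sub_apply, end_neg_apply,
        end_one_apply, Finset.sum_neg_distrib]
      rw [hw, add_neg_cancel]
    rw [h0, map_zero]
  have hwell : ∀ x x' y y', ψ x y = ψ x' y' → Ψ x y = Ψ x' y' := fun x x' y y' h => by
    rw [← sub_eq_zero, ← hΨsub]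
    exact hker _ _ (by rw [hψsub, h, sub_self])
  choose X Y hXY using hD.generate
  have hval : ∀ x y E, E = ψ x y → Ψ (X E) (Y E) = Ψ x y := fun x y E h =>
    hwell _ _ _ _ ((hXY E).symm.trans h)
  refine ⟨AddMonoidHom.mk' (fun E => Ψ (X E) (Y E)) fun E E' => ?_, fun g E => ?_, fun j => ?_⟩
  · rw [← hΨadd]
    exact hval _ _ _ (by rw [hψadd]; exact congrArg₂ (· + ·) (hXY E) (hXY E'))
  · rw [AddMonoidHom.mk'_apply, ← hRs, ← hΨmul]
    refine hval _ _ _ ?_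
    rw [hψmul, ringAct_single, one_smul]
    exact congrArg (divAct (g : SL(2, ℤ))) (hXY E)
  · rw [AddMonoidHom.mk'_apply, hval 0 (Pi.single j 1)]
    · simp only [hΨ, map_zero, end_zero_apply, zero_add]
      rw [Finset.sum_eq_single j (fun k _ hk => by simp [Pi.single_eq_of_ne hk]) (by simp)]
      simp
    · simp only [hψ, map_zero, end_zero_apply, zero_add]
      rw [Finset.sum_eq_single j (fun k _ hk => by simp [Pi.single_eq_of_ne hk]) (by simp)]
      simp

variable {p : ℕ} [Fact p.Prime] {u : ℤ_[p]ˣ}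

theorem slashD_congr (hp : p ≠ 2) (hu : IsTopGenerator u) (m : ℕ)
    {g h : Matrix (Fin 2) (Fin 2) ℤ_[p]} (hg : IsSigma g) (hh : IsSigma h) (e : g = h)
    (μ : Ddag p) : slashD hp hu m hg μ = slashD hp hu m hh μ := by
  subst e
  rfl

theorem isSigma_toPadic_inv (hΓ : Γ ≤ CongruenceSubgroup.Gamma0 p) (g : Γ) :
    IsSigma (toPadic (p := p) (g : SL(2, ℤ))⁻¹) :=
  isSigma_toPadic (inv_mem (hΓ g.2))

/-- The left action `μ ↦ μ | g⁻¹` of `Γ` on distributions. -/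
def distAct (hp : p ≠ 2) (hu : IsTopGenerator u) (m : ℕ) (hΓ : Γ ≤ CongruenceSubgroup.Gamma0 p) :
    Γ →* AddMonoid.End (Ddag p) where
  toFun g := slashD hp hu m (isSigma_toPadic_inv hΓ g)
  map_one' := by
    ext μ : 1
    refine (slashD_congr hp hu m _ isSigma_one ?_ μ).trans (slashD_one hp hu m μ)
    rw [OneMemClass.coe_one, inv_one, toPadic_one]
  map_mul' g h := by
    ext μ : 1
    refine (slashD_congr hp hu m _ ((isSigma_toPadic_inv hΓ h).mul (isSigma_toPadic_inv hΓ g)) ?_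
      μ).trans (slashD_mul hp hu m (isSigma_toPadic_inv hΓ h) (isSigma_toPadic_inv hΓ g) μ)
    rw [Subgroup.coe_mul, mul_inv_rev, toPadic_mul]

theorem distAct_apply (hp : p ≠ 2) (hu : IsTopGenerator u) (m : ℕ)
    (hΓ : Γ ≤ CongruenceSubgroup.Gamma0 p) (g : Γ) (μ : Ddag p) :
    distAct hp hu m hΓ g μ = slashD hp hu m (isSigma_toPadic_inv hΓ g) μ := rfl

theorem distAct_inv_apply (hp : p ≠ 2) (hu : IsTopGenerator u) (m : ℕ)
    (hΓ : Γ ≤ CongruenceSubgroup.Gamma0 p) (g : Γ) (μ : Ddag p) :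
    distAct hp hu m hΓ g⁻¹ μ = slashD hp hu m (isSigma_toPadic (hΓ g.2)) μ := by
  rw [distAct_apply]
  exact slashD_congr hp hu m _ _ (by rw [Subgroup.coe_inv, inv_inv]) μ

theorem evalCoeff_sub (μ ν : Ddag p) (l : ℕ) (f : Adag p) :
    evalCoeff (μ - ν) l f = evalCoeff μ l f - evalCoeff ν l f := by
  rw [eq_sub_iff_add_eq, ← evalCoeff_add, sub_add_cancel]

theorem evalCoeff_sum {ι : Type*} (s : Finset ι) (μ : ι → Ddag p) (l : ℕ) (f : Adag p) :
    evalCoeff (∑ i ∈ s, μ i) l f = ∑ i ∈ s, evalCoeff (μ i) l f := by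
  classical
  induction s using Finset.induction_on with
  | empty => simp [evalCoeff_apply]
  | insert a s ha ih => rw [Finset.sum_insert ha, Finset.sum_insert ha, evalCoeff_add, ih]

/-- Values of total measure zero extend to modular symbols. -/
theorem isAdjusted_of_totalMeasure (hp : p ≠ 2) (hu : IsTopGenerator u) (m : ℕ)
    (hΓ : Γ ≤ CongruenceSubgroup.Gamma0 p) (v : Fin t → Ddag p)
    (hv : totalMeasure u m (fun j => (γ j : SL(2, ℤ))) v = 0) :
    IsAdjusted u m Γ hT γ v := by
  refine ⟨hv, fun D hD => ?_⟩
  set ρ := distAct hp hu m hΓ with hρ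
  set ν : Ddag p := ∑ j, (ρ (γ j)⁻¹ (v j) - v j) with hν
  have hν0 : ∀ l, evalCoeff ν l (monom p 0) = 0 := fun l => by
    have h1 := congrArg (PowerSeries.coeff l) hv
    rw [totalMeasure, map_sum, map_zero] at h1
    rw [hν, evalCoeff_sum, ← h1]
    refine Finset.sum_congr rfl fun j _ => ?_
    rw [evalCoeff_sub, hρ, distAct_inv_apply, map_sub, ← slashD_apply hp hu m
      (isSigma_toPadic (hΓ (γ j).2)), evalCoeff_apply, evalCoeff_apply]
  -- The value assigned to `{0} - {∞}` is the solution of the difference equation, available since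
  -- `ν` has total measure zero.
  have hw : ρ (⟨ModularGroup.T, hT⟩ : Γ)⁻¹ (indefSumDual ν) - indefSumDual ν = ν := by
    rw [hρ, distAct_inv_apply]
    apply slashD_indefSum_sub hp hu m _ _ _ _ _ ν hν0 <;>
    simp [toPadic_apply, ModularGroup.coe_T]
  obtain ⟨Φ, h1, h2⟩ := hD.exists_hom ρ (indefSumDual ν) v hw
  refine ⟨Φ, fun g hg E f => ?_, h2⟩
  rw [h1 ⟨g, hg⟩ E, hρ, distAct_apply, slashD_apply]

theorem isUnit_and_dvd_of_mem_Gamma0 {g : SL(2, ℤ)} (hg : g ∈ CongruenceSubgroup.Gamma0 p) {a c : ℤ}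
    (ha : a = g 0 0) (hc : c = g 1 0) : IsUnit (a : ℤ_[p]) ∧ (p : ℤ_[p]) ∣ (c : ℤ_[p]) := by
  subst ha hc
  exact isSigma_toPadic hg

end Symbols

end HidaFamilies

end

theorem mainTheorem11 (p : ℕ) [Fact p.Prime] (hp : p ≠ 2)
    (u : ℤ_[p]ˣ) (hu : HidaFamilies.IsTopGenerator u) (m : ℕ)
    (Γ Γ₀ : Subgroup SL(2, ℤ)) (hΓ : CongruenceSubgroup.IsCongruenceSubgroup Γ)
    (hΓ₀ : Γ₀ = Γ ⊓ CongruenceSubgroup.Gamma0 p)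
    (htors : ∀ g ∈ Γ₀, IsOfFinOrder g → g = 1)
    (hT : ModularGroup.T ∈ Γ₀) :
    (∃ (t : ℕ) (γ : Fin t → Γ₀) (D : Fin t → HidaFamilies.DivZero),
      HidaFamilies.SolvesManinRelations Γ₀ hT γ D ∧ ∀ j, (γ j : SL(2, ℤ)) 1 0 ≠ 0) ∧
    ∀ (t : ℕ) (γ : Fin t → Γ₀) (v' : Fin t → HidaFamilies.Ddag p) (i : Fin t)
      (a c : ℤ) (_ : a = (γ i : SL(2, ℤ)) 0 0) (_ : c = (γ i : SL(2, ℤ)) 1 0)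
      (K : ℚ_[p]⟦X⟧⟦X⟧) (_ : K = HidaFamilies.autFactor u m (a : ℤ_[p]) (c : ℤ_[p]))
      (g : ℚ_[p]⟦X⟧)
      (_ : g = -HidaFamilies.totalMeasure u m (fun j => (γ j : SL(2, ℤ))) v'),
      (p - 1 ∣ m → c ≠ 0 →
        PowerSeries.constantCoeff (PowerSeries.derivative _ K) ≠ 0 ∧
        ∃ q : HidaFamilies.Tate p,
          (q : ℚ_[p]⟦X⟧) * PowerSeries.constantCoeff (PowerSeries.derivative _ K) = g ∧
          HidaFamilies.IsAdjusted u m Γ₀ hT γ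
            (Function.update v' i (v' i + q • HidaFamilies.momentDist p 1))) ∧
      (¬ p - 1 ∣ m → (a : ZMod p) ^ m ≠ 1 →
        PowerSeries.constantCoeff K - 1 ≠ 0 ∧
        ∃ q : HidaFamilies.Tate p,
          (q : ℚ_[p]⟦X⟧) * (PowerSeries.constantCoeff K - 1) = g ∧
          HidaFamilies.IsAdjusted u m Γ₀ hT γ
            (Function.update v' i (v' i + q • HidaFamilies.momentDist p 0))) := by
  have hle : Γ₀ ≤ CongruenceSubgroup.Gamma0 p := hΓ₀ ▸ inf_le_right
  have : NeZero p := ⟨(Fact.out : p.Prime).ne_zero⟩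
  have := hΓ.finiteIndex
  have : Γ₀.FiniteIndex := by
    rw [hΓ₀]
    infer_instance
  refine ⟨HidaFamilies.exists_solvesManinRelations htors hT, ?_⟩
  intro t γ v' i a c ha hc K hK g hg
  have hγ : ∀ j, (γ j : SL(2, ℤ)) ∈ CongruenceSubgroup.Gamma0 p := fun j => hle (γ j).2
  obtain ⟨hau, hcd⟩ := HidaFamilies.isUnit_and_dvd_of_mem_Gamma0 (hγ i) ha hc
  have hgT : g ∈ HidaFamilies.Tate p := by
    rw [hg]
    exact (HidaFamilies.Tate p).neg_mem (HidaFamilies.totalMeasure_mem_Tate hp hu m hγ v')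
  -- The correction adds `q h = g` to the total measure `-g`.
  have hadj : ∀ (q : HidaFamilies.Tate p) (k : ℕ),
      (q : ℚ_[p]⟦X⟧) * (PowerSeries.coeff k K - PowerSeries.C (if k = 0 then 1 else 0)) = g →
      HidaFamilies.IsAdjusted u m Γ₀ hT γ
        (Function.update v' i (v' i + q • HidaFamilies.momentDist p k)) := fun q k hq => by
    refine HidaFamilies.isAdjusted_of_totalMeasure hp hu m hle _ ?_
    rw [HidaFamilies.totalMeasure_update hp hu m hγ, HidaFamilies.toPadic_apply,
      HidaFamilies.toPadic_apply, ← ha, ← hc, ← hK, hq, hg, add_neg_cancel]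
  constructor
  · intro hm hc0
    have hder : PowerSeries.constantCoeff (PowerSeries.derivative _ K) = PowerSeries.coeff 1 K := by
      rw [← PowerSeries.coeff_zero_eq_constantCoeff_apply, PowerSeries.coeff_derivative]
      simp
    -- The zero of `g` at `w = 0` compensates the factor `w` of `h`.
    have hg0 : PowerSeries.constantCoeff g = 0 := by
      rw [hg, map_neg, HidaFamilies.constantCoeff_totalMeasure hp hu hm hγ, neg_zero]
    obtain ⟨h1, h2⟩ := HidaFamilies.coeff_one_autFactor hp hu hm hau hcd (by exact_mod_cast hc0)
    rw [← hK] at h1 h2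
    obtain ⟨q, hq⟩ := h2 g hgT hg0
    rw [hder]
    exact ⟨h1, q, hq, hadj q 1 (by simpa using hq)⟩
  · intro _ ham
    have ham' : PadicInt.toZMod (a : ℤ_[p]) ^ m ≠ 1 := by rwa [map_intCast]
    obtain ⟨h1, h2⟩ := HidaFamilies.constantCoeff_autFactor_sub_one hp hu m hau hcd ham'
    rw [← hK] at h1 h2
    obtain ⟨q, hq⟩ := h2 g hgT
    exact ⟨h1, q, hq, hadj q 0 (by simpa using hq)⟩
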